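/- Let $N\ge 2$ be an integer and let $\Omega_N$ be the hierarchical group of order $N$: the sequences $x=(x_1,x_2,\dots)$ with $x_i\in\{0,\dots,N-1\}$, only finitely many nonzero, with addition componentwise mod $N$, and with the distance $d(x,y)=\max\{i:x_i\ne y_i\}$ for $x\neq y$, $d(x,x)=0$. Write $B_k$ for the ball $\{x: d(0,x)\le k\}$. For a function $p$ on the positive integers, consider the random graph on $\Omega_N$ in which distinct $x,y$ are joined by an edge with probability $p_{(d(x,y))}$, independently over pairs. Clusters are connected components. *Percolation occurs* if $0$ lies in an infinite cluster with positive probability. For $K>0$ put $k_n=\lfloor K n\log n\rfloor$, $n\ge1$, and let $X_{k_n}$ be a largest connected component of the subgraph induced on $B_{k_n}$ (ties broken arbitrarily). *Pre-percolation* means that almost surely there is $n_0$ such that for all $n\ge n_0$ some edge joins $B_{k_{n+1}}\setminus B_{k_n}$ to $B_{k_{n+2}}\setminus B_{k_{n+1}}$. Critical case $\delta=1$: connection probabilities are $p_{(k)}=\min(c_k/N^{2k},1)$. For $C\ge 0$, $a>0$, $b\ge 0$, put $g_n=C+a\log n\cdot N^{b\log n}$ and say that $(c_k)$ are *comparison rates*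 with parameters $(K,C,a,b)$ if $c_{k_n}=g_n$ for $n\ge 1$ and $c_{k_n}\le c_j\le c_{k_{n+1}}$ for $k_n<j<k_{n+1}$. (If finitely many of the first $k_n$ coincide, which can happen for small $K$, $c_{k_n}=g_n$ is required only for the largest such index $n$.) **Theorem 3.5.** (a) Let $N\ge3$, $K=1$, $C\ge 0$, $a>0$, and let $(c_k)$ be comparison rates with $c_{k_n}=C+aN\log n$ (parameters $(1,C,aN,0)$). (i) If $a<1$, percolation does not occur. (ii) If $a>1$, pre-percolation occurs. (b) Let $\frac{2}{\log N}<K<b$. There exist $C_*>0$ and $a_*>0$ such that for all $C\ge C_*$, all $a>a_*$ and all comparison rates with parameters $(K,C,a,b)$ the following hold. (1) There is a sequence $\beta_n\in(0,1)$ with $\liminf_n\beta_n>0$ and $$P\bigl(\text{there is } n_{00}\text{ such that } |X_{k_n}|\ge\beta_nN^{k_n}\text{ for all } n\ge n_{00}\bigr)=1;$$ percolation occurs; and almost surely there is exactly one infinite cluster. (2) If moreover $b<2K-\frac1{\log N}$, the infinite cluster is a cascade of the clusters $X_{k_n}$: almost surely there is a (random) $n_0\ge 1$ such that $X_{k_n}\subseteq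 X_{k_{n+1}}$ for $n\ge n_0$, the infinite cluster equals $\bigcup_{n\ge n_0}X_{k_n}$, and for $n\ge n_0$ and $\ell\ge1$ an edge between $X_{k_n}\cap(B_{k_n}\setminus B_{k_{n-1}})$ and $X_{k_{n+\ell}}\cap(B_{k_{n+\ell}}\setminus B_{k_{n+\ell-1}})$ can occur only for $\ell=1,2$. (c) Let $C\ge0$, $a>0$ and $0<b\le\frac2{\log N}<K$, and let the connection probabilities be $p_{(j)}=\min\bigl(g_n/N^{2k_{n+1}},1\bigr)$ for $k_n<j\le k_{n+1}$, $n\ge1$. Then percolation does not occur. -/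

import Mathlib

open MeasureTheory Filter

noncomputable section

/-- The hierarchical group of order `N` (used for `N ≥ 2`): the direct sum of countably many
copies of the cyclic group `ℤ/N`.  The index `i : ℕ` stands for the `(i+1)`-st coordinate. -/
abbrev HierGroup (N : ℕ) : Type := ℕ →₀ ZMod N

namespace HierGroup

/-- The hierarchical distance: the largest (1-based) index of a coordinate at which `x` and `y`
differ, and `0` if `x = y`. -/
def hdist {N : ℕ} (x y : HierGroup N) : ℕ :=
  (x - y).support.sup (fun i => i + 1)

/-- The `k`-ball containing the origin. -/
def ball (N k : ℕ) : Set (HierGroup N) := {x | hdist 0 x ≤ k}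

/-- The `(j, l]`-annulus around the origin. -/
def annulus (N j l : ℕ) : Set (HierGroup N) := {x | j < hdist 0 x ∧ hdist 0 x ≤ l}

/-- The law of a family of independent uniform `[0,1]` variables indexed by the unordered pairs
of points (the variables at diagonal pairs are never used). -/
def edgeLaw (N : ℕ) : Measure (Sym2 (HierGroup N) → unitInterval) :=
  Measure.infinitePi (fun _ => (volume : Measure unitInterval))

theorem hdist_comm {N : ℕ} (x y : HierGroup N) : hdist x y = hdist y x := by
  unfold hdist
  rw [← Finsupp.support_neg (x - y), neg_sub]

/-- The random graph: distinct points `x`, `y` are joined by an edge iff the uniform variable of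
the pair is at most `p (hdist x y)`.  Under `edgeLaw N` all edges are independent. -/
def graph {N : ℕ} (p : ℕ → ℝ) (u : Sym2 (HierGroup N) → unitInterval) :
    SimpleGraph (HierGroup N) where
  Adj x y := x ≠ y ∧ (u s(x, y) : ℝ) ≤ p (hdist x y)
  symm := ⟨fun x y h => ⟨h.1.symm, by rw [Sym2.eq_swap, hdist_comm]; exact h.2⟩⟩
  loopless := ⟨fun _ h => h.1 rfl⟩

/-- Connection probability at distance `k` with rates `c`, in the critical case `δ = 1`, where
`k (1 + δ) = 2 k`. -/
def connProb (N : ℕ) (c : ℕ → ℝ) (k : ℕ) : ℝ := min (c k / (N : ℝ) ^ (2 * k)) 1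

/-- Percolation: with positive probability the origin belongs to an infinite cluster. -/
def Percolates (N : ℕ) (p : ℕ → ℝ) : Prop :=
  0 < edgeLaw N {u | ((graph p u).connectedComponentMk 0).supp.Infinite}

/-- Almost surely there is exactly one infinite cluster. -/
def UniqueInfiniteCluster (N : ℕ) (p : ℕ → ℝ) : Prop :=
  ∀ᵐ u ∂(edgeLaw N), ∃! κ : (graph p u).ConnectedComponent, κ.supp.Infinite

/-- The scales `k_n = ⌊K n log n⌋`. -/
def scale (K : ℝ) (n : ℕ) : ℕ := ⌊K * n * Real.log n⌋₊

/-- Pre-percolation: almost surely, for all large `n` there is an edge between the annuli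
`(k_n, k_{n+1}]` and `(k_{n+1}, k_{n+2}]`. -/
def PrePercolates (N : ℕ) (K : ℝ) (p : ℕ → ℝ) : Prop :=
  ∀ᵐ u ∂(edgeLaw N), ∃ n₀ : ℕ, ∀ n ≥ n₀,
    ∃ x ∈ annulus N (scale K n) (scale K (n + 1)),
      ∃ y ∈ annulus N (scale K (n + 1)) (scale K (n + 2)), (graph p u).Adj x y

/-- The value `C + a log n · N ^ (b log n)`. -/
def scaleRate (N : ℕ) (C a b : ℝ) (n : ℕ) : ℝ :=
  C + a * Real.log n * (N : ℝ) ^ (b * Real.log n)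

/-- Comparison rates: `c_{k_n} = C + a log n · N ^ (b log n)`, and
`c_{k_n} ≤ c_j ≤ c_{k_{n+1}}` for `k_n < j < k_{n+1}`.  If `K` is small, finitely many of the
first `k_n` may coincide; then the largest index with the given value of `k_n` prescribes the
rate.  (The value `c 0` is not a connection rate; it only bounds the rates before the first
positive `k_n`.) -/
structure IsComparisonRate (N : ℕ) (K C a b : ℝ) (c : ℕ → ℝ) : Prop where
  at_scale : ∀ n ≥ 1, scale K n < scale K (n + 1) → c (scale K n) = scaleRate N C a b n
  between : ∀ n ≥ 1, ∀ j, scale K n < j → j < scale K (n + 1) →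
    c (scale K n) ≤ c j ∧ c j ≤ c (scale K (n + 1))

/-- `X` is a connected component of the graph with vertex set `B` that keeps only the edges of
`G` inside `B`. -/
def IsClusterIn {V : Type*} (G : SimpleGraph V) (B X : Set V) : Prop :=
  ∃ κ : (G.induce B).ConnectedComponent, X = Subtype.val '' κ.supp

/-- `X` is a largest cluster of the (finite) set `B`, using only edges inside `B`. -/
def IsLargestClusterIn {V : Type*} (G : SimpleGraph V) (B X : Set V) : Prop :=
  IsClusterIn G B X ∧ ∀ Y, IsClusterIn G B Y → Y.ncard ≤ X.ncard

/-- `X n` is a largest cluster of the ball `B_{k_n}` for every `n`; ties are broken in an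
arbitrary way. -/
def IsClusterSelection {N : ℕ} (K : ℝ) (G : SimpleGraph (HierGroup N))
    (X : ℕ → Set (HierGroup N)) : Prop :=
  ∀ n, IsLargestClusterIn G (ball N (scale K n)) (X n)

/-- The largest clusters of the balls `B_{k_n}` eventually have density at least `β n`. -/
def EventuallyDense (N : ℕ) (K : ℝ) (p : ℕ → ℝ) (β : ℕ → ℝ) : Prop :=
  ∀ᵐ u ∂(edgeLaw N), ∀ X, IsClusterSelection K (graph p u) X →
    ∃ n₀ : ℕ, ∀ n ≥ n₀, β n * (N : ℝ) ^ scale K n ≤ (X n).ncard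

/-- The infinite cluster is a cascade: almost surely, from some `n₀ ≥ 1` on, the largest clusters
`X n` of the balls `B_{k_n}` increase, they fill up the infinite cluster, and edges between
`X n ∩ (B_{k_n} \ B_{k_{n-1}})` and `X (n+l) ∩ (B_{k_{n+l}} \ B_{k_{n+l-1}})`, `l ≥ 1`, occur
only for `l = 1, 2`. -/
def IsCascade (N : ℕ) (K : ℝ) (p : ℕ → ℝ) : Prop :=
  ∀ᵐ u ∂(edgeLaw N), ∀ X, IsClusterSelection K (graph p u) X →
    ∃ n₀ ≥ 1,
      (∀ n ≥ n₀, X n ⊆ X (n + 1)) ∧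
      (∀ κ : (graph p u).ConnectedComponent, κ.supp.Infinite → κ.supp = ⋃ n ≥ n₀, X n) ∧
      ∀ n ≥ n₀, ∀ l ≥ 1,
        (∃ x ∈ X n ∩ (ball N (scale K n) \ ball N (scale K (n - 1))),
          ∃ y ∈ X (n + l) ∩ (ball N (scale K (n + l)) \ ball N (scale K (n + l - 1))),
            (graph p u).Adj x y) → l = 1 ∨ l = 2

end HierGroup

end

/-! The expected number of edges leaving a ball `B_{k_n}` governs every part. Sums over shells
telescope (`sum_shell_inv_pow`), so a rate `c` produces about `c / N` edges from `B_{k_n}` to the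
next shell. The number `M_n` of `k_n`-balls in a `k_{n+1}`-ball is `n ^ (K log N)` up to constants.

In (a) there are about `a log n` edges between consecutive annuli, so none is present with
probability roughly `n ^ (-a)`. For `a > 1` this is summable, and Borel–Cantelli gives
pre-percolation. For `a < 1` the events that no edge joins `B_{k_n}` to the next shell are
independent with divergent probabilities, so infinitely many occur; edges jumping over a whole shell
eventually disappear because `log N > 1`. Hence some `B_{k_n}` is isolated. In (c) the expected
number of edges leaving `B_{k_n}` already tends to `0`.

Part (b) is a renormalization (`Renormalizable`). A `k_n`-ball is good if it has a cluster of
density at least `β n`, and it is bad with probability at most `ε n`. Goodness of disjoint balls is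
independent, so by Chebyshev a `k_{n+1}`-ball has at most a proportion `2 ε n` of bad sub-balls
(`edgeLaw_fewBad_compl_le`). Given this, the large clusters of the good sub-balls fail to be joined
only if some family of at most half of them sends no edge to the rest. One such cluster has of order
`n ^ ((b - K) log N) log n` expected edges to the others, which beats `log M_n` because `K < b`
(`linked_compl_resample_le`). The density drops by `2 ε n` only. With `ε n = (n + 1) ^ (-θ)` this
needs `1 < θ` for summability and `2 θ < K log N` for Chebyshev, which is possible since `K log N >
2`. A large `C` makes the starting balls complete graphs.

For uniqueness, an infinite cluster leaves the balls `B_{k_n}` at infinitely many scales. Each time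
the end point lies in the large cluster of its own `k_n`-ball with conditional probability at least
`3/4`, so by a conditional Borel–Cantelli lemma the cluster eventually joins the increasing large
clusters (`ae_frequently_attach`, `ae_giant`). The cascade follows because `b < 2 K - 1 / log N`
makes edges from `B_{k_n}` past `B_{k_{n+2}}` summably rare. -/

noncomputable section

/-! ### Resampling part of the coordinates of a product measure -/

section Merge
variable {ι : Type*} {X : ι → Type*}

open Classical in
/-- The configuration that agrees with `w.1` on `S` and with `w.2` off `S`. -/
def mergeOn (S : Set ι) (w : (∀ i, X i) × (∀ i, X i)) : ∀ i, X i :=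
  fun i => if i ∈ S then w.1 i else w.2 i

theorem mergeOn_of_mem {S : Set ι} {i : ι} (h : i ∈ S) (w : (∀ i, X i) × (∀ i, X i)) :
    mergeOn S w i = w.1 i := by simp [mergeOn, h]

theorem mergeOn_of_notMem {S : Set ι} {i : ι} (h : i ∉ S) (w : (∀ i, X i) × (∀ i, X i)) :
    mergeOn S w i = w.2 i := by simp [mergeOn, h]

/-- The event `E` depends only on the coordinates in `S`. -/
def EventOn (S : Set ι) (E : Set (∀ i, X i)) : Prop :=
  ∀ u v, (∀ i ∈ S, u i = v i) → u ∈ E → v ∈ E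

theorem EventOn.mono {S T : Set ι} {E : Set (∀ i, X i)} (h : EventOn S E) (hST : S ⊆ T) :
    EventOn T E := fun u v huv => h u v fun i hi => huv i (hST hi)

theorem EventOn.mergeOn_mem_iff {S T : Set ι} {E : Set (∀ i, X i)} (h : EventOn S E)
    (hST : S ⊆ T) (w : (∀ i, X i) × (∀ i, X i)) : mergeOn T w ∈ E ↔ w.1 ∈ E :=
  ⟨h _ _ fun _ hi => mergeOn_of_mem (hST hi) w,
    h _ _ fun _ hi => (mergeOn_of_mem (hST hi) w).symm⟩

theorem EventOn.mergeOn_mem_iff_of_disjoint {S T : Set ι} {E : Set (∀ i, X i)} (h : EventOn S E)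
    (hST : Disjoint S T) (w : (∀ i, X i) × (∀ i, X i)) : mergeOn T w ∈ E ↔ w.2 ∈ E :=
  ⟨h _ _ fun _ hi => mergeOn_of_notMem (Set.disjoint_left.1 hST hi) w,
    h _ _ fun _ hi => (mergeOn_of_notMem (Set.disjoint_left.1 hST hi) w).symm⟩

variable [∀ i, MeasurableSpace (X i)]

theorem measurable_mergeOn (S : Set ι) : Measurable (mergeOn (X := X) S) := by
  refine measurable_pi_iff.2 fun i => ?_
  by_cases h : i ∈ S
  · simp only [mergeOn, h, if_true]; fun_prop
  · simp only [mergeOn, h, if_false]; fun_prop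

variable (ν : ∀ i, Measure (X i)) [∀ i, IsProbabilityMeasure (ν i)]

/-- A box pulls back to a product of two boxes, one for the coordinates in `S` and one for the
others, and the product measure is determined by its values on boxes. With Fubini, this freezes the
coordinates in `S` and redraws the rest. -/
theorem measurePreserving_mergeOn (S : Set ι) :
    MeasurePreserving (mergeOn S) ((Measure.infinitePi ν).prod (Measure.infinitePi ν))
      (Measure.infinitePi ν) := by
  classical
  refine ⟨measurable_mergeOn S, Measure.eq_infinitePi _ fun s t ht => ?_⟩
  rw [Measure.map_apply (measurable_mergeOn S)
    (MeasurableSet.pi s.countable_toSet fun i _ => ht i)]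
  have : mergeOn S ⁻¹' (Set.pi (s : Set ι) t)
      = (Set.pi ((s.filter (· ∈ S) : Finset ι) : Set ι) t) ×ˢ
        (Set.pi ((s.filter (· ∉ S) : Finset ι) : Set ι) t) := by
    ext w
    simp only [Set.mem_preimage, Set.mem_pi, Set.mem_prod, Finset.mem_coe, Finset.mem_filter]
    constructor
    · intro h
      exact ⟨fun i hi => by simpa [mergeOn, hi.2] using h i hi.1,
        fun i hi => by simpa [mergeOn, hi.2] using h i hi.1⟩
    · rintro ⟨h1, h2⟩ i hi
      by_cases hS : i ∈ S
      · simpa [mergeOn, hS] using h1 i ⟨hi, hS⟩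
      · simpa [mergeOn, hS] using h2 i ⟨hi, hS⟩
  rw [this, Measure.prod_prod, Measure.infinitePi_pi ν (fun i _ => ht i),
    Measure.infinitePi_pi ν (fun i _ => ht i), Finset.prod_filter_mul_prod_filter_not]


/-- The `σ`-algebra of the measurable events that depend only on the coordinates in `S`. -/
@[reducible] def coordAlgebra (X : ι → Type*) [∀ i, MeasurableSpace (X i)] (S : Set ι) :
    MeasurableSpace (∀ i, X i) where
  MeasurableSet' E := MeasurableSet E ∧ EventOn S E
  measurableSet_empty := ⟨MeasurableSet.empty, fun _ _ _ h => h⟩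
  measurableSet_compl E hE := ⟨hE.1.compl, fun u v huv hu hv =>
    hu (hE.2 v u (fun i hi => (huv i hi).symm) hv)⟩
  measurableSet_iUnion f hf := ⟨MeasurableSet.iUnion fun n => (hf n).1, fun u v huv hu => by
    obtain ⟨n, hn⟩ := Set.mem_iUnion.1 hu
    exact Set.mem_iUnion.2 ⟨n, (hf n).2 u v huv hn⟩⟩

theorem coordAlgebra_mono {S T : Set ι} (h : S ⊆ T) : coordAlgebra X S ≤ coordAlgebra X T :=
  fun _ hE => ⟨hE.1, hE.2.mono h⟩

/-- If, for every frozen part on `S` compatible with the event `A`, resampling the coordinates off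
`S` gives the event `E` with probability at most `δ`, then `P (A ∩ E) ≤ δ P A`. -/
theorem measureReal_inter_le_of_resample {S : Set ι} {A E : Set (∀ i, X i)}
    (hA : MeasurableSet A) (hAS : EventOn S A) (hE : MeasurableSet E) {δ : ℝ} (hδ : 0 ≤ δ)
    (h : ∀ u ∈ A, (Measure.infinitePi ν).real {v | mergeOn S (u, v) ∈ E} ≤ δ) :
    (Measure.infinitePi ν).real (A ∩ E) ≤ δ * (Measure.infinitePi ν).real A := by
  set P := Measure.infinitePi ν
  have hmp := measurePreserving_mergeOn ν S
  have hmE := measurable_mergeOn (X := X) S hE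
  have key : P (A ∩ E) ≤ ENNReal.ofReal δ * P A := by
    rw [← hmp.measure_preimage (hA.inter hE).nullMeasurableSet,
      Measure.prod_apply (measurable_mergeOn S (hA.inter hE))]
    calc ∫⁻ u, P (Prod.mk u ⁻¹' (mergeOn S ⁻¹' (A ∩ E))) ∂P
        ≤ ∫⁻ u, A.indicator (fun _ => ENNReal.ofReal δ) u ∂P := by
          refine lintegral_mono fun u => ?_
          by_cases hu : u ∈ A
          · rw [Set.indicator_of_mem hu]
            refine (measure_mono (t := {v | mergeOn S (u, v) ∈ E}) fun v hv => hv.2).trans ?_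
            rw [← ofReal_measureReal (μ := P)]
            exact ENNReal.ofReal_le_ofReal (h u hu)
          · rw [Set.indicator_of_notMem hu, nonpos_iff_eq_zero]
            convert measure_empty (μ := P)
            refine Set.eq_empty_of_forall_notMem fun v hv => hu ?_
            exact (hAS.mergeOn_mem_iff subset_rfl (u, v)).1 hv.1
      _ = ENNReal.ofReal δ * P A := by rw [lintegral_indicator_const hA]
  have := ENNReal.toReal_mono (by finiteness) key
  rwa [ENNReal.toReal_mul, ENNReal.toReal_ofReal hδ] at this

/-- After merging, `A` reads only the first sample and `E` only the second, so the intersection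
pulls back to a rectangle. -/
theorem measure_inter_eq_mul_of_disjoint {S T : Set ι} {A E : Set (∀ i, X i)}
    (hA : MeasurableSet A) (hAS : EventOn S A) (hE : MeasurableSet E) (hET : EventOn T E)
    (hST : Disjoint S T) :
    Measure.infinitePi ν (A ∩ E) = Measure.infinitePi ν A * Measure.infinitePi ν E := by
  have hmp := measurePreserving_mergeOn ν S
  rw [← hmp.measure_preimage (hA.inter hE).nullMeasurableSet, ← Measure.prod_prod]
  congr 1
  ext w
  simp only [Set.mem_preimage, Set.mem_inter_iff, Set.mem_prod,
    hAS.mergeOn_mem_iff subset_rfl w, hET.mergeOn_mem_iff_of_disjoint hST.symm w]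

end Merge

/-! ### Borel–Cantelli lemmas -/

section BorelCantelli
variable {Ω : Type*} {m0 : MeasurableSpace Ω} {μ : Measure Ω} [IsProbabilityMeasure μ]

/-- A conditional Borel–Cantelli lemma: if `T n` happens infinitely often and each time is
accompanied by `U n` with conditional probability at least `1 - r`, then `U n` happens infinitely
often. -/
theorem ae_frequently_of_frequently_of_filtration (ℱ : ℕ → MeasurableSpace Ω)
    (hℱ : Monotone ℱ) (hle : ∀ n, ℱ n ≤ m0) {T U : ℕ → Set Ω}
    (hT : ∀ n, MeasurableSet[ℱ (n + 1)] (T n)) (hU : ∀ n, MeasurableSet[ℱ (n + 1)] (U n))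
    {r : ℝ} (hr0 : 0 ≤ r) (hr1 : r < 1) {n₀ : ℕ}
    (h : ∀ n ≥ n₀, ∀ B, MeasurableSet[ℱ n] B → μ.real (B ∩ T n ∩ (U n)ᶜ) ≤ r * μ.real (B ∩ T n)) :
    ∀ᵐ ω ∂μ, (∃ᶠ n in atTop, ω ∈ T n) → ∃ᶠ n in atTop, ω ∈ U n := by
  have main : ∀ n ≥ n₀, μ {ω | (∃ᶠ k in atTop, ω ∈ T k) ∧ ∀ k ≥ n, ω ∉ U k} = 0 := by
    intro n hn
    set W := {ω | (∃ᶠ k in atTop, ω ∈ T k) ∧ ∀ k ≥ n, ω ∉ U k} with hW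
    -- Each occurrence of `T` without `U` costs a factor `r`. For the induction, split according to
    -- the first time `m + i` at which `T` occurs (`D` records that it has not occurred before); `U`
    -- fails there, and the hypothesis for `j` applies from time `m + i + 1` on.
    have claim : ∀ j : ℕ, ∀ m ≥ n, ∀ B, MeasurableSet[ℱ m] B →
        μ (W ∩ B) ≤ ENNReal.ofReal (r ^ j) * μ B := by
      intro j
      induction j with
      | zero => intro m _ B _; simpa using measure_mono Set.inter_subset_right
      | succ j ih =>
        intro m hm B hB
        set D : ℕ → Set Ω := fun i => B ∩ (⋂ k ∈ Set.Ico m i, (T k)ᶜ)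
        have hD : ∀ i ≥ m, MeasurableSet[ℱ i] (D i) := by
          intro i hi
          refine MeasurableSet.inter (hℱ hi _ hB) ?_
          refine MeasurableSet.biInter (Set.to_countable _) fun k hk => ?_
          exact (hℱ (Nat.succ_le_of_lt hk.2) _ (hT k)).compl
        have hsub : W ∩ B ⊆ ⋃ i, W ∩ (D (m + i) ∩ T (m + i) ∩ (U (m + i))ᶜ) := by
          rintro ω ⟨hωW, hωB⟩
          have hex : ∃ i, ω ∈ T (m + i) := by
            obtain ⟨k, hk, hk'⟩ := (frequently_atTop.1 hωW.1) m
            exact ⟨k - m, by rwa [Nat.add_sub_cancel' hk]⟩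
          classical
          refine Set.mem_iUnion.2 ⟨Nat.find hex, hωW, ⟨⟨hωB, ?_⟩, Nat.find_spec hex⟩,
            hωW.2 _ (by omega)⟩
          refine Set.mem_iInter₂.2 fun k hk => ?_
          have := Nat.find_min hex (m := k - m) (by have := hk.1; have := hk.2; omega)
          rwa [Nat.add_sub_cancel' hk.1] at this
        have hdisj : Pairwise (Function.onFun Disjoint fun i => D (m + i) ∩ T (m + i)) := by
          intro i i' hii'
          wlog hlt : i < i' generalizing i i'
          · exact (this hii'.symm (by omega)).symm
          refine Set.disjoint_left.2 fun ω h1 h2 => ?_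
          exact (Set.mem_iInter₂.1 h2.1.2 (m + i) ⟨by omega, by omega⟩) h1.2
        have hmeas : ∀ i, MeasurableSet[ℱ (m + i + 1)] (D (m + i) ∩ T (m + i)) := fun i =>
          (hℱ (Nat.le_succ _) _ (hD (m + i) (by omega))).inter (hT _)
        calc μ (W ∩ B) ≤ ∑' i, μ (W ∩ (D (m + i) ∩ T (m + i) ∩ (U (m + i))ᶜ)) :=
              (measure_mono hsub).trans (measure_iUnion_le _)
          _ ≤ ∑' i, ENNReal.ofReal (r ^ (j + 1)) * μ (D (m + i) ∩ T (m + i)) := by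
              refine ENNReal.tsum_le_tsum fun i => ?_
              refine (ih (m + i + 1) (by omega) _ ((hmeas i).inter (hU _).compl)).trans ?_
              rw [pow_succ, ENNReal.ofReal_mul (by positivity), mul_assoc]
              gcongr
              rw [← ofReal_measureReal (μ := μ), ← ofReal_measureReal (μ := μ) (s := D _ ∩ _),
                ← ENNReal.ofReal_mul hr0]
              exact ENNReal.ofReal_le_ofReal (h _ (by omega) _ (hD (m + i) (by omega)))
          _ = ENNReal.ofReal (r ^ (j + 1)) * μ (⋃ i, D (m + i) ∩ T (m + i)) := by
              rw [ENNReal.tsum_mul_left, measure_iUnion hdisj fun i => hle _ _ (hmeas i)]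
          _ ≤ ENNReal.ofReal (r ^ (j + 1)) * μ B := by
              gcongr
              exact Set.iUnion_subset fun i ω hω => hω.1.1
    have hlim : Tendsto (fun j : ℕ => ENNReal.ofReal (r ^ j)) atTop (nhds 0) := by
      simpa using ENNReal.tendsto_ofReal (tendsto_pow_atTop_nhds_zero_of_lt_one hr0 hr1)
    refine nonpos_iff_eq_zero.1 (ge_of_tendsto' hlim fun j => ?_)
    simpa using claim j n le_rfl Set.univ MeasurableSet.univ
  have : ∀ᵐ ω ∂μ, ∀ n ≥ n₀, ω ∉ {ω | (∃ᶠ k in atTop, ω ∈ T k) ∧ ∀ k ≥ n, ω ∉ U k} := by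
    rw [ae_all_iff]; intro n
    by_cases hn : n₀ ≤ n
    · filter_upwards [measure_eq_zero_iff_ae_notMem.1 (main n hn)] with ω hω _ using hω
    · exact ae_of_all _ fun _ h => absurd h hn
  filter_upwards [this] with ω hω hωT
  by_contra hcon
  rw [not_frequently, eventually_atTop] at hcon
  obtain ⟨a, ha⟩ := hcon
  exact hω (max a n₀) (le_max_right _ _) ⟨hωT, fun k hk => ha k (le_trans (le_max_left _ _) hk)⟩

theorem ae_eventually_notMem_of_measureReal_le {s : ℕ → Set Ω} {f : ℕ → ℝ} (hf : Summable f)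
    (h : ∀ᶠ n in atTop, μ.real (s n) ≤ f n) : ∀ᵐ ω ∂μ, ∀ᶠ n in atTop, ω ∉ s n := by
  obtain ⟨n₀, hn₀⟩ := eventually_atTop.1 h
  have hs : Summable fun n => μ.real (s (n + n₀)) :=
    Summable.of_nonneg_of_le (fun _ => measureReal_nonneg) (fun n => hn₀ _ (by omega))
      ((summable_nat_add_iff n₀).2 hf)
  have : ∑' n, μ (s (n + n₀)) ≠ ⊤ := by
    have := hs.tsum_ofReal_ne_top
    simpa using this
  filter_upwards [ae_eventually_notMem this] with ω hω
  obtain ⟨a, ha⟩ := eventually_atTop.1 hω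
  refine eventually_atTop.2 ⟨a + n₀, fun n hn => ?_⟩
  have := ha (n - n₀) (by omega)
  rwa [Nat.sub_add_cancel (by omega)] at this

end BorelCantelli

/-! ### Clusters inside finite sets and the majority cluster -/

namespace SimpleGraph
variable {V : Type*}

/-- The graph on all of `V` that keeps only the edges of `G` with both end points in `B`. -/
def inside (G : SimpleGraph V) (B : Finset V) : SimpleGraph V where
  Adj x y := x ∈ B ∧ y ∈ B ∧ G.Adj x y
  symm := ⟨fun _ _ h => ⟨h.2.1, h.1, h.2.2.symm⟩⟩
  loopless := ⟨fun _ h => h.2.2.ne rfl⟩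

theorem inside_mono (G : SimpleGraph V) {B B' : Finset V} (h : B ⊆ B') :
    G.inside B ≤ G.inside B' := fun _ _ hxy => ⟨h hxy.1, h hxy.2.1, hxy.2.2⟩

theorem inside_le (G : SimpleGraph V) (B : Finset V) : G.inside B ≤ G := fun _ _ h => h.2.2

theorem inside_eq_of_subset {G G' : SimpleGraph V} {B B' : Finset V} (h : B ⊆ B')
    (hG : G.inside B' = G'.inside B') : G.inside B = G'.inside B := by
  ext x y
  have : (G.inside B').Adj x y ↔ (G'.inside B').Adj x y := by rw [hG]
  simp only [inside] at this ⊢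
  constructor
  · rintro ⟨hx, hy, hxy⟩; exact ⟨hx, hy, (this.1 ⟨h hx, h hy, hxy⟩).2.2⟩
  · rintro ⟨hx, hy, hxy⟩; exact ⟨hx, hy, (this.2 ⟨h hx, h hy, hxy⟩).2.2⟩

/-- A set that contains `x` and is closed under adjacency contains everything reachable. -/
theorem Reachable.mem_of_closed {G : SimpleGraph V} {S : Set V} {x y : V} (h : G.Reachable x y)
    (hx : x ∈ S) (hS : ∀ a b, a ∈ S → G.Adj a b → b ∈ S) : y ∈ S := by
  rw [reachable_iff_reflTransGen] at h
  induction h with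
  | refl => exact hx
  | tail _ hab ih => exact hS _ _ ih hab

/-- A finite set containing `x` without outgoing edges would contain the whole cluster of `x`. -/
theorem exists_adj_of_infinite_supp {G : SimpleGraph V} {x : V}
    (h : (G.connectedComponentMk x).supp.Infinite) {Y : Finset V} (hx : x ∈ Y) :
    ∃ a ∈ Y, ∃ y ∉ Y, G.Adj a y := by
  by_contra hcon
  push Not at hcon
  refine h (Y.finite_toSet.subset fun y hy => ?_)
  have hxy : G.Reachable x y := (ConnectedComponent.exact hy).symm
  refine hxy.mem_of_closed (S := Y) hx fun a b ha hab => ?_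
  by_contra hb
  exact hcon a ha b hb hab

open Classical in
/-- The cluster of `x` in `B`, using only edges inside `B`; empty if `x ∉ B`. -/
def clusterOf (G : SimpleGraph V) (B : Finset V) (x : V) : Finset V :=
  B.filter fun y => x ∈ B ∧ (G.inside B).Reachable x y

theorem mem_clusterOf {G : SimpleGraph V} {B : Finset V} {x y : V} :
    y ∈ G.clusterOf B x ↔ y ∈ B ∧ x ∈ B ∧ (G.inside B).Reachable x y := by
  simp [clusterOf]

theorem clusterOf_congr {G G' : SimpleGraph V} {B : Finset V} (h : G.inside B = G'.inside B)
    (x : V) : G.clusterOf B x = G'.clusterOf B x := by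
  ext; simp [mem_clusterOf, h]

theorem clusterOf_subset (G : SimpleGraph V) (B : Finset V) (x : V) : G.clusterOf B x ⊆ B :=
  fun _ h => (mem_clusterOf.1 h).1

theorem clusterOf_mono (G : SimpleGraph V) {B B' : Finset V} (h : B ⊆ B') (x : V) :
    G.clusterOf B x ⊆ G.clusterOf B' x := fun _ hy => by
  rw [mem_clusterOf] at hy ⊢
  exact ⟨h hy.1, h hy.2.1, hy.2.2.mono (G.inside_mono h)⟩

theorem clusterOf_subset_supp (G : SimpleGraph V) (B : Finset V)
    (x : V) : (G.clusterOf B x : Set V) ⊆ (G.connectedComponentMk x).supp :=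
  fun _ hy => ConnectedComponent.sound ((mem_clusterOf.1 hy).2.2.mono (G.inside_le B)).symm

theorem clusterOf_eq_of_mem {G : SimpleGraph V} {B : Finset V} {x y : V}
    (h : y ∈ G.clusterOf B x) : G.clusterOf B y = G.clusterOf B x := by
  obtain ⟨hy, hx, hxy⟩ := mem_clusterOf.1 h
  ext z
  simp only [mem_clusterOf]
  exact ⟨fun hz => ⟨hz.1, hx, hxy.trans hz.2.2⟩, fun hz => ⟨hz.1, hy, hxy.symm.trans hz.2.2⟩⟩

open Classical in
/-- The vertices whose cluster in `B` contains more than half of `B`. -/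
def giant (G : SimpleGraph V) (B : Finset V) : Finset V :=
  B.filter fun x => B.card < 2 * (G.clusterOf B x).card

theorem mem_giant {G : SimpleGraph V} {B : Finset V} {x : V} :
    x ∈ G.giant B ↔ x ∈ B ∧ B.card < 2 * (G.clusterOf B x).card := by
  simp [giant]

theorem giant_subset (G : SimpleGraph V) (B : Finset V) : G.giant B ⊆ B :=
  fun _ h => (mem_giant.1 h).1

theorem giant_congr {G G' : SimpleGraph V} {B : Finset V} (h : G.inside B = G'.inside B) :
    G.giant B = G'.giant B := by
  ext; simp [mem_giant, clusterOf_congr h]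

/-- Two clusters that each fill more than half of `B` intersect, hence coincide. So `giant` is empty
or a single cluster, and is defined without any tie-breaking. -/
theorem giant_eq_clusterOf {G : SimpleGraph V} {B : Finset V} {x : V} (hx : x ∈ G.giant B) :
    G.giant B = G.clusterOf B x := by
  classical
  rw [mem_giant] at hx
  ext y
  constructor
  · intro hy
    rw [mem_giant] at hy
    have hne : (G.clusterOf B x ∩ G.clusterOf B y).Nonempty := by
      by_contra hemp
      rw [Finset.not_nonempty_iff_eq_empty, ← Finset.disjoint_iff_inter_eq_empty] at hemp
      have h1 := Finset.card_union_of_disjoint hemp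
      have h2 : (G.clusterOf B x ∪ G.clusterOf B y).card ≤ B.card :=
        Finset.card_le_card (Finset.union_subset (clusterOf_subset ..) (clusterOf_subset ..))
      omega
    obtain ⟨z, hz⟩ := hne
    obtain ⟨hz1, hz2⟩ := Finset.mem_inter.1 hz
    rw [mem_clusterOf] at *
    exact ⟨hy.1, hx.1, hz1.2.2.trans hz2.2.2.symm⟩
  · intro hy
    rw [mem_giant, clusterOf_eq_of_mem hy]
    exact ⟨clusterOf_subset _ _ _ hy, hx.2⟩

theorem reachable_of_mem_giant {G : SimpleGraph V} {B : Finset V} {x y : V} (hx : x ∈ G.giant B)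
    (hy : y ∈ G.giant B) : (G.inside B).Reachable x y := by
  rw [giant_eq_clusterOf hx, mem_clusterOf] at hy
  exact hy.2.2

theorem giant_eq_of_complete {G : SimpleGraph V} {B : Finset V}
    (h : ∀ x ∈ B, ∀ y ∈ B, x ≠ y → G.Adj x y) : G.giant B = B := by
  refine Finset.Subset.antisymm (giant_subset _ _) fun x hx => mem_giant.2 ⟨hx, ?_⟩
  have : G.clusterOf B x = B := by
    refine Finset.Subset.antisymm (clusterOf_subset _ _ _) fun y hy => mem_clusterOf.2 ⟨hy, hx, ?_⟩
    by_cases hxy : x = y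
    · rw [hxy]
    · exact Adj.reachable ⟨hx, hy, h x hx y hy hxy⟩
  rw [this]
  have := Finset.card_pos.2 ⟨x, hx⟩
  omega

end SimpleGraph

/-! ### Largest clusters as finite sets, and the ultrametric geometry of balls -/

namespace HierGroup
open SimpleGraph

theorem reachable_induce_iff {V : Type*} (G : SimpleGraph V) (B : Finset V) (x y : (B : Set V)) :
    (G.induce (B : Set V)).Reachable x y ↔ (G.inside B).Reachable x.1 y.1 := by
  constructor
  · intro h
    have := h.mem_of_closed (S := {z : (B : Set V) | (G.inside B).Reachable x.1 z.1})
      (by exact Reachable.refl x.1)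
      fun a b ha hab => Reachable.trans ha (Adj.reachable ⟨a.2, b.2, hab⟩)
    exact this
  · intro h
    have := h.mem_of_closed (S := {z | ∃ hz : z ∈ (B : Set V),
      (G.induce (B : Set V)).Reachable x ⟨z, hz⟩}) ⟨x.2, Reachable.refl _⟩ (by
        rintro a b ⟨ha, hxa⟩ ⟨_, hb, hab⟩
        exact ⟨hb, hxa.trans (Adj.reachable (by exact hab))⟩)
    exact this.2

theorem isClusterIn_iff {V : Type*} (G : SimpleGraph V) (B : Finset V) (X : Set V) :
    IsClusterIn G B X ↔ ∃ x ∈ B, X = G.clusterOf B x := by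
  have key : ∀ x : (B : Set V),
      Subtype.val '' ((G.induce (B : Set V)).connectedComponentMk x).supp
        = (G.clusterOf B x.1 : Set V) := by
    intro x
    ext y
    simp only [Set.mem_image, Finset.mem_coe, mem_clusterOf, ConnectedComponent.mem_supp_iff,
      ConnectedComponent.eq]
    constructor
    · rintro ⟨z, hz, rfl⟩
      exact ⟨z.2, x.2, (reachable_induce_iff G B x z).1 hz.symm⟩
    · rintro ⟨hy, hx, hxy⟩
      exact ⟨⟨y, hy⟩, ((reachable_induce_iff G B x ⟨y, hy⟩).2 hxy).symm, rfl⟩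
  constructor
  · rintro ⟨κ, rfl⟩
    induction κ using ConnectedComponent.ind with
    | h x => exact ⟨x.1, x.2, key x⟩
  · rintro ⟨x, hx, rfl⟩
    exact ⟨(G.induce (B : Set V)).connectedComponentMk ⟨x, hx⟩, (key ⟨x, hx⟩).symm⟩

/-- If some cluster has a majority, then a largest one has a majority too, and majority clusters are
unique. Ties therefore play no role at good scales. -/
theorem IsLargestClusterIn.eq_giant {V : Type*} {G : SimpleGraph V} {B : Finset V} {X : Set V}
    (h : IsLargestClusterIn G B X) (hg : (G.giant B).Nonempty) : X = G.giant B := by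
  obtain ⟨y, hy⟩ := hg
  obtain ⟨x, hx, rfl⟩ := (isClusterIn_iff G B X).1 h.1
  have hyB := (mem_giant.1 hy)
  have := h.2 (G.clusterOf B y) ((isClusterIn_iff G B _).2 ⟨y, hyB.1, rfl⟩)
  rw [Set.ncard_coe_finset, Set.ncard_coe_finset] at this
  rw [giant_eq_clusterOf (x := x) (mem_giant.2 ⟨hx, by omega⟩)]

variable {N : ℕ}

theorem hdist_le_iff {x y : HierGroup N} {k : ℕ} : hdist x y ≤ k ↔ ∀ i, k ≤ i → x i = y i := by
  unfold hdist
  rw [Finset.sup_le_iff]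
  constructor
  · intro h i hi
    by_contra hne
    have := h i (by simpa [sub_eq_zero] using hne)
    omega
  · intro h i hi
    by_contra hlt
    have := h i (by omega)
    simp [this] at hi

theorem hdist_self (x : HierGroup N) : hdist x x = 0 := by
  rw [← nonpos_iff_eq_zero, hdist_le_iff]; intros; rfl

theorem hdist_eq_zero {x y : HierGroup N} : hdist x y = 0 ↔ x = y := by
  rw [← nonpos_iff_eq_zero, hdist_le_iff]
  exact ⟨fun h => Finsupp.ext fun i => h i (Nat.zero_le i), fun h i _ => by rw [h]⟩

theorem hdist_pos {x y : HierGroup N} (h : x ≠ y) : 0 < hdist x y :=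
  Nat.pos_of_ne_zero fun h0 => h (hdist_eq_zero.1 h0)

theorem hdist_le_trans {x y z : HierGroup N} {k : ℕ} (h1 : hdist x y ≤ k) (h2 : hdist y z ≤ k) :
    hdist x z ≤ k := by
  rw [hdist_le_iff] at *
  exact fun i hi => (h1 i hi).trans (h2 i hi)

/-- The isosceles property of an ultrametric. Because of it, the distance from a point of a central
ball to a point outside depends on the outer point only. -/
theorem hdist_eq_of_lt {x y z : HierGroup N} (h : hdist x y < hdist x z) :
    hdist y z = hdist x z := by
  refine le_antisymm (hdist_le_trans ((hdist_comm y x).trans_le h.le) le_rfl) ?_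
  by_contra hlt
  push Not at hlt
  rcases le_total (hdist x y) (hdist y z) with h' | h'
  · exact absurd (hdist_le_trans h' le_rfl) (by omega)
  · exact absurd (hdist_le_trans le_rfl h') (by omega)

/-- The part of `x` beyond the first `k` coordinates; it labels the `k`-ball of `x`. -/
def center (k : ℕ) (x : HierGroup N) : HierGroup N := x.filter (k ≤ ·)

theorem center_eq_iff {k : ℕ} {x y : HierGroup N} : center k x = center k y ↔ hdist x y ≤ k := by
  rw [hdist_le_iff]
  constructor
  · intro h i hi
    have := DFunLike.congr_fun h i
    simpa [center, hi] using this
  · intro h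
    ext i
    by_cases hi : k ≤ i
    · simpa [center, hi] using h i hi
    · simp [center, hi]

theorem hdist_center (k : ℕ) (x : HierGroup N) : hdist x (center k x) ≤ k := by
  rw [hdist_le_iff]
  intro i hi
  simp [center, hi]

theorem finite_block [NeZero N] (k : ℕ) (x : HierGroup N) : {y | hdist x y ≤ k}.Finite := by
  refine Set.Finite.of_injOn (f := fun y : HierGroup N => fun i : Fin k => y i)
    (t := Set.univ) (fun _ _ => trivial) ?_ Set.finite_univ
  intro y hy z hz h
  simp only [Set.mem_ofPred_eq, hdist_le_iff] at hy hz
  ext i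
  by_cases hi : i < k
  · exact congrFun h ⟨i, hi⟩
  · rw [← hy i (by omega), hz i (by omega)]

/-- The ball of radius `k` around `x`. -/
def block [NeZero N] (k : ℕ) (x : HierGroup N) : Finset (HierGroup N) :=
  (finite_block k x).toFinset

variable [NeZero N]

@[simp] theorem mem_block {k : ℕ} {x y : HierGroup N} : y ∈ block k x ↔ hdist x y ≤ k := by
  simp [block]

theorem coe_block (k : ℕ) : (block k (0 : HierGroup N) : Set (HierGroup N)) = ball N k := by
  ext; simp [ball]

theorem mem_block_self (k : ℕ) (x : HierGroup N) : x ∈ block k x := by simp [hdist_self]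

theorem block_mono {k l : ℕ} (h : k ≤ l) (x : HierGroup N) : block k x ⊆ block l x := fun y => by
  simp only [mem_block]; omega

theorem block_eq {k : ℕ} {x y : HierGroup N} (h : hdist x y ≤ k) : block k x = block k y := by
  ext z
  simp only [mem_block]
  exact ⟨fun hz => hdist_le_trans ((hdist_comm y x).trans_le h) hz, hdist_le_trans h⟩

theorem block_subset_block {k l : ℕ} (h : k ≤ l) {x y : HierGroup N} (hy : y ∈ block l x) :
    block k y ⊆ block l x := by
  rw [mem_block] at hy
  rw [block_eq hy]
  exact block_mono h y

theorem disjoint_block {k : ℕ} {x y : HierGroup N} (h : k < hdist x y) :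
    Disjoint (block k x) (block k y) := by
  rw [Finset.disjoint_left]
  intro z hz hz'
  rw [mem_block] at hz hz'
  rw [hdist_comm] at hz'
  exact absurd (hdist_le_trans hz hz') (by omega)

theorem card_block (k : ℕ) (x : HierGroup N) : (block k x).card = N ^ k := by
  have : (block k x).card = Fintype.card (Fin k → ZMod N) := by
    rw [← Finset.card_univ]
    refine Finset.card_bij (fun y _ => fun i : Fin k => y i) (fun _ _ => Finset.mem_univ _) ?_ ?_
    · intro y hy z hz h
      rw [mem_block, hdist_le_iff] at hy hz
      ext i
      by_cases hi : i < k
      · exact congrFun h ⟨i, hi⟩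
      · rw [← hy i (by omega), hz i (by omega)]
    · intro f _
      refine ⟨Finsupp.onFinset (Finset.range k ∪ x.support)
        (fun i => if h : i < k then f ⟨i, h⟩ else x i) ?_, ?_, ?_⟩
      · intro i hi
        by_cases h : i < k
        · simp [h]
        · simp only [h, dite_false] at hi
          simp [hi]
      · rw [mem_block, hdist_le_iff]
        intro i hi
        simp [Finsupp.onFinset_apply, not_lt.2 hi]
      · funext i
        simp [Finsupp.onFinset_apply]
  rw [this]; simp [ZMod.card]

/-- Labels of the `k`-balls contained in the `l`-ball of `x`. -/
def subBlocks (k l : ℕ) (x : HierGroup N) : Finset (HierGroup N) := (block l x).image (center k)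

theorem mem_block_of_mem_subBlocks {k l : ℕ} (h : k ≤ l) {x z : HierGroup N}
    (hz : z ∈ subBlocks k l x) : z ∈ block l x := by
  obtain ⟨y, hy, rfl⟩ := Finset.mem_image.1 hz
  exact block_subset_block h hy (mem_block.2 (hdist_center k y))

theorem lt_hdist_of_mem_subBlocks {k l : ℕ} {x z z' : HierGroup N} (hz : z ∈ subBlocks k l x)
    (hz' : z' ∈ subBlocks k l x) (h : z ≠ z') : k < hdist z z' := by
  obtain ⟨y, hy, rfl⟩ := Finset.mem_image.1 hz
  obtain ⟨y', hy', rfl⟩ := Finset.mem_image.1 hz'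
  by_contra hcon
  push Not at hcon
  have h1 := center_eq_iff.2 (hdist_le_trans (hdist_le_trans (hdist_center k y) hcon)
    ((hdist_comm _ _).trans_le (hdist_center k y')))
  exact h h1

/-- The `k`-balls with these labels tile the `l`-ball, so comparing cardinalities gives their
number. -/
theorem card_subBlocks {k l : ℕ} (h : k ≤ l) (x : HierGroup N) :
    (subBlocks k l x).card = N ^ (l - k) := by
  have h1 : (block l x).card = ∑ z ∈ subBlocks k l x, (block k z).card := by
    rw [← Finset.card_biUnion]
    · congr 1
      ext y
      simp only [Finset.mem_biUnion]
      constructor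
      · intro hy
        exact ⟨center k y, Finset.mem_image_of_mem _ hy,
          mem_block.2 ((hdist_comm _ _).trans_le (hdist_center k y))⟩
      · rintro ⟨z, hz, hy⟩
        exact block_subset_block h (mem_block_of_mem_subBlocks h hz) hy
    · intro z hz z' hz' hne
      exact disjoint_block (lt_hdist_of_mem_subBlocks hz hz' hne)
  simp only [card_block, Finset.sum_const, smul_eq_mul] at h1
  have hN : 0 < N := Nat.pos_of_ne_zero (NeZero.ne N)
  refine Nat.eq_of_mul_eq_mul_right (pow_pos hN k) ?_
  rw [← h1, ← pow_add, Nat.sub_add_cancel h]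

theorem center_mem_subBlocks {k l : ℕ} {x y : HierGroup N} (hy : y ∈ block l x) :
    center k y ∈ subBlocks k l x := Finset.mem_image_of_mem _ hy

theorem block_center (k : ℕ) (x : HierGroup N) : block k (center k x) = block k x :=
  (block_eq (hdist_center k x)).symm

/-- The annulus of points at distance in `(j, l]` from the origin. -/
def shell (N : ℕ) [NeZero N] (j l : ℕ) : Finset (HierGroup N) := block l 0 \ block j 0

@[simp] theorem mem_shell {j l : ℕ} {x : HierGroup N} :
    x ∈ shell N j l ↔ j < hdist 0 x ∧ hdist 0 x ≤ l := by
  simp [shell, and_comm]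

theorem card_shell {j l : ℕ} (h : j ≤ l) : (shell N j l).card = N ^ l - N ^ j := by
  rw [shell, Finset.card_sdiff_of_subset (block_mono h 0), card_block, card_block]

end HierGroup

/-! ### A second moment bound for counting bad balls -/

open ProbabilityTheory in
/-- Chebyshev's inequality for the number of pairwise independent events that occur. -/
theorem measureReal_count_gt_le {Ω ι : Type*} {m0 : MeasurableSpace Ω} {μ : Measure Ω}
    [IsProbabilityMeasure μ] {Z : Finset ι} (hZ : Z.Nonempty) {E : ι → Set Ω}
    (hE : ∀ z ∈ Z, MeasurableSet (E z))
    (hind : ∀ z ∈ Z, ∀ z' ∈ Z, z ≠ z' → μ (E z ∩ E z') = μ (E z) * μ (E z')) {ε : ℝ}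
    (hε : 0 < ε) (hb : ∀ z ∈ Z, μ.real (E z) ≤ ε) :
    μ.real {ω | 2 * ε * Z.card < ∑ z ∈ Z, (E z).indicator (fun _ => (1 : ℝ)) ω} ≤ 1 / (ε * Z.card) := by
  set X : ι → Ω → ℝ := fun z => (E z).indicator fun _ => 1
  have hm : (0 : ℝ) < Z.card := by exact_mod_cast hZ.card_pos
  have hL : ∀ z ∈ Z, MemLp (X z) 2 μ := fun z hz =>
    memLp_indicator_const 2 (hE z hz) 1 (Or.inr (measure_ne_top _ _))
  have hmean : ∀ z ∈ Z, ∫ ω, X z ω ∂μ = μ.real (E z) := fun z hz => by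
    simp only [X]
    rw [integral_indicator_const _ (hE z hz)]; simp
  have hindep : Set.Pairwise (Z : Set ι) fun i j => IndepFun (X i) (X j) μ := by
    intro i hi j hj hij
    have h := (indepSet_iff_measure_inter_eq_mul (hE i hi) (hE j hj) μ).2 (hind i hi j hj hij)
    exact indep_of_indep_of_le_left (indep_of_indep_of_le_right h
      (MeasurableSpace.comap_indicator_const_le_generateFrom_singleton _ _))
      (MeasurableSpace.comap_indicator_const_le_generateFrom_singleton _ _)
  have hvar : variance (∑ z ∈ Z, X z) μ ≤ ε * Z.card := by
    rw [IndepFun.variance_sum hL hindep]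
    calc ∑ z ∈ Z, variance (X z) μ ≤ ∑ _z ∈ Z, ε := by
          refine Finset.sum_le_sum fun z hz => ?_
          refine (variance_le_expectation_sq (hL z hz).1).trans ?_
          refine le_trans (le_of_eq ?_) (hb z hz)
          rw [← hmean z hz]
          congr 1
          ext ω
          by_cases h : ω ∈ E z <;> simp [X, h]
      _ = ε * Z.card := by rw [Finset.sum_const, nsmul_eq_mul, mul_comm]
  have hsum : MemLp (∑ z ∈ Z, X z) 2 μ := memLp_finsetSum' Z hL
  have hmeanle : ∫ ω, (∑ z ∈ Z, X z) ω ∂μ ≤ ε * Z.card := by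
    simp only [Finset.sum_apply]
    rw [integral_finsetSum Z fun z hz => (hL z hz).integrable (by norm_num)]
    calc ∑ z ∈ Z, ∫ ω, X z ω ∂μ ≤ ∑ _z ∈ Z, ε :=
          Finset.sum_le_sum fun z hz => (hmean z hz).trans_le (hb z hz)
      _ = ε * Z.card := by rw [Finset.sum_const, nsmul_eq_mul, mul_comm]
  -- The mean and the variance are both at most `ε * Z.card`, so exceeding twice that value is a
  -- deviation of at least `ε * Z.card`.
  have hch := meas_ge_le_variance_div_sq hsum (c := ε * Z.card) (by positivity)
  have hsub : {ω | 2 * ε * Z.card < ∑ z ∈ Z, (E z).indicator (fun _ => (1 : ℝ)) ω} ⊆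
      {ω | ε * Z.card ≤ |(∑ z ∈ Z, X z) ω - ∫ ω, (∑ z ∈ Z, X z) ω ∂μ|} := by
    intro ω hω
    have h1 : 2 * ε * Z.card < (∑ z ∈ Z, X z) ω := by
      rw [Finset.sum_apply]; exact hω
    change ε * (Z.card : ℝ) ≤ |(∑ z ∈ Z, X z) ω - ∫ ω, (∑ z ∈ Z, X z) ω ∂μ|
    refine le_trans ?_ (le_abs_self _)
    linarith
  have h2 : μ.real {ω | 2 * ε * Z.card < ∑ z ∈ Z, (E z).indicator (fun _ => (1 : ℝ)) ω}
      ≤ variance (∑ z ∈ Z, X z) μ / (ε * Z.card) ^ 2 :=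
    ENNReal.toReal_le_of_le_ofReal (div_nonneg (variance_nonneg _ _) (by positivity))
      ((measure_mono hsub).trans hch)
  refine h2.trans ?_
  rw [div_le_div_iff₀ (by positivity) (by positivity)]
  nlinarith [mul_pos hε hm]

/-! ### Edge probabilities and local events -/

namespace HierGroup
open SimpleGraph
variable {N : ℕ}

instance : IsProbabilityMeasure (edgeLaw N) := by unfold edgeLaw; infer_instance

theorem measurableSet_open (q : ℝ) : MeasurableSet {t : unitInterval | (t : ℝ) ≤ q} :=
  measurableSet_le measurable_subtype_coe measurable_const

/-- The probability that an edge with connection probability `q` is absent. -/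
def closedProb (q : ℝ) : ℝ := (volume : Measure unitInterval).real {t | ¬ (t : ℝ) ≤ q}

theorem closedProb_nonneg (q : ℝ) : 0 ≤ closedProb q := measureReal_nonneg

theorem one_sub_closedProb (q : ℝ) :
    (volume : Measure unitInterval).real {t | (t : ℝ) ≤ q} = 1 - closedProb q := by
  have := probReal_compl_eq_one_sub (μ := (volume : Measure unitInterval)) (measurableSet_open q)
  have h2 : closedProb q = (volume : Measure unitInterval).real {t | (t : ℝ) ≤ q}ᶜ := rfl
  rw [h2, this]; ring

theorem closedProb_of_one_le {q : ℝ} (h : 1 ≤ q) : closedProb q = 0 := by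
  have : {t : unitInterval | ¬ (t : ℝ) ≤ q} = ∅ :=
    Set.eq_empty_of_forall_notMem fun t ht => ht (t.2.2.trans h)
  rw [closedProb, this, measureReal_empty]

theorem closedProb_of_mem {q : ℝ} (h0 : 0 ≤ q) (h1 : q ≤ 1) : closedProb q = 1 - q := by
  have : {t : unitInterval | ¬ (t : ℝ) ≤ q} = Set.Ioi ⟨q, h0, h1⟩ := by
    ext t; simp [← Subtype.coe_lt_coe]
  rw [closedProb, this, Measure.real, unitInterval.volume_Ioi,
    ENNReal.toReal_ofReal (by simpa using h1)]

theorem closedProb_of_nonpos {q : ℝ} (h : q ≤ 0) : closedProb q = 1 := by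
  refine le_antisymm measureReal_le_one ?_
  rw [← closedProb_of_mem le_rfl zero_le_one |>.trans (sub_zero 1)]
  exact measureReal_mono fun t ht ht' => ht (ht'.trans h)

theorem one_sub_le_closedProb {q f : ℝ} (hf : 0 ≤ f) (hq : q ≤ f) : 1 - f ≤ closedProb q := by
  rcases le_total q 0 with h | h
  · rw [closedProb_of_nonpos h]; linarith
  rcases le_total q 1 with h' | h'
  · rw [closedProb_of_mem h h']; linarith
  · linarith [closedProb_nonneg q]

theorem closedProb_le_exp {q f : ℝ} (hf : 0 ≤ f) (h : min f 1 ≤ q) :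
    closedProb q ≤ Real.exp (-f) := by
  rcases le_total q 1 with h' | h'
  · rw [closedProb_of_mem ((le_min hf zero_le_one).trans h) h']
    rcases eq_or_lt_of_le h' with rfl | h1
    · simpa using (Real.exp_pos _).le
    have : f ≤ q := by
      rcases min_le_iff.1 h with h | h
      · exact h
      · linarith
    linarith [Real.add_one_le_exp (-f)]
  · rw [closedProb_of_one_le h']; positivity

/-- For `f ≤ η / (1 + η)` one has `(1 - f) * (1 + (1 + η) * f) ≥ 1`, hence `1 / (1 - f) ≤ exp ((1 +
η) * f)`. The loss `η` is what the room between `a` and `1` pays for in the subcritical case. -/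
theorem exp_le_closedProb {q f η : ℝ} (hη : 0 < η) (hf : 0 ≤ f) (hq : q ≤ f)
    (hfη : f ≤ η / (1 + η)) : Real.exp (-((1 + η) * f)) ≤ closedProb q := by
  refine le_trans ?_ (one_sub_le_closedProb hf hq)
  rw [Real.exp_neg]
  have h1 : f * (1 + η) ≤ η := (le_div_iff₀ (by positivity)).1 hfη
  have h2 : 0 < 1 - f := by nlinarith
  rw [inv_le_comm₀ (Real.exp_pos _) h2]
  refine le_trans ?_ (Real.add_one_le_exp _)
  rw [inv_le_iff_one_le_mul₀ h2]
  nlinarith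

/-- No edge joins `A` to `B`. -/
def noEdge (p : ℕ → ℝ) (A B : Finset (HierGroup N)) : Set (Sym2 (HierGroup N) → unitInterval) :=
  {u | ∀ x ∈ A, ∀ y ∈ B, ¬ (graph p u).Adj x y}

theorem noEdge_eq_pi (p : ℕ → ℝ) {A B : Finset (HierGroup N)} (h : Disjoint A B) :
    noEdge p A B = Set.pi (((A ×ˢ B).image fun q => s(q.1, q.2) : Finset _) : Set _)
      fun e => {t : unitInterval | ¬ (t : ℝ) ≤ p (Sym2.lift ⟨hdist, hdist_comm⟩ e)} := by
  ext u
  simp only [noEdge, Set.mem_ofPred_eq, Set.mem_pi, Finset.coe_image, Set.mem_image,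
    Finset.mem_coe, Finset.mem_product, graph]
  constructor
  · rintro hu e ⟨q, ⟨hq1, hq2⟩, rfl⟩
    have hne : q.1 ≠ q.2 := fun he => Finset.disjoint_left.1 h hq1 (he ▸ hq2)
    simpa [hne] using hu _ hq1 _ hq2
  · intro hu x hx y hy hadj
    exact hu _ ⟨(x, y), ⟨hx, hy⟩, rfl⟩ (by simpa using hadj.2)

theorem eventOn_noEdge (p : ℕ → ℝ) (A B : Finset (HierGroup N)) :
    EventOn {e | ∃ x ∈ A, ∃ y ∈ B, e = s(x, y)} (noEdge p A B) := by
  intro u v huv hu x hx y hy hadj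
  refine hu x hx y hy ⟨hadj.1, ?_⟩
  rw [huv _ ⟨x, hx, y, hy, rfl⟩]
  exact hadj.2

/-- Disjointness makes `(x, y) ↦ s(x, y)` injective on `A ×ˢ B`, so the event is a box whose sides
are indexed by the pairs. -/
theorem edgeLaw_noEdge (p : ℕ → ℝ) {A B : Finset (HierGroup N)} (h : Disjoint A B) :
    (edgeLaw N).real (noEdge p A B) = ∏ x ∈ A, ∏ y ∈ B, closedProb (p (hdist x y)) := by
  have hm : ∀ e : Sym2 (HierGroup N), MeasurableSet
      {t : unitInterval | ¬ (t : ℝ) ≤ p (Sym2.lift ⟨hdist, hdist_comm⟩ e)} :=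
    fun _ => (measurableSet_open _).compl
  rw [noEdge_eq_pi p h, Measure.real, edgeLaw, Measure.infinitePi_pi _ fun e _ => hm e, ENNReal.toReal_prod, Finset.prod_image,
    Finset.prod_product]
  · rfl
  · rintro ⟨x, y⟩ hq ⟨x', y'⟩ hq' he
    simp only [Finset.coe_product, Set.mem_prod, Finset.mem_coe] at hq hq'
    rcases Sym2.eq_iff.1 he with ⟨h1, h2⟩ | ⟨h1, h2⟩
    · exact Prod.ext h1 h2
    · exact absurd hq'.2 (Finset.disjoint_left.1 h ((show x = y' from h1) ▸ hq.1))

theorem edgeLaw_noEdge_le (p : ℕ → ℝ) {A B : Finset (HierGroup N)} (h : Disjoint A B)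
    {f : HierGroup N → HierGroup N → ℝ}
    (hf : ∀ x ∈ A, ∀ y ∈ B, 0 ≤ f x y ∧ min (f x y) 1 ≤ p (hdist x y)) :
    (edgeLaw N).real (noEdge p A B) ≤ Real.exp (-∑ x ∈ A, ∑ y ∈ B, f x y) := by
  rw [edgeLaw_noEdge p h, ← Finset.sum_neg_distrib, Real.exp_sum]
  refine Finset.prod_le_prod (fun _ _ => Finset.prod_nonneg fun _ _ => closedProb_nonneg _) ?_
  intro x hx
  rw [← Finset.sum_neg_distrib, Real.exp_sum]
  exact Finset.prod_le_prod (fun _ _ => closedProb_nonneg _) fun y hy =>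
    closedProb_le_exp (hf x hx y hy).1 (hf x hx y hy).2

theorem le_edgeLaw_noEdge (p : ℕ → ℝ) {A B : Finset (HierGroup N)} (h : Disjoint A B)
    {f : HierGroup N → HierGroup N → ℝ} {η : ℝ} (hη : 0 < η)
    (hf : ∀ x ∈ A, ∀ y ∈ B, 0 ≤ f x y ∧ p (hdist x y) ≤ f x y ∧ f x y ≤ η / (1 + η)) :
    Real.exp (-((1 + η) * ∑ x ∈ A, ∑ y ∈ B, f x y)) ≤ (edgeLaw N).real (noEdge p A B) := by
  rw [edgeLaw_noEdge p h, Finset.mul_sum, ← Finset.sum_neg_distrib, Real.exp_sum]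
  refine Finset.prod_le_prod (fun _ _ => (Real.exp_pos _).le) fun x hx => ?_
  rw [Finset.mul_sum, ← Finset.sum_neg_distrib, Real.exp_sum]
  exact Finset.prod_le_prod (fun _ _ => (Real.exp_pos _).le) fun y hy =>
    exp_le_closedProb hη (hf x hx y hy).1 (hf x hx y hy).2.1 (hf x hx y hy).2.2

theorem edgeLaw_adj_le (p : ℕ → ℝ) (x y : HierGroup N) {f : ℝ} (hf : 0 ≤ f)
    (h : p (hdist x y) ≤ f) : (edgeLaw N).real {u | (graph p u).Adj x y} ≤ f := by
  calc (edgeLaw N).real {u | (graph p u).Adj x y}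
      ≤ (edgeLaw N).real ((fun u => u s(x, y)) ⁻¹' {t | (t : ℝ) ≤ p (hdist x y)}) :=
        measureReal_mono fun u hu => hu.2
    _ = (volume : Measure unitInterval).real {t | (t : ℝ) ≤ p (hdist x y)} := by
        rw [Measure.real, Measure.real, edgeLaw, (measurePreserving_eval_infinitePi _
          s(x, y)).measure_preimage (measurableSet_open _).nullMeasurableSet]
    _ ≤ f := by
        rw [one_sub_closedProb]
        linarith [one_sub_le_closedProb hf h]

theorem edgeLaw_exists_adj_le (p : ℕ → ℝ) (A B : Finset (HierGroup N))
    {f : HierGroup N → HierGroup N → ℝ}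
    (hf : ∀ x ∈ A, ∀ y ∈ B, 0 ≤ f x y ∧ p (hdist x y) ≤ f x y) :
    (edgeLaw N).real {u | ∃ x ∈ A, ∃ y ∈ B, (graph p u).Adj x y} ≤ ∑ x ∈ A, ∑ y ∈ B, f x y := by
  have : {u | ∃ x ∈ A, ∃ y ∈ B, (graph p u).Adj x y}
      = ⋃ x ∈ A, ⋃ y ∈ B, {u | (graph p u).Adj x y} := by ext; simp
  rw [this]
  refine (measureReal_biUnion_finset_le _ _).trans (Finset.sum_le_sum fun x hx => ?_)
  refine (measureReal_biUnion_finset_le _ _).trans (Finset.sum_le_sum fun y hy => ?_)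
  exact edgeLaw_adj_le p x y (hf x hx y hy).1 (hf x hx y hy).2

/-- Pairs of points of `B`. -/
def innerEdges (B : Finset (HierGroup N)) : Set (Sym2 (HierGroup N)) := {e | ∀ a ∈ e, a ∈ B}

theorem mem_innerEdges {B : Finset (HierGroup N)} {x y : HierGroup N} :
    s(x, y) ∈ innerEdges B ↔ x ∈ B ∧ y ∈ B := by simp [innerEdges]

theorem innerEdges_mono {B B' : Finset (HierGroup N)} (h : B ⊆ B') :
    innerEdges B ⊆ innerEdges B' := fun _ he a ha => h (he a ha)

theorem disjoint_innerEdges {B B' : Finset (HierGroup N)} (h : Disjoint B B') :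
    Disjoint (innerEdges B) (innerEdges B') := by
  rw [Set.disjoint_left]
  intro e
  induction e with
  | _ x y =>
    intro h1 h2
    exact Finset.disjoint_left.1 h (mem_innerEdges.1 h1).1 (mem_innerEdges.1 h2).1

theorem inside_graph_congr (p : ℕ → ℝ) {B : Finset (HierGroup N)}
    {u v : Sym2 (HierGroup N) → unitInterval} (h : ∀ e ∈ innerEdges B, u e = v e) :
    (graph p u).inside B = (graph p v).inside B := by
  ext x y
  simp only [inside, graph]
  constructor
  · rintro ⟨hx, hy, hne, hxy⟩
    exact ⟨hx, hy, hne, by rwa [← h _ (mem_innerEdges.2 ⟨hx, hy⟩)]⟩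
  · rintro ⟨hx, hy, hne, hxy⟩
    exact ⟨hx, hy, hne, by rwa [h _ (mem_innerEdges.2 ⟨hx, hy⟩)]⟩

theorem adj_of_inside_eq {p : ℕ → ℝ} {u v : Sym2 (HierGroup N) → unitInterval}
    {B : Finset (HierGroup N)} (huv : (graph p u).inside B = (graph p v).inside B)
    {x y : HierGroup N} (hx : x ∈ B) (hy : y ∈ B) (h : (graph p u).Adj x y) :
    (graph p v).Adj x y := by
  have : ((graph p v).inside B).Adj x y := by rw [← huv]; exact ⟨hx, hy, h⟩
  exact this.2.2

/-- The event `E` depends only on the presence of the edges inside `B`. -/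
def IsLocal (p : ℕ → ℝ) (B : Finset (HierGroup N))
    (E : Set (Sym2 (HierGroup N) → unitInterval)) : Prop :=
  ∀ u v, (graph p u).inside B = (graph p v).inside B → u ∈ E → v ∈ E

theorem IsLocal.eventOn {p : ℕ → ℝ} {B : Finset (HierGroup N)}
    {E : Set (Sym2 (HierGroup N) → unitInterval)} (h : IsLocal p B E) :
    EventOn (innerEdges B) E :=
  fun u v huv => h u v (inside_graph_congr p huv)

theorem IsLocal.mono {p : ℕ → ℝ} {B B' : Finset (HierGroup N)}
    {E : Set (Sym2 (HierGroup N) → unitInterval)} (h : IsLocal p B E) (hB : B ⊆ B') :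
    IsLocal p B' E := fun u v huv => h u v (inside_eq_of_subset hB huv)

theorem IsLocal.compl {p : ℕ → ℝ} {B : Finset (HierGroup N)}
    {E : Set (Sym2 (HierGroup N) → unitInterval)} (h : IsLocal p B E) :
    IsLocal p B Eᶜ := fun u v huv hu hv => hu (h v u huv.symm hv)

theorem IsLocal.inter {p : ℕ → ℝ} {B : Finset (HierGroup N)}
    {E F : Set (Sym2 (HierGroup N) → unitInterval)} (h : IsLocal p B E) (h' : IsLocal p B F) :
    IsLocal p B (E ∩ F) := fun u v huv hu => ⟨h u v huv hu.1, h' u v huv hu.2⟩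

/-- A local event is the preimage of a set of patterns of finitely many edges. Thus every event
about clusters in a ball is measurable as soon as it is seen to be local. -/
theorem IsLocal.measurableSet {p : ℕ → ℝ} {B : Finset (HierGroup N)}
    {E : Set (Sym2 (HierGroup N) → unitInterval)} (h : IsLocal p B E) : MeasurableSet E := by
  let f : (Sym2 (HierGroup N) → unitInterval) → (B × B → Prop) :=
    fun u q => (u s(q.1.1, q.2.1) : ℝ) ≤ p (hdist q.1.1 q.2.1)
  have hf : Measurable f := by
    refine measurable_pi_iff.2 fun q => ?_
    have : Measurable fun u : Sym2 (HierGroup N) → unitInterval => (u s(q.1.1, q.2.1) : ℝ) :=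
      measurable_subtype_coe.comp (measurable_pi_apply _)
    exact measurableSet_setOfPred.1 (measurableSet_le this measurable_const)
  have hE : E = f ⁻¹' (f '' E) := by
    refine Set.Subset.antisymm (Set.subset_preimage_image f E) ?_
    rintro v ⟨u, hu, huv⟩
    refine h u v ?_ hu
    ext x y
    simp only [inside, graph]
    constructor
    · rintro ⟨hx, hy, hne, hxy⟩
      exact ⟨hx, hy, hne, (congrFun huv (⟨x, hx⟩, ⟨y, hy⟩)).mp hxy⟩
    · rintro ⟨hx, hy, hne, hxy⟩
      exact ⟨hx, hy, hne, (congrFun huv (⟨x, hx⟩, ⟨y, hy⟩)).mpr hxy⟩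
  rw [hE]
  exact hf (Set.toFinite _).measurableSet

theorem IsLocal.measurableSet_coordAlgebra {p : ℕ → ℝ} {B : Finset (HierGroup N)}
    {E : Set (Sym2 (HierGroup N) → unitInterval)} (h : IsLocal p B E) :
    MeasurableSet[coordAlgebra (fun _ => unitInterval) (innerEdges B)] E :=
  ⟨h.measurableSet, h.eventOn⟩

end HierGroup

/-! ### Separating families and a union bound over them -/

/-- An equivalence relation on a finite set that is not total admits a
separating set containing at most half of the points. -/
theorem exists_half_separating {ι : Type*} [DecidableEq ι] (s : Finset ι) (R : ι → ι → Prop)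
    (hrefl : ∀ a ∈ s, R a a) (hsymm : ∀ a b, R a b → R b a)
    (htrans : ∀ a ∈ s, ∀ b ∈ s, ∀ c ∈ s, R a b → R b c → R a c)
    {z z' : ι} (hz : z ∈ s) (hz' : z' ∈ s) (hR : ¬ R z z') :
    ∃ t ⊆ s, t.Nonempty ∧ 2 * t.card ≤ s.card ∧ ∀ a ∈ t, ∀ b ∈ s \ t, ¬ R a b := by
  classical
  have hzz := hrefl z hz
  -- The class of `z` separates; if it has more than half of the points, its complement is used
  -- instead, which is nonempty because it contains `z'`.
  set t := s.filter fun a => R z a with ht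
  have h1 : ∀ a ∈ t, ∀ b ∈ s \ t, ¬ R a b := by
    intro a ha b hb hab
    simp only [ht, Finset.mem_filter, Finset.mem_sdiff, not_and] at ha hb
    exact hb.2 hb.1 (htrans z hz a ha.1 b hb.1 ha.2 hab)
  have hcard := Finset.card_sdiff_add_card_eq_card (Finset.filter_subset (fun a => R z a) s)
  by_cases hle : 2 * t.card ≤ s.card
  · exact ⟨t, Finset.filter_subset _ _, ⟨z, Finset.mem_filter.2 ⟨hz, hzz⟩⟩, hle, h1⟩
  · refine ⟨s \ t, Finset.sdiff_subset, ⟨z', ?_⟩, ?_, ?_⟩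
    · simp [ht, hz', hR]
    · change (s \ t).card + t.card = s.card at hcard
      omega
    · intro a ha b hb hab
      rw [Finset.sdiff_sdiff_eq_self (Finset.filter_subset _ _)] at hb
      exact h1 b hb a ha (hsymm _ _ hab)

/-- By the binomial theorem the sum over all subsets is `(1 + x) ^ s.card ≤ exp (m * x) ≤ 1 + 2 * (m
* x)`, and the empty set contributes the `1`. -/
theorem sum_nonempty_pow_card_le {ι : Type*} [DecidableEq ι] (s : Finset ι) {x m : ℝ} (hx : 0 ≤ x)
    (hs : (s.card : ℝ) ≤ m) (hmx : m * x ≤ 1) :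
    ∑ t ∈ s.powerset.erase ∅, x ^ t.card ≤ 2 * (m * x) := by
  have h1 : ∑ t ∈ s.powerset, x ^ t.card = (1 + x) ^ s.card := by
    rw [← Finset.prod_const, Finset.prod_one_add]
    simp
  have h2 := Finset.add_sum_erase s.powerset (fun t => x ^ t.card) (Finset.empty_mem_powerset s)
  simp only [Finset.card_empty, pow_zero] at h2
  have h3 : (1 + x) ^ s.card ≤ Real.exp (m * x) := by
    calc (1 + x) ^ s.card ≤ Real.exp x ^ s.card := by
          gcongr
          linarith [Real.add_one_le_exp x]
      _ = Real.exp (s.card * x) := by rw [← Real.exp_nat_mul]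
      _ ≤ Real.exp (m * x) := by gcongr
  have h0 : 0 ≤ m * x := mul_nonneg ((Nat.cast_nonneg _).trans hs) hx
  have h4 : Real.exp (m * x) ≤ 1 + 2 * (m * x) := by
    have := Real.abs_exp_sub_one_le (x := m * x) (by rwa [abs_of_nonneg h0])
    rw [abs_of_nonneg h0] at this
    linarith [le_abs_self (Real.exp (m * x) - 1)]
  linarith

theorem indicator_compl_eq {Ω : Type*} {E : Set Ω} {u v : Ω} (h : u ∈ E ↔ v ∈ E) :
    Eᶜ.indicator (fun _ => (1 : ℝ)) u = Eᶜ.indicator (fun _ => (1 : ℝ)) v := by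
  by_cases hv : v ∈ E
  · rw [Set.indicator_of_notMem (not_not.2 (h.2 hv) : u ∉ Eᶜ),
      Set.indicator_of_notMem (not_not.2 hv : v ∉ Eᶜ)]
  · rw [Set.indicator_of_mem (show u ∈ Eᶜ from fun h' => hv (h.1 h')),
      Set.indicator_of_mem (show v ∈ Eᶜ from hv)]

/-! ### One renormalization step -/

namespace HierGroup
open SimpleGraph
variable {N : ℕ} [NeZero N] (p : ℕ → ℝ)

/-- The largest cluster of the `k`-ball of `z` has density at least `β`. -/
def goodEvent (β : ℝ) (k : ℕ) (z : HierGroup N) : Set (Sym2 (HierGroup N) → unitInterval) :=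
  {u | β * (N : ℝ) ^ k ≤ ((graph p u).giant (block k z)).card}

theorem isLocal_goodEvent (β : ℝ) (k : ℕ) (z : HierGroup N) :
    IsLocal p (block k z) (goodEvent p β k z) := fun u v huv hu => by
  simp only [goodEvent, Set.mem_ofPred_eq] at hu ⊢
  rwa [giant_congr huv] at hu

/-- At most a proportion `2 ε` of the `k`-balls inside the `l`-ball of `x` is bad. -/
def fewBad (β ε : ℝ) (k l : ℕ) (x : HierGroup N) : Set (Sym2 (HierGroup N) → unitInterval) :=
  {u | ∑ z ∈ subBlocks k l x, (goodEvent p β k z)ᶜ.indicator (fun _ => (1 : ℝ)) u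
    ≤ 2 * ε * (subBlocks k l x).card}

/-- The large clusters of the good `k`-balls inside the `l`-ball of `x` are connected with each
other inside the `l`-ball. -/
def linked (β : ℝ) (k l : ℕ) (x : HierGroup N) : Set (Sym2 (HierGroup N) → unitInterval) :=
  {u | ∀ z ∈ subBlocks k l x, ∀ z' ∈ subBlocks k l x, u ∈ goodEvent p β k z →
    u ∈ goodEvent p β k z' → ∀ a ∈ (graph p u).giant (block k z),
    ∀ b ∈ (graph p u).giant (block k z'), ((graph p u).inside (block l x)).Reachable a b}

variable {p}

theorem goodEvent_iff_of_inside_eq {B : Finset (HierGroup N)} {β : ℝ} {k : ℕ} {z : HierGroup N}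
    (hz : block k z ⊆ B) {u v : Sym2 (HierGroup N) → unitInterval}
    (h : (graph p u).inside B = (graph p v).inside B) :
    u ∈ goodEvent p β k z ↔ v ∈ goodEvent p β k z :=
  ⟨((isLocal_goodEvent p β k z).mono hz) u v h, ((isLocal_goodEvent p β k z).mono hz) v u h.symm⟩

theorem block_subset_of_mem_subBlocks {k l : ℕ} (hkl : k ≤ l) {x z : HierGroup N}
    (hz : z ∈ subBlocks k l x) : block k z ⊆ block l x :=
  block_subset_block hkl (mem_block_of_mem_subBlocks hkl hz)

theorem isLocal_fewBad {β ε : ℝ} {k l : ℕ} (hkl : k ≤ l) (x : HierGroup N) :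
    IsLocal p (block l x) (fewBad p β ε k l x) := fun u v huv hu => by
  simp only [fewBad, Set.mem_ofPred_eq] at hu ⊢
  refine le_trans (Finset.sum_le_sum fun z hz => le_of_eq ?_) hu
  exact indicator_compl_eq
    (goodEvent_iff_of_inside_eq (block_subset_of_mem_subBlocks hkl hz) huv).symm

theorem isLocal_linked {β : ℝ} {k l : ℕ} (hkl : k ≤ l) (x : HierGroup N) :
    IsLocal p (block l x) (linked p β k l x) := fun u v huv hu z hz z' hz' hg hg' a ha b hb => by
  have hs := block_subset_of_mem_subBlocks hkl hz
  have hs' := block_subset_of_mem_subBlocks hkl hz'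
  rw [← huv]
  refine hu z hz z' hz' ((goodEvent_iff_of_inside_eq hs huv).2 hg)
    ((goodEvent_iff_of_inside_eq hs' huv).2 hg') a ?_ b ?_
  · rwa [giant_congr (inside_eq_of_subset hs huv)]
  · rwa [giant_congr (inside_eq_of_subset hs' huv)]

/-- The pairs of points at distance at most `k`. -/
def nearPairs (N k : ℕ) [NeZero N] : Set (Sym2 (HierGroup N)) :=
  {e | ∃ z : HierGroup N, e ∈ innerEdges (block k z)}

theorem inside_mergeOn_nearPairs (k : ℕ) (z : HierGroup N)
    (w : (Sym2 (HierGroup N) → unitInterval) × (Sym2 (HierGroup N) → unitInterval)) :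
    (graph p (mergeOn (nearPairs N k) w)).inside (block k z)
      = (graph p w.1).inside (block k z) :=
  inside_graph_congr p fun _ he => mergeOn_of_mem (S := nearPairs N k) ⟨z, he⟩ w

/-- Goodness of `k`-balls is read off the pairs at distance at most `k`. Conditioning on it leaves
all longer edges fresh. -/
theorem eventOn_fewBad (β ε : ℝ) (k l : ℕ) (x : HierGroup N) :
    EventOn (nearPairs N k) (fewBad p β ε k l x) := fun u v huv hu => by
  simp only [fewBad, Set.mem_ofPred_eq] at hu ⊢
  refine le_trans (Finset.sum_le_sum fun z _ => le_of_eq ?_) hu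
  exact indicator_compl_eq (goodEvent_iff_of_inside_eq subset_rfl
    (inside_graph_congr p (B := block k z) fun e he => huv e ⟨z, he⟩)).symm

open Classical in
theorem le_card_good_of_mem_fewBad {β ε : ℝ} {k l : ℕ} {x : HierGroup N}
    {u : Sym2 (HierGroup N) → unitInterval} (hu : u ∈ fewBad p β ε k l x) :
    (1 - 2 * ε) * (subBlocks k l x).card
      ≤ ((subBlocks k l x).filter fun z => u ∈ goodEvent p β k z).card := by
  set Z := subBlocks k l x with hZ
  have h1 : ∑ z ∈ Z, (goodEvent p β k z)ᶜ.indicator (fun _ => (1 : ℝ)) u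
      = (Z.filter fun z => ¬ u ∈ goodEvent p β k z).card := by
    rw [← Finset.sum_boole]
    refine Finset.sum_congr rfl fun z _ => ?_
    by_cases h : u ∈ goodEvent p β k z <;> simp [h]
  have h2 : (Z.filter fun z => ¬ u ∈ goodEvent p β k z).card ≤ 2 * ε * (Z.card : ℝ) :=
    h1 ▸ hu
  have h3 : ((Z.filter fun z => u ∈ goodEvent p β k z).card : ℝ)
      + (Z.filter fun z => ¬ u ∈ goodEvent p β k z).card = Z.card := by
    exact_mod_cast Finset.card_filter_add_card_filter_not _
  linarith

/-- Distinct `k`-balls have disjoint sets of inner edges, so their badness events are independent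
and Chebyshev's inequality applies. -/
theorem edgeLaw_fewBad_compl_le {β ε : ℝ} {k l : ℕ} (hkl : k ≤ l) (hε : 0 < ε) (x : HierGroup N)
    (hbad : ∀ z, (edgeLaw N).real (goodEvent p β k z)ᶜ ≤ ε) :
    (edgeLaw N).real (fewBad p β ε k l x)ᶜ ≤ 1 / (ε * (N : ℝ) ^ (l - k)) := by
  have hne : (subBlocks k l x).Nonempty := ⟨_, center_mem_subBlocks (mem_block_self l x)⟩
  have h := measureReal_count_gt_le (μ := edgeLaw N) hne
    (E := fun z => (goodEvent p β k z)ᶜ)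
    (fun z _ => (isLocal_goodEvent p β k z).measurableSet.compl) ?_ hε fun z _ => hbad z
  · rw [card_subBlocks hkl, Nat.cast_pow] at h
    refine le_trans (le_of_eq ?_) h
    congr 1
    ext u
    simp only [fewBad, Set.mem_compl_iff, Set.mem_ofPred_eq, not_le, card_subBlocks hkl,
      Nat.cast_pow]
  · intro z hz z' hz' hne
    exact measure_inter_eq_mul_of_disjoint _ (isLocal_goodEvent p β k z).measurableSet.compl
      (isLocal_goodEvent p β k z).compl.eventOn
      (isLocal_goodEvent p β k z').measurableSet.compl (isLocal_goodEvent p β k z').compl.eventOn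
      (disjoint_innerEdges (disjoint_block (lt_hdist_of_mem_subBlocks hz hz' hne)))

-- Freeze the near pairs; this fixes the large clusters `Γ z` of the good balls. If they are not all
-- joined, some nonempty family `t` of at most half of the good balls sends no edge to the other
-- good ones. At least `t.card * N ^ k / 2` points face at least `N ^ (l - k) / 4 * (N ^ k / 2)`
-- others, which explains the `16` in `r`: the family `t` is isolated with probability at most `r ^
-- t.card`. Summing over `t` gives the bound.
open Classical in
theorem linked_compl_resample_le {β ε lam : ℝ} {k l : ℕ} (hkl : k ≤ l) (hβ : 1 / 2 ≤ β)
    (hε : 2 * ε ≤ 1 / 2) (hlam : 0 ≤ lam) (hp : ∀ j, k < j → j ≤ l → min lam 1 ≤ p j)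
    (x : HierGroup N) {r : ℝ} (hr : r = Real.exp (-(lam * (N : ℝ) ^ (2 * k) * (N : ℝ) ^ (l - k) / 16)))
    (hMr : (N : ℝ) ^ (l - k) * r ≤ 1) {u : Sym2 (HierGroup N) → unitInterval}
    (hu : u ∈ fewBad p β ε k l x) :
    (edgeLaw N).real {v | mergeOn (nearPairs N k) (u, v) ∈ (linked p β k l x)ᶜ}
      ≤ 2 * ((N : ℝ) ^ (l - k) * r) := by
  have hN : (0 : ℝ) < N := Nat.cast_pos.2 (Nat.pos_of_ne_zero (NeZero.ne N))
  set Z := subBlocks k l x with hZ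
  have hZcard : (Z.card : ℝ) = (N : ℝ) ^ (l - k) := by rw [hZ, card_subBlocks hkl, Nat.cast_pow]
  set S := Z.filter fun z => u ∈ goodEvent p β k z with hS
  set Γ : HierGroup N → Finset (HierGroup N) := fun z => (graph p u).giant (block k z) with hΓ
  have hSZ : S ⊆ Z := Finset.filter_subset _ _
  have hScard : (Z.card : ℝ) / 2 ≤ S.card := by
    have h3 := le_card_good_of_mem_fewBad hu
    nlinarith [(Nat.cast_nonneg Z.card : (0 : ℝ) ≤ Z.card)]
  have hΓcard : ∀ z ∈ S, (N : ℝ) ^ k / 2 ≤ (Γ z).card := fun z hz => by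
    have h1 : β * (N : ℝ) ^ k ≤ (Γ z).card := (Finset.mem_filter.1 hz).2
    nlinarith [pow_pos hN k]
  have hΓsub : ∀ z, Γ z ⊆ block k z := fun z => giant_subset _ _
  have hblock : ∀ z ∈ S, block k z ⊆ block l x := fun z hz =>
    block_subset_of_mem_subBlocks hkl (hSZ hz)
  have hfar : ∀ z ∈ S, ∀ z' ∈ S, z ≠ z' → ∀ a ∈ Γ z, ∀ b ∈ Γ z', k < hdist a b := by
    intro z hz z' hz' hne a ha b hb
    by_contra hcon
    have h1 := mem_block.1 (hΓsub z ha)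
    have h2 := mem_block.1 (hΓsub z' hb)
    rw [hdist_comm] at h2
    exact absurd (hdist_le_trans h1 (hdist_le_trans (not_lt.1 hcon) h2))
      (not_le.2 (lt_hdist_of_mem_subBlocks (hSZ hz) (hSZ hz') hne))
  have hsub : {v | mergeOn (nearPairs N k) (u, v) ∈ (linked p β k l x)ᶜ} ⊆
      ⋃ t ∈ (S.powerset.erase ∅).filter fun t => 2 * t.card ≤ S.card,
        noEdge p (t.biUnion Γ) ((S \ t).biUnion Γ) := by
    intro v hv
    set w := mergeOn (nearPairs N k) (u, v) with hw
    have hin : ∀ z, (graph p w).inside (block k z) = (graph p u).inside (block k z) := fun z =>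
      inside_mergeOn_nearPairs k z (u, v)
    have hΓw : ∀ z, (graph p w).giant (block k z) = Γ z := fun z => giant_congr (hin z)
    have hgood : ∀ z, w ∈ goodEvent p β k z ↔ u ∈ goodEvent p β k z := fun z =>
      goodEvent_iff_of_inside_eq subset_rfl (hin z)
    simp only [linked, Set.mem_compl_iff, Set.mem_ofPred_eq] at hv
    push Not at hv
    obtain ⟨z, hz, z', hz', hg, hg', a, ha, b, hb, hab⟩ := hv
    rw [hgood] at hg hg'
    rw [hΓw] at ha hb
    have hreach : ∀ z ∈ S, ∀ a ∈ Γ z, ∀ b ∈ Γ z,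
        ((graph p w).inside (block l x)).Reachable a b := by
      intro z hz a ha b hb
      rw [← hΓw] at ha hb
      exact (reachable_of_mem_giant ha hb).mono (inside_mono _ (hblock z hz))
    obtain ⟨t, htS, htne, htcard, ht⟩ := exists_half_separating S
      (fun z z' => ∀ a ∈ Γ z, ∀ b ∈ Γ z', ((graph p w).inside (block l x)).Reachable a b)
      hreach (fun z z' h a ha b hb => (h b hb a ha).symm)
      (fun z _ z' hz' z'' _ h h' a ha b hb => by
        have hpos : (0 : ℝ) < (Γ z').card := lt_of_lt_of_le (by positivity) (hΓcard z' hz')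
        obtain ⟨c, hc⟩ := Finset.card_pos.1 (Nat.cast_pos.1 hpos)
        exact (h a ha c hc).trans (h' c hc b hb))
      (Finset.mem_filter.2 ⟨hz, hg⟩) (Finset.mem_filter.2 ⟨hz', hg'⟩)
      (fun h => hab (h a ha b hb))
    simp only [Set.mem_iUnion]
    refine ⟨t, by simp [htS, htne.ne_empty, htcard], ?_⟩
    intro a ha b hb hadj
    obtain ⟨y, hy, ha⟩ := Finset.mem_biUnion.1 ha
    obtain ⟨y', hy', hb⟩ := Finset.mem_biUnion.1 hb
    have hyS := htS hy
    have hy'S := (Finset.mem_sdiff.1 hy').1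
    have hne : y ≠ y' := fun h => (Finset.mem_sdiff.1 hy').2 (h ▸ hy)
    -- Points of different `k`-balls are more than `k` apart, so this edge is taken from the
    -- resampled configuration `v`.
    have hnear : s(a, b) ∉ nearPairs N k := by
      rintro ⟨c, hc⟩
      obtain ⟨hc1, hc2⟩ := mem_innerEdges.1 hc
      rw [mem_block] at hc1 hc2
      rw [hdist_comm] at hc1
      exact absurd (hdist_le_trans hc1 hc2) (not_le.2 (hfar y hyS y' hy'S hne a ha b hb))
    have hadjw : ((graph p w).inside (block l x)).Adj a b := by
      refine ⟨hblock y hyS (hΓsub y ha), hblock y' hy'S (hΓsub y' hb), hadj.1, ?_⟩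
      rw [hw, mergeOn_of_notMem hnear]
      exact hadj.2
    exact ht y hy y' hy' fun a' ha' b' hb' =>
      ((hreach y hyS a' ha' a ha).trans hadjw.reachable).trans (hreach y' hy'S b hb b' hb')
  have hbound : ∀ t ∈ (S.powerset.erase ∅).filter fun t => 2 * t.card ≤ S.card,
      (edgeLaw N).real (noEdge p (t.biUnion Γ) ((S \ t).biUnion Γ)) ≤ r ^ t.card := by
    intro t ht
    simp only [Finset.mem_filter, Finset.mem_erase, Finset.mem_powerset] at ht
    obtain ⟨⟨_, htS⟩, htcard⟩ := ht
    have hcardU : ∀ T ⊆ S, (T.card : ℝ) * ((N : ℝ) ^ k / 2) ≤ (T.biUnion Γ).card := by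
      intro T hT
      rw [Finset.card_biUnion]
      · push_cast
        rw [← nsmul_eq_mul, ← Finset.sum_const]
        exact Finset.sum_le_sum fun z hz => hΓcard z (hT hz)
      · intro z hz z' hz' hne
        exact (disjoint_block (lt_hdist_of_mem_subBlocks (hSZ (hT hz)) (hSZ (hT hz')) hne)).mono
          (hΓsub z) (hΓsub z')
    have hfar' : ∀ a ∈ t.biUnion Γ, ∀ b ∈ (S \ t).biUnion Γ, k < hdist a b ∧ hdist a b ≤ l := by
      intro a ha b hb
      obtain ⟨y, hy, ha⟩ := Finset.mem_biUnion.1 ha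
      obtain ⟨y', hy', hb⟩ := Finset.mem_biUnion.1 hb
      have hyS := htS hy
      have hy'S := (Finset.mem_sdiff.1 hy').1
      refine ⟨hfar y hyS y' hy'S (fun h => (Finset.mem_sdiff.1 hy').2 (h ▸ hy)) a ha b hb, ?_⟩
      have h1 := mem_block.1 (hblock y hyS (hΓsub y ha))
      have h2 := mem_block.1 (hblock y' hy'S (hΓsub y' hb))
      rw [hdist_comm] at h1
      exact hdist_le_trans h1 h2
    have hdisj : Disjoint (t.biUnion Γ) ((S \ t).biUnion Γ) := by
      rw [Finset.disjoint_left]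
      intro a ha hb
      have := (hfar' a ha a hb).1
      rw [hdist_self] at this
      omega
    refine (edgeLaw_noEdge_le p hdisj (f := fun _ _ => lam) fun a ha b hb =>
      ⟨hlam, hp _ (hfar' a ha b hb).1 (hfar' a ha b hb).2⟩).trans ?_
    rw [hr, ← Real.exp_nat_mul, Real.exp_le_exp]
    simp only [Finset.sum_const, nsmul_eq_mul]
    have h1 := hcardU t htS
    have h2 := hcardU (S \ t) Finset.sdiff_subset
    -- At least half of the sub-balls are good, and `t` contains at most half of those.
    have h3 : (N : ℝ) ^ (l - k) / 4 ≤ ((S \ t).card : ℝ) := by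
      have h4 : ((S \ t).card : ℝ) + t.card = S.card := by
        exact_mod_cast Finset.card_sdiff_add_card_eq_card htS
      have h5 : 2 * (t.card : ℝ) ≤ S.card := by exact_mod_cast htcard
      rw [hZcard] at hScard
      linarith
    have hk := pow_pos hN k
    have h6 : (N : ℝ) ^ (l - k) / 4 * ((N : ℝ) ^ k / 2) ≤ (((S \ t).biUnion Γ).card : ℝ) :=
      (mul_le_mul_of_nonneg_right h3 (by positivity)).trans h2
    have h7 := mul_le_mul h1 h6 (by positivity) (by positivity)
    have h8 := mul_le_mul_of_nonneg_right h7 hlam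
    have h9 : (N : ℝ) ^ (2 * k) = (N : ℝ) ^ k * (N : ℝ) ^ k := by rw [two_mul, pow_add]
    rw [h9]
    nlinarith [h8]
  calc (edgeLaw N).real {v | mergeOn (nearPairs N k) (u, v) ∈ (linked p β k l x)ᶜ}
      ≤ ∑ t ∈ (S.powerset.erase ∅).filter fun t => 2 * t.card ≤ S.card,
          (edgeLaw N).real (noEdge p (t.biUnion Γ) ((S \ t).biUnion Γ)) :=
        (measureReal_mono hsub (measure_ne_top _ _)).trans (measureReal_biUnion_finset_le _ _)
    _ ≤ ∑ t ∈ (S.powerset.erase ∅).filter fun t => 2 * t.card ≤ S.card, r ^ t.card :=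
        Finset.sum_le_sum hbound
    _ ≤ ∑ t ∈ S.powerset.erase ∅, r ^ t.card :=
        Finset.sum_le_sum_of_subset_of_nonneg (Finset.filter_subset _ _) fun _ _ _ => by
          rw [hr]; positivity
    _ ≤ 2 * ((N : ℝ) ^ (l - k) * r) := by
        refine sum_nonempty_pow_card_le S (by rw [hr]; positivity) ?_ hMr
        rw [← hZcard]
        exact_mod_cast Finset.card_le_card hSZ

theorem edgeLaw_fewBad_inter_linked_compl_le {β ε lam : ℝ} {k l : ℕ} (hkl : k ≤ l)
    (hβ : 1 / 2 ≤ β) (hε : 2 * ε ≤ 1 / 2) (hlam : 0 ≤ lam)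
    (hp : ∀ j, k < j → j ≤ l → min lam 1 ≤ p j) (x : HierGroup N) {r : ℝ}
    (hr : r = Real.exp (-(lam * (N : ℝ) ^ (2 * k) * (N : ℝ) ^ (l - k) / 16)))
    (hMr : (N : ℝ) ^ (l - k) * r ≤ 1) :
    (edgeLaw N).real (fewBad p β ε k l x ∩ (linked p β k l x)ᶜ)
      ≤ 2 * ((N : ℝ) ^ (l - k) * r) := by
  have h0 : 0 ≤ 2 * ((N : ℝ) ^ (l - k) * r) := by rw [hr]; positivity
  refine (measureReal_inter_le_of_resample _ (isLocal_fewBad hkl x).measurableSet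
    (eventOn_fewBad β ε k l x) (isLocal_linked hkl x).measurableSet.compl h0 fun u hu =>
    linked_compl_resample_le hkl hβ hε hlam hp x hr hMr hu).trans ?_
  exact mul_le_of_le_one_right h0 measureReal_le_one

/-- On `fewBad ∩ linked`, the large clusters of the good sub-balls are contained in a large cluster
of the whole ball. -/
theorem giant_subset_giant_of_linked {β ε : ℝ} {k l : ℕ} (hkl : k ≤ l) (hβ1 : β ≤ 1)
    (hε : 0 ≤ ε) (hβ : 1 / 2 < β - 2 * ε) {x : HierGroup N}
    {u : Sym2 (HierGroup N) → unitInterval}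
    (hu : u ∈ fewBad p β ε k l x ∩ linked p β k l x) :
    u ∈ goodEvent p (β - 2 * ε) l x ∧ ∀ y ∈ block l x, u ∈ goodEvent p β k y →
      (graph p u).giant (block k y) ⊆ (graph p u).giant (block l x) := by
  classical
  have hN : (0 : ℝ) < N := Nat.cast_pos.2 (Nat.pos_of_ne_zero (NeZero.ne N))
  set Z := subBlocks k l x with hZ
  have hZcard : (Z.card : ℝ) = (N : ℝ) ^ (l - k) := by rw [hZ, card_subBlocks hkl, Nat.cast_pow]
  set S := Z.filter fun z => u ∈ goodEvent p β k z with hS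
  set Γ : HierGroup N → Finset (HierGroup N) := fun z => (graph p u).giant (block k z) with hΓ
  have hSZ : S ⊆ Z := Finset.filter_subset _ _
  have hblock : ∀ z ∈ S, block k z ⊆ block l x := fun z hz =>
    block_subset_of_mem_subBlocks hkl (hSZ hz)
  have hScard : (1 - 2 * ε) * (N : ℝ) ^ (l - k) ≤ S.card := by
    rw [← hZcard]
    exact le_card_good_of_mem_fewBad hu.1
  have hUcard : (β - 2 * ε) * (N : ℝ) ^ l ≤ (S.biUnion Γ).card := by
    rw [Finset.card_biUnion]
    · push_cast
      -- Since `β ≤ 1`, one has `(1 - 2 * ε) * β ≥ β - 2 * ε`: the loss of density is additive and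
      -- can be summed over the scales.
      calc (β - 2 * ε) * (N : ℝ) ^ l ≤ ((1 - 2 * ε) * (N : ℝ) ^ (l - k)) * (β * (N : ℝ) ^ k) := by
            have h1 : (N : ℝ) ^ l = (N : ℝ) ^ (l - k) * (N : ℝ) ^ k := by
              rw [← pow_add, Nat.sub_add_cancel hkl]
            rw [h1]
            have h2 : 0 < (N : ℝ) ^ (l - k) * (N : ℝ) ^ k := by positivity
            nlinarith [mul_nonneg (mul_nonneg hε (sub_nonneg.2 hβ1)) h2.le]
        _ ≤ S.card * (β * (N : ℝ) ^ k) := by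
            have : 0 ≤ β := by linarith
            gcongr
        _ = ∑ _z ∈ S, β * (N : ℝ) ^ k := by rw [Finset.sum_const, nsmul_eq_mul]
        _ ≤ ∑ z ∈ S, ((Γ z).card : ℝ) :=
            Finset.sum_le_sum fun z hz => (Finset.mem_filter.1 hz).2
    · intro z hz z' hz' hne
      exact (disjoint_block (lt_hdist_of_mem_subBlocks (hSZ hz) (hSZ hz') hne)).mono
        (giant_subset _ _) (giant_subset _ _)
  have hsub : S.biUnion Γ ⊆ (graph p u).giant (block l x) := by
    intro a ha
    obtain ⟨z, hz, haz⟩ := Finset.mem_biUnion.1 ha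
    have haB := hblock z hz (giant_subset _ _ haz)
    refine mem_giant.2 ⟨haB, ?_⟩
    have h1 : S.biUnion Γ ⊆ (graph p u).clusterOf (block l x) a := by
      intro b hb
      obtain ⟨z', hz', hbz⟩ := Finset.mem_biUnion.1 hb
      exact mem_clusterOf.2 ⟨hblock z' hz' (giant_subset _ _ hbz), haB,
        hu.2 z (hSZ hz) z' (hSZ hz') (Finset.mem_filter.1 hz).2 (Finset.mem_filter.1 hz').2
          a haz b hbz⟩
    have h2 : ((S.biUnion Γ).card : ℝ) ≤ ((graph p u).clusterOf (block l x) a).card := by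
      exact_mod_cast Finset.card_le_card h1
    have h3 : (N : ℝ) ^ l < 2 * ((graph p u).clusterOf (block l x) a).card := by
      nlinarith [pow_pos hN l]
    rw [card_block]
    exact_mod_cast h3
  refine ⟨?_, ?_⟩
  · refine hUcard.trans ?_
    exact_mod_cast Finset.card_le_card hsub
  · intro y hy hgood a ha
    refine hsub (Finset.mem_biUnion.2 ⟨center k y, ?_, ?_⟩)
    · refine Finset.mem_filter.2 ⟨center_mem_subBlocks hy, ?_⟩
      simpa only [goodEvent, block_center] using hgood
    · simpa only [hΓ, block_center] using ha

end HierGroup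

set_option linter.unusedSectionVars false

/-! ### The renormalization scheme: percolation and uniqueness -/

namespace HierGroup
open SimpleGraph
variable {N : ℕ} [NeZero N]

/-- Numerical conditions under which the renormalization scheme along the scales `k n`, `n ≥ n₀`,
works: `β n` are the densities of the large clusters, `ε n` the failure probabilities, and `lam n`
bounds the connection probabilities between `k n` and `k (n + 1)` from below. -/
structure Renormalizable (N : ℕ) (p : ℕ → ℝ) (k : ℕ → ℕ) (n₀ : ℕ) (β ε lam : ℕ → ℝ) : Prop where
  mono : Monotone k
  lt_succ : ∀ n ≥ n₀, k n < k (n + 1)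
  density_ge : ∀ n ≥ n₀, 3 / 4 ≤ β n
  density_le : ∀ n ≥ n₀, β n ≤ 1
  density_succ : ∀ n ≥ n₀, β (n + 1) = β n - 2 * ε n
  eps_pos : ∀ n, 0 < ε n
  eps_summable : Summable ε
  eps_tsum : ∑' n, ε (n + (n₀ + 1)) ≤ 1 / 4
  lam_nonneg : ∀ n ≥ n₀, 0 ≤ lam n
  lam_le : ∀ n ≥ n₀, ∀ j, k n < j → j ≤ k (n + 1) → min (lam n) 1 ≤ p j
  count_bound : ∀ n ≥ n₀, 1 / (ε n * (N : ℝ) ^ (k (n + 1) - k n)) ≤ ε (n + 1) / 2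
  link_bound : ∀ n ≥ n₀, 2 * ((N : ℝ) ^ (k (n + 1) - k n) *
    Real.exp (-(lam n * (N : ℝ) ^ (2 * k n) * (N : ℝ) ^ (k (n + 1) - k n) / 16))) ≤ ε (n + 1) / 2
  eps_le : ∀ n, ε n ≤ 1
  base : ∀ j, 1 ≤ j → j ≤ k n₀ → 1 ≤ p j

/-- The renormalization step from scale `k` to scale `l` succeeds around `x`. -/
def stepEvent (p : ℕ → ℝ) (β ε : ℝ) (k l : ℕ) (x : HierGroup N) :
    Set (Sym2 (HierGroup N) → unitInterval) :=
  fewBad p β ε k l x ∩ linked p β k l x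

/-- The `k`-ball of `y` is good and `y` belongs to its large cluster. -/
def inGoodGiant (p : ℕ → ℝ) (β : ℝ) (k : ℕ) (y : HierGroup N) :
    Set (Sym2 (HierGroup N) → unitInterval) :=
  {u | u ∈ goodEvent p β k y ∧ y ∈ (graph p u).giant (block k y)}

theorem isLocal_inGoodGiant (p : ℕ → ℝ) (β : ℝ) (k : ℕ) (y : HierGroup N) :
    IsLocal p (block k y) (inGoodGiant p β k y) := fun u v huv hu =>
  ⟨isLocal_goodEvent p β k y u v huv hu.1, by rw [← giant_congr huv]; exact hu.2⟩

/-- The cluster of `x` in the `k`-ball of the origin has an edge to the annulus `(k, l]`. -/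
def exitEvent (p : ℕ → ℝ) (k l : ℕ) (x : HierGroup N) :
    Set (Sym2 (HierGroup N) → unitInterval) :=
  {u | ∃ a ∈ (graph p u).clusterOf (block k 0) x, ∃ y ∈ shell N k l, (graph p u).Adj a y}

/-- The cluster of `x` in the `k`-ball of the origin has an edge to a point of the annulus `(k, l]`
that lies in the large cluster of its good `k`-ball. -/
def attachEvent (p : ℕ → ℝ) (β : ℝ) (k l : ℕ) (x : HierGroup N) :
    Set (Sym2 (HierGroup N) → unitInterval) :=
  {u | ∃ a ∈ (graph p u).clusterOf (block k 0) x, ∃ y ∈ shell N k l, (graph p u).Adj a y ∧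
    u ∈ inGoodGiant p β k y}

theorem isLocal_exitEvent (p : ℕ → ℝ) {k l : ℕ} (hkl : k ≤ l) (x : HierGroup N) :
    IsLocal p (block l 0) (exitEvent p k l x) := by
  rintro u v huv ⟨a, ha, y, hy, hay⟩
  refine ⟨a, ?_, y, hy, adj_of_inside_eq huv (block_mono hkl 0 (clusterOf_subset _ _ _ ha))
    (Finset.sdiff_subset hy) hay⟩
  rwa [← clusterOf_congr (inside_eq_of_subset (block_mono hkl 0) huv)]

theorem isLocal_attachEvent (p : ℕ → ℝ) (β : ℝ) {k l : ℕ} (hkl : k ≤ l) (x : HierGroup N) :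
    IsLocal p (block l 0) (attachEvent p β k l x) := by
  rintro u v huv ⟨a, ha, y, hy, hay, hg⟩
  refine ⟨a, ?_, y, hy, adj_of_inside_eq huv (block_mono hkl 0 (clusterOf_subset _ _ _ ha))
    (Finset.sdiff_subset hy) hay, ?_⟩
  · rwa [← clusterOf_congr (inside_eq_of_subset (block_mono hkl 0) huv)]
  · exact (isLocal_inGoodGiant p β k y).mono
      (block_subset_block hkl (Finset.sdiff_subset hy)) u v huv hg

/-- Given the configuration inside the `k`-ball of the origin and that the cluster of `x` sends an
edge to the annulus, with probability at least `1 - r` it is attached to a good large cluster. -/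
theorem edgeLaw_exit_not_attach_le (p : ℕ → ℝ) {β : ℝ} {k l : ℕ} (hkl : k ≤ l) {r : ℝ}
    (hr : 0 ≤ r) (h : ∀ y, (edgeLaw N).real (inGoodGiant p β k y)ᶜ ≤ r) (x : HierGroup N)
    {B : Set (Sym2 (HierGroup N) → unitInterval)}
    (hB : MeasurableSet[coordAlgebra (fun _ => unitInterval) (innerEdges (block k 0))] B) :
    (edgeLaw N).real (B ∩ exitEvent p k l x ∩ (attachEvent p β k l x)ᶜ)
      ≤ r * (edgeLaw N).real (B ∩ exitEvent p k l x) := by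
  -- Reveal everything except the pairs inside a `k`-ball other than the central one. This
  -- determines the exit event and leaves the balls of the possible end points fresh.
  set S : Set (Sym2 (HierGroup N)) :=
    {e | ¬ ∃ y ∉ block k (0 : HierGroup N), e ∈ innerEdges (block k y)} with hS
  have hkey : ∀ {a b : HierGroup N}, a ∈ block k 0 → s(a, b) ∈ S := by
    rintro a b ha ⟨y, hy, he⟩
    have hay := mem_block.1 (mem_innerEdges.1 he).1
    exact hy (mem_block.2 (hdist_le_trans (mem_block.1 ha) ((hdist_comm _ _).trans_le hay)))
  have hinner : innerEdges (block k 0) ⊆ S := by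
    intro e
    induction e with
    | _ a b => exact fun he => hkey (mem_innerEdges.1 he).1
  have hexit : EventOn S (exitEvent p k l x) := by
    rintro u v huv ⟨a, ha, y, hy, hay⟩
    have hin := inside_graph_congr p (B := block k (0 : HierGroup N))
      fun e he => huv e (hinner he)
    refine ⟨a, by rwa [← clusterOf_congr hin], y, hy, hay.1, ?_⟩
    rw [← huv _ (hkey (clusterOf_subset _ _ _ ha))]
    exact hay.2
  refine measureReal_inter_le_of_resample (S := S) _
    (hB.1.inter (isLocal_exitEvent p hkl x).measurableSet) ?_
    (isLocal_attachEvent p β hkl x).measurableSet.compl hr ?_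
  · exact fun u v huv hu => ⟨hB.2.mono hinner u v huv hu.1, hexit u v huv hu.2⟩
  · rintro u ⟨_, a, ha, y, hy, hay⟩
    -- The exit edge to `y` is frozen, while the `k`-ball of `y` is redrawn; if the attachment
    -- fails, then `y` is not in a good large cluster of the new sample.
    refine (measureReal_mono (fun v hv => ?_) (measure_ne_top _ _)).trans (h y)
    intro hg
    refine hv ?_
    have hin : (graph p (mergeOn S (u, v))).inside (block k (0 : HierGroup N))
        = (graph p u).inside (block k 0) :=
      inside_graph_congr p fun e he => mergeOn_of_mem (hinner he) (u, v)
    refine ⟨a, by rwa [clusterOf_congr hin], y, hy, ⟨hay.1, ?_⟩, ?_⟩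
    · rw [mergeOn_of_mem (hkey (clusterOf_subset _ _ _ ha))]
      exact hay.2
    · refine (isLocal_inGoodGiant p β k y).eventOn v _ (fun e he => ?_) hg
      have heS : e ∉ S := fun h' => h' ⟨y, (Finset.mem_sdiff.1 hy).2, he⟩
      exact (mergeOn_of_notMem heS (u, v)).symm

namespace Renormalizable
variable {p : ℕ → ℝ} {k : ℕ → ℕ} {n₀ : ℕ} {β ε lam : ℕ → ℝ}

/-- Up to distance `k n₀` every edge is present, so the induction over scales starts from complete
graphs, with no failure at all. -/
theorem giant_base (h : Renormalizable N p k n₀ β ε lam)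
    (u : Sym2 (HierGroup N) → unitInterval) (x : HierGroup N) :
    (graph p u).giant (block (k n₀) x) = block (k n₀) x := by
  refine giant_eq_of_complete fun a ha b hb hab => ⟨hab, (u _).2.2.trans (h.base _ ?_ ?_)⟩
  · exact hdist_pos hab
  · rw [mem_block] at ha hb
    exact hdist_le_trans ((hdist_comm a x).trans_le ha) hb

theorem mem_inGoodGiant_base (h : Renormalizable N p k n₀ β ε lam)
    (u : Sym2 (HierGroup N) → unitInterval) (x : HierGroup N) :
    u ∈ inGoodGiant p (β n₀) (k n₀) x := by
  refine ⟨?_, by rw [h.giant_base]; exact mem_block_self _ _⟩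
  simp only [goodEvent, Set.mem_ofPred_eq, h.giant_base, card_block, Nat.cast_pow]
  exact mul_le_of_le_one_left (by positivity) (h.density_le n₀ le_rfl)

theorem step (h : Renormalizable N p k n₀ β ε lam) {n : ℕ} (hn : n₀ ≤ n) {x : HierGroup N}
    {u : Sym2 (HierGroup N) → unitInterval}
    (hu : u ∈ stepEvent p (β n) (ε n) (k n) (k (n + 1)) x) :
    u ∈ goodEvent p (β (n + 1)) (k (n + 1)) x ∧ ∀ y ∈ block (k (n + 1)) x,
      u ∈ goodEvent p (β n) (k n) y →
      (graph p u).giant (block (k n) y) ⊆ (graph p u).giant (block (k (n + 1)) x) := by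
  have h1 := h.density_succ n hn
  have h2 := h.density_ge (n + 1) (by omega)
  rw [h1]
  exact giant_subset_giant_of_linked (h.lt_succ n hn).le (h.density_le n hn) (h.eps_pos n).le
    (by linarith) hu

/-- A step fails through too many bad balls or through missing links; each of the two costs at most
half of `ε (n + 1)`. -/
theorem edgeLaw_step_compl_le (h : Renormalizable N p k n₀ β ε lam) {n : ℕ} (hn : n₀ ≤ n)
    (hgood : ∀ z : HierGroup N, (edgeLaw N).real (goodEvent p (β n) (k n) z)ᶜ ≤ ε n)
    (x : HierGroup N) :
    (edgeLaw N).real (stepEvent p (β n) (ε n) (k n) (k (n + 1)) x)ᶜ ≤ ε (n + 1) := by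
  have hk := (h.lt_succ n hn).le
  have h1 := (edgeLaw_fewBad_compl_le hk (h.eps_pos n) x hgood).trans (h.count_bound n hn)
  have hl := h.link_bound n hn
  have h4 := h.density_succ n hn
  have h5 := h.density_ge (n + 1) (by omega)
  have h6 := h.density_le n hn
  have h2 := (edgeLaw_fewBad_inter_linked_compl_le (p := p) (ε := ε n) hk
    (by linarith [h.density_ge n hn] : 1 / 2 ≤ β n) (by linarith) (h.lam_nonneg n hn)
    (h.lam_le n hn) x rfl (by linarith [h.eps_le (n + 1)])).trans hl
  have h3 : (stepEvent p (β n) (ε n) (k n) (k (n + 1)) x)ᶜ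
      ⊆ (fewBad p (β n) (ε n) (k n) (k (n + 1)) x)ᶜ ∪
        (fewBad p (β n) (ε n) (k n) (k (n + 1)) x ∩ (linked p (β n) (k n) (k (n + 1)) x)ᶜ) := by
    intro u hu
    by_cases hf : u ∈ fewBad p (β n) (ε n) (k n) (k (n + 1)) x
    · exact Or.inr ⟨hf, fun hl => hu ⟨hf, hl⟩⟩
    · exact Or.inl hf
  refine (measureReal_mono h3 (measure_ne_top _ _)).trans ((measureReal_union_le _ _).trans ?_)
  linarith

theorem edgeLaw_good_compl_le (h : Renormalizable N p k n₀ β ε lam) {n : ℕ} (hn : n₀ ≤ n)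
    (z : HierGroup N) : (edgeLaw N).real (goodEvent p (β n) (k n) z)ᶜ ≤ ε n := by
  induction n, hn using Nat.le_induction generalizing z with
  | base =>
    have : (goodEvent p (β n₀) (k n₀) z)ᶜ = ∅ :=
      Set.eq_empty_of_forall_notMem fun u hu => hu (h.mem_inGoodGiant_base u z).1
    rw [this, measureReal_empty]
    exact (h.eps_pos n₀).le
  | succ n hn ih =>
    refine le_trans (measureReal_mono ?_ (measure_ne_top _ _)) (h.edgeLaw_step_compl_le hn ih z)
    exact Set.compl_subset_compl.2 fun u hu => (h.step hn hu).1

theorem edgeLaw_iUnion_step_compl_le (h : Renormalizable N p k n₀ β ε lam) (x : HierGroup N) :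
    edgeLaw N (⋃ i, (stepEvent p (β (n₀ + i)) (ε (n₀ + i)) (k (n₀ + i)) (k (n₀ + i + 1)) x)ᶜ)
      ≤ ENNReal.ofReal (1 / 4) := by
  refine (measure_iUnion_le _).trans ?_
  have hs : Summable fun n => ε (n + (n₀ + 1)) := (summable_nat_add_iff (n₀ + 1)).2 h.eps_summable
  refine le_trans ?_ (ENNReal.ofReal_le_ofReal h.eps_tsum)
  rw [ENNReal.ofReal_tsum_of_nonneg (fun n => (h.eps_pos _).le) hs]
  refine ENNReal.tsum_le_tsum fun i => ?_
  rw [← ofReal_measureReal (μ := edgeLaw N)]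
  refine ENNReal.ofReal_le_ofReal ?_
  have := h.edgeLaw_step_compl_le (n := n₀ + i) (by omega)
    (fun z => h.edgeLaw_good_compl_le (by omega) z) x
  rwa [show n₀ + i + 1 = i + (n₀ + 1) by omega] at this ⊢

/-- At the base scale `x` lies in its complete ball, and each successful step carries the large
cluster of the ball of `x` into the next one. -/
theorem mem_inGoodGiant_of_steps (h : Renormalizable N p k n₀ β ε lam) {x : HierGroup N}
    {u : Sym2 (HierGroup N) → unitInterval}
    (hu : ∀ i, u ∈ stepEvent p (β (n₀ + i)) (ε (n₀ + i)) (k (n₀ + i)) (k (n₀ + i + 1)) x)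
    (n : ℕ) : u ∈ inGoodGiant p (β (n₀ + n)) (k (n₀ + n)) x := by
  induction n with
  | zero => exact h.mem_inGoodGiant_base u x
  | succ n ih =>
    obtain ⟨h1, h2⟩ := h.step (by omega) (hu n)
    exact ⟨h1, h2 x (mem_block_self _ _) ih.1 ih.2⟩

theorem edgeLaw_inGoodGiant_compl_le (h : Renormalizable N p k n₀ β ε lam) {n : ℕ} (hn : n₀ ≤ n)
    (x : HierGroup N) : (edgeLaw N).real (inGoodGiant p (β n) (k n) x)ᶜ ≤ 1 / 4 := by
  obtain ⟨i, rfl⟩ := Nat.exists_eq_add_of_le hn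
  refine ENNReal.toReal_le_of_le_ofReal (by norm_num)
    ((measure_mono fun u hu => ?_).trans (h.edgeLaw_iUnion_step_compl_le x))
  by_contra hcon
  simp only [Set.mem_iUnion, Set.mem_compl_iff, not_exists, not_not] at hcon
  exact hu (h.mem_inGoodGiant_of_steps hcon i)

theorem strictMono_add (h : Renormalizable N p k n₀ β ε lam) : StrictMono fun i => k (n₀ + i) :=
  strictMono_nat_of_lt_succ fun i => h.lt_succ (n₀ + i) (by omega)

theorem le_scale (h : Renormalizable N p k n₀ β ε lam) (n : ℕ) : n ≤ k (n₀ + n) :=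
  h.strictMono_add.le_apply

theorem infinite_supp_of_frequently_mem_giant (hN : 2 ≤ N) (hk : ∀ n, n ≤ k (n₀ + n))
    {G : SimpleGraph (HierGroup N)} {x : HierGroup N}
    (h : ∃ᶠ n in atTop, x ∈ G.giant (block (k (n₀ + n)) 0)) :
    (G.connectedComponentMk x).supp.Infinite := by
  intro hfin
  obtain ⟨n, hn, hx⟩ := (frequently_atTop.1 h) (2 * (G.connectedComponentMk x).supp.ncard)
  have h1 := (mem_giant.1 hx).2
  rw [card_block] at h1
  have h2 : (G.clusterOf (block (k (n₀ + n)) 0) x).card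
      ≤ (G.connectedComponentMk x).supp.ncard := by
    rw [← Set.ncard_coe_finset]
    exact Set.ncard_le_ncard (clusterOf_subset_supp _ _ _) hfin
  have h3 := Nat.lt_pow_self (n := k (n₀ + n)) (a := N) (by omega)
  have h4 := hk n
  omega

/-- If all steps around `0` succeed, then `0` lies in majority clusters of arbitrarily large balls;
some step fails with probability at most `1/4`. -/
theorem percolates (hN : 2 ≤ N) (h : Renormalizable N p k n₀ β ε lam) : Percolates N p := by
  unfold Percolates
  by_contra hcon
  rw [not_lt, nonpos_iff_eq_zero] at hcon
  have h1 : (Set.univ : Set (Sym2 (HierGroup N) → unitInterval)) ⊆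
      {u | ((graph p u).connectedComponentMk 0).supp.Infinite} ∪
      ⋃ i, (stepEvent p (β (n₀ + i)) (ε (n₀ + i)) (k (n₀ + i)) (k (n₀ + i + 1)) 0)ᶜ := by
    intro u _
    by_contra hu
    simp only [Set.mem_union, Set.mem_iUnion, Set.mem_compl_iff, not_or, not_exists, not_not] at hu
    exact hu.1 (infinite_supp_of_frequently_mem_giant hN h.le_scale
      (Eventually.of_forall fun n => (h.mem_inGoodGiant_of_steps hu.2 n).2).frequently)
  have h2 := (measure_mono (μ := edgeLaw N) h1).trans (measure_union_le _ _)
  rw [hcon, zero_add, measure_univ] at h2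
  have h3 := h2.trans (h.edgeLaw_iUnion_step_compl_le 0)
  rw [← ENNReal.ofReal_one, ENNReal.ofReal_le_ofReal_iff (by norm_num)] at h3
  norm_num at h3

theorem ae_eventually_step (h : Renormalizable N p k n₀ β ε lam) :
    ∀ᵐ u ∂(edgeLaw N), ∀ᶠ n in atTop,
      u ∈ stepEvent p (β n) (ε n) (k n) (k (n + 1)) (0 : HierGroup N) := by
  have h1 := ae_eventually_notMem_of_measureReal_le (μ := edgeLaw N)
    (s := fun n => (stepEvent p (β n) (ε n) (k n) (k (n + 1)) (0 : HierGroup N))ᶜ)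
    ((summable_nat_add_iff 1).2 h.eps_summable)
    (eventually_atTop.2 ⟨n₀, fun n hn => h.edgeLaw_step_compl_le hn
      (fun z => h.edgeLaw_good_compl_le hn z) 0⟩)
  filter_upwards [h1] with u hu
  filter_upwards [hu] with n hn
  simpa using hn

/-- The filtration is generated by the edges inside `B_{k n}`. The failure ratio `1/4` is the
uniform bound for a point not to lie in the large cluster of its good ball. -/
theorem ae_frequently_attach (h : Renormalizable N p k n₀ β ε lam) :
    ∀ᵐ u ∂(edgeLaw N), ∀ x : HierGroup N,
      (∃ᶠ n in atTop, u ∈ exitEvent p (k n) (k (n + 1)) x) →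
      ∃ᶠ n in atTop, u ∈ attachEvent p (β n) (k n) (k (n + 1)) x := by
  rw [ae_all_iff]
  intro x
  refine ae_frequently_of_frequently_of_filtration
    (fun n => coordAlgebra (fun _ => unitInterval) (innerEdges (block (k n) (0 : HierGroup N))))
    (fun m n hmn => coordAlgebra_mono (innerEdges_mono (block_mono (h.mono hmn) 0)))
    (fun n E hE => hE.1)
    (fun n => (isLocal_exitEvent p (h.mono (Nat.le_succ n)) x).measurableSet_coordAlgebra)
    (fun n => (isLocal_attachEvent p _ (h.mono (Nat.le_succ n)) x).measurableSet_coordAlgebra)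
    (r := 1 / 4) (by norm_num) (by norm_num) (n₀ := n₀) fun n hn B hB => ?_
  exact edgeLaw_exit_not_attach_le p (h.mono (Nat.le_succ n)) (by norm_num)
    (fun y => h.edgeLaw_inGoodGiant_compl_le hn y) x hB

/-- An infinite cluster has an edge from its part in a ball to the outside of that ball. If the edge
overshoots, it counts as an exit at the later scale `m' + i` whose shell it hits; the cluster inside
that larger ball still contains the starting point `a`. -/
theorem frequently_exit (h : Renormalizable N p k n₀ β ε lam) {x : HierGroup N}
    {u : Sym2 (HierGroup N) → unitInterval}
    (hx : ((graph p u).connectedComponentMk x).supp.Infinite) :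
    ∃ᶠ n in atTop, u ∈ exitEvent p (k n) (k (n + 1)) x := by
  rw [frequently_atTop]
  intro m
  set m' := n₀ + max m (hdist 0 x) with hm'
  have hxm : x ∈ block (k m') 0 := by
    rw [mem_block]
    exact (le_max_right _ _).trans (h.le_scale _)
  obtain ⟨a, ha, y, hy, hay⟩ := exists_adj_of_infinite_supp hx
    (Y := (graph p u).clusterOf (block (k m') 0) x)
    (mem_clusterOf.2 ⟨hxm, hxm, Reachable.refl _⟩)
  have hya : y ∉ block (k m') 0 := by
    intro hyB
    obtain ⟨haB, _, hxa⟩ := mem_clusterOf.1 ha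
    exact hy (mem_clusterOf.2 ⟨hyB, hxm, hxa.trans (Adj.reachable ⟨haB, hyB, hay⟩)⟩)
  have hex : ∃ i, y ∈ block (k (m' + i)) (0 : HierGroup N) :=
    ⟨hdist 0 y, mem_block.2 ((h.le_scale _).trans (h.mono (by omega)))⟩
  classical
  obtain ⟨i, hi⟩ : ∃ i, Nat.find hex = i + 1 := Nat.exists_eq_succ_of_ne_zero fun h0 => by
    have := Nat.find_spec hex
    rw [h0] at this
    exact hya this
  refine ⟨m' + i, by have := le_max_left m (hdist 0 x); omega, a,
    clusterOf_mono _ (block_mono (h.mono (by omega)) 0) _ ha, y, ?_, hay⟩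
  refine Finset.mem_sdiff.2 ⟨?_, Nat.find_min hex (m := i) (by omega)⟩
  have := Nat.find_spec hex
  rwa [hi] at this

/-- Almost surely, eventually the large clusters of the balls `B_{k n}` are dense and increase, and
eventually they contain any given point of any infinite cluster. -/
theorem ae_giant (h : Renormalizable N p k n₀ β ε lam) :
    ∀ᵐ u ∂(edgeLaw N), ∃ n₁ ≥ n₀,
      (∀ n ≥ n₁, u ∈ goodEvent p (β n) (k n) (0 : HierGroup N)) ∧
      (∀ n ≥ n₁, (graph p u).giant (block (k n) (0 : HierGroup N))
        ⊆ (graph p u).giant (block (k (n + 1)) 0)) ∧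
      ∀ x : HierGroup N, ((graph p u).connectedComponentMk x).supp.Infinite →
        ∃ n ≥ n₁, x ∈ (graph p u).giant (block (k n) 0) := by
  filter_upwards [h.ae_eventually_step, h.ae_frequently_attach] with u hstep hatt
  obtain ⟨n₂, hn₂⟩ := eventually_atTop.1 hstep
  have hstep' : ∀ n ≥ max n₀ n₂, _ := fun n hn =>
    h.step (le_trans (le_max_left _ _) hn) (hn₂ n (le_trans (le_max_right _ _) hn))
  have hgood : ∀ n ≥ max n₀ n₂ + 1, u ∈ goodEvent p (β n) (k n) (0 : HierGroup N) := by
    intro n hn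
    obtain ⟨m, rfl⟩ := Nat.exists_eq_add_of_le' hn
    exact (hstep' (m + max n₀ n₂) (by omega)).1
  refine ⟨max n₀ n₂ + 1, by omega, hgood, fun n hn => ?_, fun x hx => ?_⟩
  · exact (hstep' n (by omega)).2 0 (mem_block_self _ _) (hgood n hn)
  · obtain ⟨n, hn, a, ha, y, hy, hay, hg⟩ :=
      (frequently_atTop.1 (hatt x (h.frequently_exit hx))) (max n₀ n₂ + 1)
    refine ⟨n + 1, by omega, ?_⟩
    have hyB : y ∈ block (k (n + 1)) 0 := Finset.sdiff_subset hy
    have hyg := (hstep' n (by omega)).2 y hyB hg.1 hg.2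
    have hsub := block_mono (h.mono (Nat.le_succ n)) (0 : HierGroup N)
    obtain ⟨haB, hxB, hxa⟩ := mem_clusterOf.1 ha
    rw [giant_eq_clusterOf hyg]
    refine mem_clusterOf.2 ⟨hsub hxB, hyB, Reachable.symm ?_⟩
    exact (hxa.mono (inside_mono _ hsub)).trans (Adj.reachable ⟨hsub haB, hyB, hay⟩)

theorem giant_nonempty (h : Renormalizable N p k n₀ β ε lam) {n : ℕ} (hn : n₀ ≤ n)
    {u : Sym2 (HierGroup N) → unitInterval} (hu : u ∈ goodEvent p (β n) (k n) (0 : HierGroup N)) :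
    ((graph p u).giant (block (k n) (0 : HierGroup N))).Nonempty := by
  have hN : (0 : ℝ) < N := Nat.cast_pos.2 (Nat.pos_of_ne_zero (NeZero.ne N))
  have h1 := h.density_ge n hn
  have h2 : (0 : ℝ) < ((graph p u).giant (block (k n) (0 : HierGroup N))).card :=
    lt_of_lt_of_le (by positivity) hu
  exact Finset.card_pos.1 (Nat.cast_pos.1 h2)

/-- The increasing majority clusters lie in one infinite cluster, and every infinite cluster meets
them. -/
theorem uniqueInfiniteCluster (hN : 2 ≤ N) (h : Renormalizable N p k n₀ β ε lam) :
    UniqueInfiniteCluster N p := by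
  filter_upwards [h.ae_giant] with u hu
  obtain ⟨n₁, hn₁, hgood, hmono, hinf⟩ := hu
  have hmono' : ∀ m ≥ n₁, ∀ n ≥ m, (graph p u).giant (block (k m) (0 : HierGroup N))
      ⊆ (graph p u).giant (block (k n) 0) := by
    intro m hm n hmn
    induction n, hmn using Nat.le_induction with
    | base => exact subset_rfl
    | succ n hn ih => exact ih.trans (hmono n (by omega))
  obtain ⟨x, hx⟩ := h.giant_nonempty hn₁ (hgood n₁ le_rfl)
  refine ⟨(graph p u).connectedComponentMk x, ?_, ?_⟩
  · refine infinite_supp_of_frequently_mem_giant hN h.le_scale (Eventually.frequently ?_)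
    filter_upwards [eventually_ge_atTop n₁] with n hn
    exact hmono' n₁ le_rfl _ (by omega) hx
  · intro κ
    induction κ using ConnectedComponent.ind with
    | h y =>
      intro hy
      obtain ⟨n, hn, hyn⟩ := hinf y hy
      exact ConnectedComponent.sound
        ((reachable_of_mem_giant hyn (hmono' n₁ le_rfl n hn hx)).mono (inside_le _ _))

end Renormalizable

end HierGroup

/-! ### Selected largest clusters and the cascade -/

namespace HierGroup
open SimpleGraph
variable {N : ℕ} [NeZero N]

namespace Renormalizable
variable {p : ℕ → ℝ} {K : ℝ} {n₀ : ℕ} {β ε lam : ℕ → ℝ}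

theorem selection_eq_giant (h : Renormalizable N p (scale K) n₀ β ε lam) {n : ℕ} (hn : n₀ ≤ n)
    {u : Sym2 (HierGroup N) → unitInterval}
    (hu : u ∈ goodEvent p (β n) (scale K n) (0 : HierGroup N)) {X : ℕ → Set (HierGroup N)}
    (hX : IsClusterSelection K (graph p u) X) :
    X n = (graph p u).giant (block (scale K n) 0) := by
  have h1 := hX n
  rw [← coe_block] at h1
  exact h1.eq_giant (h.giant_nonempty hn hu)

theorem eventuallyDense (h : Renormalizable N p (scale K) n₀ β ε lam) :
    EventuallyDense N K p fun _ => 1 / 2 := by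
  filter_upwards [h.ae_giant] with u hu
  obtain ⟨n₁, hn₁, hgood, -, -⟩ := hu
  intro X hX
  refine ⟨n₁, fun n hn => ?_⟩
  rw [h.selection_eq_giant (hn₁.trans hn) (hgood n hn) hX, Set.ncard_coe_finset]
  refine le_trans ?_ (hgood n hn)
  have := h.density_ge n (hn₁.trans hn)
  gcongr
  linarith

/-- The cascade consists of the majority clusters of `ae_giant`. For `l ≥ 3` an edge as in the last
clause would end outside `B_{k_{n+2}}`, which `hlong` excludes for large `n`. -/
theorem isCascade (h : Renormalizable N p (scale K) n₀ β ε lam)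
    (hlong : ∀ᵐ u ∂(edgeLaw N), ∀ᶠ n in atTop, ∀ x ∈ block (scale K n) (0 : HierGroup N),
      ∀ y ∉ block (scale K (n + 2)) (0 : HierGroup N), ¬ (graph p u).Adj x y) :
    IsCascade N K p := by
  filter_upwards [h.ae_giant, hlong] with u hu hlong
  obtain ⟨n₁, hn₁, hgood, hmono, hinf⟩ := hu
  obtain ⟨n₂, hn₂⟩ := eventually_atTop.1 hlong
  intro X hX
  have hXg : ∀ n ≥ n₁, X n = (graph p u).giant (block (scale K n) 0) := fun n hn =>
    h.selection_eq_giant (hn₁.trans hn) (hgood n hn) hX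
  have hmono' : ∀ m ≥ n₁, ∀ n ≥ m, (graph p u).giant (block (scale K m) (0 : HierGroup N))
      ⊆ (graph p u).giant (block (scale K n) 0) := by
    intro m hm n hmn
    induction n, hmn using Nat.le_induction with
    | base => exact subset_rfl
    | succ n hn ih => exact ih.trans (hmono n (by omega))
  refine ⟨max (max n₁ n₂) 1, le_max_right _ _, fun n hn => ?_, fun κ hκ => ?_, ?_⟩
  · rw [hXg n (by omega), hXg (n + 1) (by omega)]
    exact_mod_cast hmono n (by omega)
  · induction κ using ConnectedComponent.ind with
    | h y =>
      obtain ⟨m, hm, hym⟩ := hinf y hκ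
      ext z
      simp only [Set.mem_iUnion]
      constructor
      · intro hz
        have hz' : (graph p u).connectedComponentMk z = (graph p u).connectedComponentMk y := hz
        obtain ⟨n, hn, hzn⟩ := hinf z (by rwa [hz'])
        refine ⟨max n (max (max n₁ n₂) 1), le_max_right _ _, ?_⟩
        rw [hXg _ (by omega)]
        exact hmono' n hn _ (le_max_left _ _) hzn
      · rintro ⟨n, hn, hzn⟩
        rw [hXg n (by omega)] at hzn
        exact ConnectedComponent.sound (((reachable_of_mem_giant
          (hmono' n (by omega) (max m n) (le_max_right _ _) hzn)
          (hmono' m hm (max m n) (le_max_left _ _) hym))).mono (inside_le _ _))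
  · rintro n hn l hl ⟨x, hx, y, hy, hxy⟩
    by_contra hcon
    rw [← coe_block, ← coe_block] at hx hy
    refine hn₂ n (by omega) x hx.2.1 y (fun hy2 => hy.2.2 ?_) hxy
    exact block_mono (h.mono (by omega)) 0 hy2

end Renormalizable

/-! ### First moment bounds for long edges -/

theorem hdist_eq_of_mem_block_of_notMem {k : ℕ} {x y : HierGroup N} (hx : x ∈ block k 0)
    (hy : y ∉ block k 0) : hdist x y = hdist 0 y := by
  rw [mem_block] at hx hy
  exact hdist_eq_of_lt (by omega)

/-- The `N ^ i - N ^ (i - 1)` points at distance `i` contribute `(N ^ (-(i - 1)) - N ^ (-i)) / N`,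
and the sum telescopes. The factor `1 / N` is why the critical rate is `N log n`. -/
theorem sum_shell_inv_pow {j l : ℕ} (h : j ≤ l) :
    ∑ y ∈ shell N j l, ((N : ℝ) ^ (2 * hdist 0 y))⁻¹
      = (((N : ℝ) ^ j)⁻¹ - ((N : ℝ) ^ l)⁻¹) / N := by
  have hN : (0 : ℝ) < N := Nat.cast_pos.2 (Nat.pos_of_ne_zero (NeZero.ne N))
  induction l, h using Nat.le_induction with
  | base =>
    have : shell N j j = ∅ := by simp [shell]
    simp [this]
  | succ l hl ih =>
    have hsplit : shell N j (l + 1) = shell N j l ∪ shell N l (l + 1) := by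
      ext y
      simp only [Finset.mem_union, mem_shell]
      omega
    have hdisj : Disjoint (shell N j l) (shell N l (l + 1)) := by
      rw [Finset.disjoint_left]
      intro y hy hy'
      rw [mem_shell] at hy hy'
      omega
    rw [hsplit, Finset.sum_union hdisj, ih]
    have : ∑ y ∈ shell N l (l + 1), ((N : ℝ) ^ (2 * hdist 0 y))⁻¹
        = ∑ _y ∈ shell N l (l + 1), ((N : ℝ) ^ (2 * (l + 1)))⁻¹ := by
      refine Finset.sum_congr rfl fun y hy => ?_
      rw [mem_shell] at hy
      rw [show hdist 0 y = l + 1 by omega]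
    rw [this, Finset.sum_const, card_shell (Nat.le_succ l), nsmul_eq_mul,
      Nat.cast_sub (Nat.pow_le_pow_right (Nat.pos_of_ne_zero (NeZero.ne N)) (Nat.le_succ l))]
    simp only [Nat.succ_eq_add_one, Nat.cast_pow, Nat.cast_mul, pow_succ, mul_add, mul_one,
      pow_mul']
    field_simp
    ring

theorem edgeLaw_block_shell_le (p : ℕ → ℝ) {f : ℕ → ℝ} {k j l : ℕ} (hkj : k ≤ j)
    (hf : ∀ i, j < i → i ≤ l → 0 ≤ f i ∧ p i ≤ f i) :
    (edgeLaw N).real {u | ∃ x ∈ block k 0, ∃ y ∈ shell N j l, (graph p u).Adj x y}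
      ≤ (N : ℝ) ^ k * ∑ y ∈ shell N j l, f (hdist 0 y) := by
  refine (edgeLaw_exists_adj_le p _ _ (f := fun _ y => f (hdist 0 y)) fun x hx y hy => ?_).trans ?_
  · have hy' := mem_shell.1 hy
    rw [hdist_eq_of_mem_block_of_notMem hx (by rw [mem_block]; omega)]
    exact hf _ hy'.1 hy'.2
  · rw [Finset.sum_const, card_block, nsmul_eq_mul, Nat.cast_pow]

/-- Some edge joins the `k`-ball of the origin to the complement of the `l`-ball. -/
def escapeEvent (N : ℕ) [NeZero N] (p : ℕ → ℝ) (k l : ℕ) :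
    Set (Sym2 (HierGroup N) → unitInterval) :=
  {u | ∃ x ∈ block k 0, ∃ y ∉ block l 0, (graph p u).Adj x y}

/-- Cut the complement of the ball into shells. The bounds `q` on the expected number of edges per
point decay geometrically, so the first shell dominates and the sum costs a factor `2`. -/
theorem edgeLaw_escapeEvent_le {p : ℕ → ℝ} {k : ℕ → ℕ} (hk : Monotone k)
    (hk' : Tendsto k atTop atTop) {q : ℕ → ℝ} {m₀ : ℕ} (hq0 : ∀ m ≥ m₀, 0 ≤ q m)
    (hq : ∀ m ≥ m₀, q (m + 1) ≤ q m / 2)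
    (hp : ∀ m ≥ m₀, ∃ f : ℕ → ℝ, (∀ i, k m < i → i ≤ k (m + 1) → 0 ≤ f i ∧ p i ≤ f i) ∧
      ∑ y ∈ shell N (k m) (k (m + 1)), f (hdist 0 y) ≤ q m)
    {n m : ℕ} (hnm : n ≤ m) (hm : m₀ ≤ m) :
    (edgeLaw N).real (escapeEvent N p (k n) (k m)) ≤ 2 * ((N : ℝ) ^ k n * q m) := by
  have hsub : escapeEvent N p (k n) (k m) ⊆ ⋃ i, {u | ∃ x ∈ block (k n) 0,
      ∃ y ∈ shell N (k (m + i)) (k (m + i + 1)), (graph p u).Adj x y} := by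
    rintro u ⟨x, hx, y, hy, hxy⟩
    have hex : ∃ i, y ∈ block (k (m + i)) (0 : HierGroup N) := by
      obtain ⟨a, ha⟩ := (hk'.eventually_ge_atTop (hdist 0 y)).exists
      exact ⟨a, mem_block.2 (ha.trans (hk (by omega)))⟩
    classical
    obtain ⟨i, hi⟩ : ∃ i, Nat.find hex = i + 1 := Nat.exists_eq_succ_of_ne_zero fun h0 => by
      have := Nat.find_spec hex
      rw [h0] at this
      exact hy this
    refine Set.mem_iUnion.2 ⟨i, x, hx, y, Finset.mem_sdiff.2 ⟨?_, ?_⟩, hxy⟩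
    · have := Nat.find_spec hex
      rwa [hi] at this
    · exact Nat.find_min hex (m := i) (by omega)
  have hqi : ∀ i, q (m + i) ≤ q m * (1 / 2) ^ i := by
    intro i
    induction i with
    | zero => simp
    | succ i ih =>
      have := hq (m + i) (by omega)
      rw [pow_succ]
      rw [← add_assoc]
      linarith
  have hNk : (0 : ℝ) ≤ (N : ℝ) ^ k n := by positivity
  have hterm : ∀ i, (edgeLaw N).real {u | ∃ x ∈ block (k n) 0,
      ∃ y ∈ shell N (k (m + i)) (k (m + i + 1)), (graph p u).Adj x y}
      ≤ (N : ℝ) ^ k n * q m * (1 / 2) ^ i := by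
    intro i
    obtain ⟨f, hf, hfq⟩ := hp (m + i) (by omega)
    refine (edgeLaw_block_shell_le p (hk (by omega)) hf).trans ?_
    rw [mul_assoc]
    exact mul_le_mul_of_nonneg_left (hfq.trans (hqi i)) hNk
  have hsum : Summable fun i : ℕ => (N : ℝ) ^ k n * q m * (1 / 2) ^ i :=
    summable_geometric_two.mul_left _
  have h0 : 0 ≤ (N : ℝ) ^ k n * q m := mul_nonneg hNk (hq0 m hm)
  refine ENNReal.toReal_le_of_le_ofReal (by positivity)
    ((measure_mono hsub).trans ((measure_iUnion_le _).trans ?_))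
  have h1 : 2 * ((N : ℝ) ^ k n * q m) = ∑' i : ℕ, (N : ℝ) ^ k n * q m * (1 / 2) ^ i := by
    rw [tsum_mul_left, tsum_geometric_two]; ring
  rw [h1, ENNReal.ofReal_tsum_of_nonneg (fun i => by positivity) hsum]
  refine ENNReal.tsum_le_tsum fun i => ?_
  rw [← ofReal_measureReal (μ := edgeLaw N)]
  exact ENNReal.ofReal_le_ofReal (hterm i)

theorem finite_supp_of_notMem_escapeEvent {p : ℕ → ℝ} {k : ℕ}
    {u : Sym2 (HierGroup N) → unitInterval} (h : u ∉ escapeEvent N p k k) :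
    ¬ ((graph p u).connectedComponentMk 0).supp.Infinite := fun hinf => by
  obtain ⟨a, ha, y, hy, hay⟩ := exists_adj_of_infinite_supp hinf (mem_block_self k 0)
  exact h ⟨a, ha, y, hy, hay⟩

end HierGroup

/-! ### Asymptotics of the scales and of the comparison rates -/

namespace HierGroup

theorem log_pos_of_two_le {N : ℕ} (hN : 2 ≤ N) : 0 < Real.log N :=
  Real.log_pos (by exact_mod_cast hN)

theorem natCast_mul_log_mono {m n : ℕ} (h : m ≤ n) :
    (m : ℝ) * Real.log m ≤ n * Real.log n := by
  rcases Nat.eq_zero_or_pos m with rfl | hm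
  · simpa using mul_nonneg n.cast_nonneg (Real.log_natCast_nonneg n)
  · have h1 : (m : ℝ) ≤ n := by exact_mod_cast h
    have h2 : (0 : ℝ) < m := by exact_mod_cast hm
    exact mul_le_mul h1 (Real.log_le_log h2 h1) (Real.log_natCast_nonneg m) n.cast_nonneg

theorem scale_mono {K : ℝ} (hK : 0 ≤ K) : Monotone (scale K) := fun m n h => by
  refine Nat.floor_mono ?_
  rw [mul_assoc, mul_assoc]
  exact mul_le_mul_of_nonneg_left (natCast_mul_log_mono h) hK

theorem scale_one (K : ℝ) : scale K 1 = 0 := by simp [scale]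

theorem log_succ_le_sub (n : ℕ) :
    Real.log (n + 1) ≤ (n + 1) * Real.log (n + 1) - n * Real.log n := by
  rcases Nat.eq_zero_or_pos n with rfl | hn
  · simp
  · have h2 : (0 : ℝ) < n := by exact_mod_cast hn
    have := Real.log_le_log h2 (by linarith : (n : ℝ) ≤ n + 1)
    nlinarith

theorem sub_le_log_succ (n : ℕ) :
    (n + 1) * Real.log (n + 1) - n * Real.log n ≤ Real.log (n + 1) + 1 := by
  rcases Nat.eq_zero_or_pos n with rfl | hn
  · simp
  · have h2 : (0 : ℝ) < n := by exact_mod_cast hn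
    have h3 : Real.log (n + 1) - Real.log n ≤ 1 / n := by
      rw [← Real.log_div (by positivity) (by positivity)]
      refine (Real.log_le_sub_one_of_pos (by positivity)).trans (le_of_eq ?_)
      field_simp
      ring
    have h4 : (n : ℝ) * (Real.log (n + 1) - Real.log n) ≤ 1 := by
      calc (n : ℝ) * (Real.log (n + 1) - Real.log n) ≤ n * (1 / n) :=
            mul_le_mul_of_nonneg_left h3 h2.le
        _ = 1 := by field_simp
    linarith

theorem scale_gap_lower {K : ℝ} (hK : 0 ≤ K) (n : ℕ) :
    K * Real.log (n + 1) - 1 < (scale K (n + 1) : ℝ) - scale K n := by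
  have h1 := Nat.lt_floor_add_one (K * ((n + 1 : ℕ) : ℝ) * Real.log ((n + 1 : ℕ) : ℝ))
  have h2 := Nat.floor_le (a := K * (n : ℝ) * Real.log (n : ℝ))
    (mul_nonneg (mul_nonneg hK n.cast_nonneg) (Real.log_natCast_nonneg n))
  have h3 := mul_le_mul_of_nonneg_left (log_succ_le_sub n) hK
  simp only [scale]
  push_cast at *
  linarith

theorem scale_gap_upper {K : ℝ} (hK : 0 ≤ K) (n : ℕ) :
    (scale K (n + 1) : ℝ) - scale K n ≤ K * (Real.log (n + 1) + 1) + 1 := by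
  have h1 := Nat.lt_floor_add_one (K * (n : ℝ) * Real.log (n : ℝ))
  have h2 := Nat.floor_le (a := K * ((n + 1 : ℕ) : ℝ) * Real.log ((n + 1 : ℕ) : ℝ))
    (mul_nonneg (mul_nonneg hK (Nat.cast_nonneg _)) (Real.log_natCast_nonneg _))
  have h3 := mul_le_mul_of_nonneg_left (sub_le_log_succ n) hK
  simp only [scale]
  push_cast at *
  linarith

theorem eventually_scale_lt {K : ℝ} (hK : 0 < K) : ∀ᶠ n in atTop, scale K n < scale K (n + 1) := by
  have h1 : Tendsto (fun n : ℕ => K * Real.log ((n : ℝ) + 1)) atTop atTop := by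
    refine Tendsto.const_mul_atTop hK (Real.tendsto_log_atTop.comp ?_)
    exact tendsto_atTop_add_const_right _ _ tendsto_natCast_atTop_atTop
  filter_upwards [h1.eventually_ge_atTop 1] with n hn
  have := scale_gap_lower hK.le n
  have h2 : (scale K n : ℝ) < scale K (n + 1) := by linarith
  exact_mod_cast h2

theorem tendsto_scale {K : ℝ} (hK : 0 < K) : Tendsto (scale K) atTop atTop := by
  obtain ⟨a, ha⟩ := eventually_atTop.1 (eventually_scale_lt hK)
  have h : StrictMono fun i => scale K (i + a) := strictMono_nat_of_lt_succ fun i => by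
    have := ha (i + a) (by omega)
    rwa [show i + a + 1 = i + 1 + a by omega] at this
  exact (tendsto_add_atTop_iff_nat a).1 h.tendsto_atTop

variable {N : ℕ}

/-- The number of `k_n`-balls in a `k_{n+1}`-ball. -/
def branching (N : ℕ) (K : ℝ) (n : ℕ) : ℝ := (N : ℝ) ^ (scale K (n + 1) - scale K n)

theorem branching_pos (hN : 2 ≤ N) (K : ℝ) (n : ℕ) : 0 < branching N K n := by
  have : (0 : ℝ) < N := by positivity
  unfold branching
  positivity

theorem pow_scale_succ {K : ℝ} (hK : 0 ≤ K) (n : ℕ) :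
    (N : ℝ) ^ scale K (n + 1) = (N : ℝ) ^ scale K n * branching N K n := by
  rw [branching, ← pow_add, Nat.add_sub_cancel' (scale_mono hK (Nat.le_succ n))]

theorem branching_eq_exp (hN : 2 ≤ N) {K : ℝ} (hK : 0 ≤ K) (n : ℕ) :
    branching N K n = Real.exp (Real.log N * ((scale K (n + 1) : ℝ) - scale K n)) := by
  have h0 : (0 : ℝ) < N := by positivity
  rw [branching, ← Real.rpow_natCast, Nat.cast_sub (scale_mono hK (Nat.le_succ n)),
    Real.rpow_def_of_pos h0]

/-- The gap `k_{n+1} - k_n` is at least `K log (n + 1) - 1`, and `N ^ (K log (n + 1)) = (n + 1) ^ (K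
log N)`; the integer part costs the factor `N`. -/
theorem branching_lower (hN : 2 ≤ N) {K : ℝ} (hK : 0 ≤ K) (n : ℕ) :
    ((n : ℝ) + 1) ^ (K * Real.log N) / N ≤ branching N K n := by
  have h0 : (0 : ℝ) < N := by positivity
  have hL := log_pos_of_two_le hN
  rw [branching_eq_exp hN hK, Real.rpow_def_of_pos (by positivity)]
  nth_rewrite 2 [← Real.exp_log h0]
  rw [← Real.exp_sub, Real.exp_le_exp]
  nlinarith [scale_gap_lower hK n]

theorem branching_upper (hN : 2 ≤ N) {K : ℝ} (hK : 0 ≤ K) (n : ℕ) :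
    branching N K n ≤ (N : ℝ) ^ (K + 1) * ((n : ℝ) + 1) ^ (K * Real.log N) := by
  have h0 : (0 : ℝ) < N := by positivity
  have hL := log_pos_of_two_le hN
  rw [branching_eq_exp hN hK, Real.rpow_def_of_pos h0,
    Real.rpow_def_of_pos (by positivity : (0 : ℝ) < (n : ℝ) + 1), ← Real.exp_add, Real.exp_le_exp]
  nlinarith [scale_gap_upper hK n]

theorem tendsto_branching (hN : 2 ≤ N) {K : ℝ} (hK : 0 < K) :
    Tendsto (branching N K) atTop atTop := by
  have h0 : (0 : ℝ) < N := by positivity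
  have hL := log_pos_of_two_le hN
  refine tendsto_atTop_mono (branching_lower hN hK.le) ?_
  refine Tendsto.atTop_div_const h0 ((tendsto_rpow_atTop (mul_pos hK hL)).comp ?_)
  exact tendsto_atTop_add_const_right _ _ tendsto_natCast_atTop_atTop

theorem pow_scale_div_le (hN : 2 ≤ N) {K : ℝ} (hK : 0 ≤ K) (n r : ℕ) :
    (N : ℝ) ^ scale K n * ((N : ℝ) ^ scale K (n + r))⁻¹
      ≤ (N : ℝ) ^ r * ((n : ℝ) + 1) ^ (-(r * (K * Real.log N))) := by
  have h0 : (0 : ℝ) < N := by positivity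
  have hL := log_pos_of_two_le hN
  induction r with
  | zero => simp [h0.ne']
  | succ r ih =>
    have hpos := branching_pos hN K (n + r)
    have h1 : (branching N K (n + r))⁻¹ ≤ N * ((n : ℝ) + 1) ^ (-(K * Real.log N)) := by
      rw [Real.rpow_neg (by positivity), inv_le_comm₀ hpos (by positivity), mul_inv, inv_inv,
        mul_comm, ← div_eq_mul_inv]
      refine le_trans ?_ (branching_lower hN hK (n + r))
      push_cast
      gcongr
      linarith [(Nat.cast_nonneg r : (0 : ℝ) ≤ r)]
    rw [← add_assoc, pow_scale_succ hK, mul_inv, ← mul_assoc]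
    refine (mul_le_mul ih h1 (by positivity) (by positivity)).trans (le_of_eq ?_)
    have h2 : ((n : ℝ) + 1) ^ (-(((r + 1 : ℕ) : ℝ) * (K * Real.log N)))
        = ((n : ℝ) + 1) ^ (-(r * (K * Real.log N))) * ((n : ℝ) + 1) ^ (-(K * Real.log N)) := by
      rw [← Real.rpow_add (by positivity)]
      push_cast
      ring_nf
    rw [h2, pow_succ]
    ring

theorem natCast_add_rpow_le (n r : ℕ) {σ : ℝ} (hσ : 0 ≤ σ) :
    ((n : ℝ) + r + 1) ^ σ ≤ ((r : ℝ) + 1) ^ σ * ((n : ℝ) + 1) ^ σ := by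
  rw [← Real.mul_rpow (by positivity) (by positivity)]
  refine Real.rpow_le_rpow (by positivity) ?_ hσ
  nlinarith [(Nat.cast_nonneg n : (0 : ℝ) ≤ n), (Nat.cast_nonneg r : (0 : ℝ) ≤ r),
    mul_nonneg (Nat.cast_nonneg n : (0 : ℝ) ≤ n) (Nat.cast_nonneg r : (0 : ℝ) ≤ r)]

theorem scaleRate_eq (hN : 2 ≤ N) (C a b : ℝ) {n : ℕ} (hn : 1 ≤ n) :
    scaleRate N C a b n = C + a * Real.log n * (n : ℝ) ^ (b * Real.log N) := by
  have h0 : (0 : ℝ) < N := by positivity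
  have h1 : (0 : ℝ) < n := by exact_mod_cast hn
  rw [scaleRate, Real.rpow_def_of_pos h0, Real.rpow_def_of_pos h1]
  ring_nf

theorem le_scaleRate (C : ℝ) {a : ℝ} (ha : 0 ≤ a) (b : ℝ) (n : ℕ) : C ≤ scaleRate N C a b n := by
  have := Real.log_natCast_nonneg n
  have h : 0 ≤ a * Real.log n * (N : ℝ) ^ (b * Real.log n) := by positivity
  rw [scaleRate]; linarith

theorem scaleRate_mono (hN : 2 ≤ N) (C : ℝ) {a b : ℝ} (ha : 0 ≤ a) (hb : 0 ≤ b) {m n : ℕ}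
    (hm : 1 ≤ m) (h : m ≤ n) : scaleRate N C a b m ≤ scaleRate N C a b n := by
  have hL := log_pos_of_two_le hN
  rw [scaleRate_eq hN C a b hm, scaleRate_eq hN C a b (hm.trans h)]
  have h1 : (0 : ℝ) < m := by exact_mod_cast hm
  have h2 : (m : ℝ) ≤ n := by exact_mod_cast h
  have h3 := Real.log_natCast_nonneg n
  have h4 := Real.log_le_log h1 h2
  have h5 := mul_nonneg hb hL.le
  gcongr

theorem scaleRate_le_rpow (hN : 2 ≤ N) {C a b s : ℝ} (hC : 0 ≤ C) (ha : 0 ≤ a) (hb : 0 ≤ b)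
    (hs : 0 < s) {n : ℕ} (hn : 1 ≤ n) :
    scaleRate N C a b n ≤ (C + a / s) * (n : ℝ) ^ (b * Real.log N + s) := by
  have hL := log_pos_of_two_le hN
  have h1 : (1 : ℝ) ≤ n := by exact_mod_cast hn
  rw [scaleRate_eq hN C a b hn, add_mul]
  have h2 : 1 ≤ (n : ℝ) ^ (b * Real.log N + s) :=
    Real.one_le_rpow h1 (by have := mul_nonneg hb hL.le; linarith)
  have h3 := Real.log_le_rpow_div (by linarith : (0 : ℝ) ≤ n) hs
  have h4 : (n : ℝ) ^ (b * Real.log N + s) = (n : ℝ) ^ (b * Real.log N) * (n : ℝ) ^ s :=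
    Real.rpow_add (by linarith) _ _
  refine add_le_add (le_mul_of_one_le_right hC h2) ?_
  rw [h4]
  calc a * Real.log n * (n : ℝ) ^ (b * Real.log N)
      ≤ a * ((n : ℝ) ^ s / s) * (n : ℝ) ^ (b * Real.log N) := by gcongr
    _ = a / s * ((n : ℝ) ^ (b * Real.log N) * (n : ℝ) ^ s) := by ring

namespace IsComparisonRate
variable {K C a b : ℝ} {c : ℕ → ℝ}

theorem mem_Icc (hc : IsComparisonRate N K C a b c) (hN : 2 ≤ N) (ha : 0 ≤ a) (hb : 0 ≤ b)
    {m : ℕ} (hm : 1 ≤ m) (h1 : scale K m < scale K (m + 1))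
    (h2 : scale K (m + 1) < scale K (m + 2)) {j : ℕ} (hj : scale K m < j)
    (hj' : j ≤ scale K (m + 1)) :
    scaleRate N C a b m ≤ c j ∧ c j ≤ scaleRate N C a b (m + 1) := by
  have h3 := hc.at_scale m hm h1
  have h4 := hc.at_scale (m + 1) (by omega) h2
  rcases hj'.lt_or_eq with hlt | rfl
  · rw [← h3, ← h4]
    exact hc.between m hm j hj hlt
  · rw [h4]
    exact ⟨scaleRate_mono hN C ha hb hm (Nat.le_succ m), le_rfl⟩

/-- As `k_1 = 0`, every `j` lies in some `[k_{n+1}, k_{n+2})`. That interval is nonempty, so the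
rate is prescribed at its left end even when other scales coincide. -/
theorem le_rate (hc : IsComparisonRate N K C a b c) (hK : 0 < K) (ha : 0 ≤ a) (j : ℕ) :
    C ≤ c j := by
  have hex : ∃ n, j < scale K (n + 2) := by
    obtain ⟨n, hn⟩ := ((tendsto_scale hK).eventually_gt_atTop j).exists
    exact ⟨n, hn.trans_le (scale_mono hK.le (by omega))⟩
  classical
  set n := Nat.find hex with hn
  have h1 : j < scale K (n + 2) := Nat.find_spec hex
  have h2 : scale K (n + 1) ≤ j := by
    rcases Nat.eq_zero_or_pos n with h0 | h0
    · rw [h0, scale_one]; exact Nat.zero_le _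
    · have := Nat.find_min hex (m := n - 1) (by omega)
      rw [show n - 1 + 2 = n + 1 by omega] at this
      omega
  have h3 := hc.at_scale (n + 1) (by omega) (h2.trans_lt h1)
  have h4 : C ≤ c (scale K (n + 1)) := by rw [h3]; exact le_scaleRate C ha b _
  rcases h2.lt_or_eq with hlt | heq
  · exact h4.trans (hc.between (n + 1) (by omega) j hlt h1).1
  · rwa [heq] at h4

end IsComparisonRate

/-- The expected number of such edges is of order the rate times `N ^ (k_n - k_{n+r})`. The small
power `s` absorbs the logarithm in the rate, and each of the `r` scale gaps gains `n ^ (K log N)`.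
-/
theorem edgeLaw_escapeEvent_comparison_le [NeZero N] (hN : 2 ≤ N) {K C a b s : ℝ} (hK : 0 < K)
    (hC : 0 ≤ C) (ha : 0 ≤ a) (hb : 0 ≤ b) (hs : 0 < s) {c : ℕ → ℝ}
    (hc : IsComparisonRate N K C a b c) (r : ℕ) :
    ∃ D : ℝ, ∀ᶠ n in atTop,
      (edgeLaw N).real (escapeEvent N (connProb N c) (scale K n) (scale K (n + r)))
        ≤ D * ((n : ℝ) + 1) ^ (b * Real.log N + s - r * (K * Real.log N)) := by
  have h0 : (0 : ℝ) < N := by positivity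
  have hL := log_pos_of_two_le hN
  set σ := b * Real.log N + s with hσ
  have hσ0 : 0 ≤ σ := by have := mul_nonneg hb hL.le; linarith
  set A := C + a / s with hA
  have hA0 : 0 ≤ A := by positivity
  set q : ℕ → ℝ := fun m => A * ((m : ℝ) + 1) ^ σ * ((N : ℝ) ^ scale K m)⁻¹ with hq
  obtain ⟨m₀, hm₀⟩ := eventually_atTop.1 (((eventually_scale_lt hK).and
    ((tendsto_branching hN hK).eventually_ge_atTop (2 * 2 ^ σ))).and (eventually_ge_atTop 1))
  refine ⟨2 * A * ((r : ℝ) + 1) ^ σ * N ^ r, eventually_atTop.2 ⟨m₀, fun n hn => ?_⟩⟩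
  have hesc := edgeLaw_escapeEvent_le (N := N) (p := connProb N c) (scale_mono hK.le) (tendsto_scale hK)
    (q := q) (m₀ := m₀) (fun m _ => by positivity) (fun m hm => ?_) (fun m hm => ?_)
    (n := n) (m := n + r) (by omega) (by omega)
  · refine hesc.trans ?_
    have h1 := pow_scale_div_le hN hK.le n r
    have h2 := natCast_add_rpow_le n r hσ0
    have h3 : ((n : ℝ) + 1) ^ (σ - r * (K * Real.log N))
        = ((n : ℝ) + 1) ^ σ * ((n : ℝ) + 1) ^ (-(r * (K * Real.log N))) := by
      rw [← Real.rpow_add (by positivity), sub_eq_add_neg]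
    rw [h3]
    simp only [hq]
    push_cast
    calc 2 * ((N : ℝ) ^ scale K n * (A * ((n : ℝ) + r + 1) ^ σ * ((N : ℝ) ^ scale K (n + r))⁻¹))
        = 2 * A * (((n : ℝ) + r + 1) ^ σ * ((N : ℝ) ^ scale K n *
            ((N : ℝ) ^ scale K (n + r))⁻¹)) := by ring
      _ ≤ 2 * A * ((((r : ℝ) + 1) ^ σ * ((n : ℝ) + 1) ^ σ) *
            ((N : ℝ) ^ r * ((n : ℝ) + 1) ^ (-(r * (K * Real.log N))))) := by gcongr
      _ = _ := by ring
  · simp only [hq]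
    have h1 := (hm₀ m hm).1.2
    have h2 : ((m : ℝ) + 1 + 1) ^ σ ≤ 2 ^ σ * ((m : ℝ) + 1) ^ σ := by
      have := natCast_add_rpow_le m 1 hσ0
      rw [Nat.cast_one, one_add_one_eq_two] at this
      exact this
    have hpos := branching_pos hN K m
    rw [pow_scale_succ hK.le, mul_inv]
    push_cast
    calc A * ((m : ℝ) + 1 + 1) ^ σ * (((N : ℝ) ^ scale K m)⁻¹ * (branching N K m)⁻¹)
        ≤ A * (2 ^ σ * ((m : ℝ) + 1) ^ σ) * (((N : ℝ) ^ scale K m)⁻¹ * (2 * 2 ^ σ)⁻¹) := by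
          gcongr
      _ = _ := by
          have : (0 : ℝ) < 2 ^ σ := by positivity
          field_simp
  · refine ⟨fun i => A * ((m : ℝ) + 1) ^ σ * ((N : ℝ) ^ (2 * i))⁻¹, fun i hi hi' => ?_, ?_⟩
    · refine ⟨by positivity, (min_le_left _ _).trans ?_⟩
      rw [div_eq_mul_inv]
      refine mul_le_mul_of_nonneg_right ?_ (by positivity)
      refine (hc.mem_Icc hN ha hb (hm₀ m hm).2 (hm₀ m hm).1.1 (hm₀ (m + 1) (by omega)).1.1 hi
        hi').2.trans ?_
      have := scaleRate_le_rpow hN hC ha hb hs (n := m + 1) (by omega)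
      push_cast at this
      exact this
    · rw [← Finset.mul_sum, sum_shell_inv_pow (scale_mono hK.le (Nat.le_succ m))]
      refine mul_le_mul_of_nonneg_left ?_ (by positivity)
      rw [div_le_iff₀ h0]
      have h1 : (1 : ℝ) ≤ N := by exact_mod_cast (by omega : 1 ≤ N)
      have h2 : (0 : ℝ) ≤ ((N : ℝ) ^ scale K m)⁻¹ := by positivity
      have h3 : (0 : ℝ) ≤ ((N : ℝ) ^ scale K (m + 1))⁻¹ := by positivity
      nlinarith

theorem summable_nat_add_one_rpow {σ : ℝ} (h : σ < -1) :
    Summable fun n : ℕ => ((n : ℝ) + 1) ^ σ := by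
  have := (summable_nat_add_iff 1).2 (Real.summable_nat_rpow.2 h)
  simpa using this

/-- The condition leaves room for an `s > 0` with the exponent still below `-1`. It is used with `r
= 1` when `b = 0`, `K = 1` and `log N > 1`, and with `r = 2` for the cascade. -/
theorem ae_eventually_notMem_escapeEvent [NeZero N] (hN : 2 ≤ N) {K C a b : ℝ} (hK : 0 < K)
    (hC : 0 ≤ C) (ha : 0 ≤ a) (hb : 0 ≤ b) {c : ℕ → ℝ} (hc : IsComparisonRate N K C a b c) (r : ℕ)
    (h : b * Real.log N + 1 < r * (K * Real.log N)) :
    ∀ᵐ u ∂(edgeLaw N), ∀ᶠ n in atTop,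
      u ∉ escapeEvent N (connProb N c) (scale K n) (scale K (n + r)) := by
  set s := (r * (K * Real.log N) - (b * Real.log N + 1)) / 2 with hs
  obtain ⟨D, hD⟩ := edgeLaw_escapeEvent_comparison_le hN hK hC ha hb (s := s)
    (by rw [hs]; linarith) hc r
  refine ae_eventually_notMem_of_measureReal_le ((summable_nat_add_one_rpow ?_).mul_left D) hD
  linarith

theorem tendsto_nat_add_one_rpow {σ : ℝ} (h : σ < 0) :
    Tendsto (fun n : ℕ => ((n : ℝ) + 1) ^ σ) atTop (nhds 0) := by
  have h1 := tendsto_rpow_neg_atTop (y := -σ) (by linarith)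
  rw [neg_neg] at h1
  exact h1.comp (tendsto_atTop_add_const_right _ _ tendsto_natCast_atTop_atTop)

theorem not_summable_of_eventually_le_inv {f : ℕ → ℝ} {δ : ℝ} (hδ : 0 < δ)
    (h : ∀ᶠ n : ℕ in atTop, δ * ((n : ℝ) + 1)⁻¹ ≤ f n) : ¬ Summable f := by
  intro hsum
  obtain ⟨n₀, hn₀⟩ := eventually_atTop.1 h
  have h1 : Summable fun n : ℕ => δ * (((n + n₀ : ℕ) : ℝ) + 1)⁻¹ :=
    Summable.of_nonneg_of_le (fun n => by positivity) (fun n => hn₀ (n + n₀) (by omega))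
      ((summable_nat_add_iff n₀).2 hsum)
  have h2 := (summable_mul_left_iff hδ.ne').1 h1
  have h3 : Summable fun n : ℕ => ((n + (n₀ + 1) : ℕ) : ℝ)⁻¹ := by
    refine h2.congr fun n => ?_
    push_cast
    ring_nf
  exact Real.not_summable_natCast_inv
    ((summable_nat_add_iff (f := fun n : ℕ => (n : ℝ)⁻¹) (n₀ + 1)).1 h3)

theorem one_lt_log_of_three_le (hN : 3 ≤ N) : 1 < Real.log N := by
  rw [Real.lt_log_iff_exp_lt (by positivity)]
  have h3 : (3 : ℝ) ≤ N := by exact_mod_cast hN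
  linarith [Real.exp_one_lt_d9]

theorem tendsto_scaleRate_div_pow (hN : 3 ≤ N) {C a : ℝ} (hC : 0 ≤ C) (ha : 0 ≤ a) :
    Tendsto (fun n => scaleRate N C a 0 (n + 1) * ((N : ℝ) ^ scale 1 n)⁻¹) atTop (nhds 0) := by
  have hL := one_lt_log_of_three_le hN
  rw [← tendsto_add_atTop_iff_nat 1]
  have h0 : (0 : ℝ) < N := by positivity
  have hlim : Tendsto (fun n : ℕ => (C + a / (1 / 2)) * 2 ^ (1 / 2 : ℝ) * N *
      ((n : ℝ) + 1) ^ (1 / 2 - Real.log N)) atTop (nhds ((C + a / (1 / 2)) * 2 ^ (1 / 2 : ℝ) * N * 0)) :=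
    (tendsto_nat_add_one_rpow (by linarith)).const_mul _
  rw [mul_zero] at hlim
  refine squeeze_zero (fun n => ?_) (fun n => ?_) hlim
  · exact mul_nonneg (hC.trans (le_scaleRate C ha 0 _)) (by positivity)
  · have h1 := scaleRate_le_rpow (N := N) (by omega) hC ha le_rfl (s := 1 / 2) (by norm_num)
      (n := n + 1 + 1) (by omega)
    have h2 := natCast_add_rpow_le n 1 (σ := 1 / 2) (by norm_num)
    have h3 := pow_scale_div_le (N := N) (by omega) (K := 1) zero_le_one n 1
    have h4 : ((N : ℝ) ^ scale 1 (n + 1))⁻¹ ≤ (N : ℝ) ^ scale 1 n * ((N : ℝ) ^ scale 1 (n + 1))⁻¹ :=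
      le_mul_of_one_le_left (by positivity) (one_le_pow₀ (by exact_mod_cast (by omega : 1 ≤ N)))
    have h5 : ((n : ℝ) + 1) ^ (1 / 2 - Real.log N)
        = ((n : ℝ) + 1) ^ (1 / 2 : ℝ) * ((n : ℝ) + 1) ^ (-Real.log N) := by
      rw [← Real.rpow_add (by positivity), sub_eq_add_neg]
    rw [zero_mul, zero_add] at h1
    push_cast at h1 h2 h3
    rw [one_add_one_eq_two] at h2
    rw [one_mul, one_mul, pow_one] at h3
    rw [h5]
    calc _ ≤ ((C + a / (1 / 2)) * (2 ^ (1 / 2 : ℝ) * ((n : ℝ) + 1) ^ (1 / 2 : ℝ))) *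
          (N * ((n : ℝ) + 1) ^ (-Real.log N)) := by
          refine mul_le_mul (h1.trans ?_) (h4.trans h3) (by positivity) (by positivity)
          exact mul_le_mul_of_nonneg_left h2 (by positivity)
      _ = _ := by ring

end HierGroup

/-! ### Non-percolation and pre-percolation -/

namespace HierGroup
open SimpleGraph
variable {N : ℕ} [NeZero N]

/-- A shell has at most `N ^ k_{n+1}` points, so the expected number of edges leaving `B_{k_n}` is
of order `N ^ (k_n - k_{n+1})` times the rate. Half of the gap `(K - b) log N` absorbs the
logarithm, and the remaining power of `n` tends to `0`. -/
theorem not_percolates_of_lower_rates (hN : 2 ≤ N) {K C a b : ℝ} (hC : 0 ≤ C) (ha : 0 ≤ a)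
    (hb : 0 ≤ b) (hbK : b < K) {p : ℕ → ℝ}
    (hp : ∀ n ≥ 1, ∀ j, scale K n < j → j ≤ scale K (n + 1) →
      p j = min (scaleRate N C a b n / (N : ℝ) ^ (2 * scale K (n + 1))) 1) :
    ¬ Percolates N p := by
  have h0 : (0 : ℝ) < N := by positivity
  have hL := log_pos_of_two_le hN
  have hK : 0 < K := hb.trans_lt hbK
  set s := (K * Real.log N - b * Real.log N) / 2 with hs
  have hs0 : 0 < s := by rw [hs]; nlinarith
  set σ := b * Real.log N + s with hσ
  have hσ0 : 0 ≤ σ := by have := mul_nonneg hb hL.le; linarith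
  set A := C + a / s with hA
  have hA0 : 0 ≤ A := by positivity
  set q : ℕ → ℝ := fun m => A * ((m : ℝ) + 1) ^ σ * ((N : ℝ) ^ scale K (m + 1))⁻¹ with hq
  obtain ⟨m₀, hm₀⟩ := eventually_atTop.1 (((tendsto_branching hN hK).eventually_ge_atTop
    (2 * 2 ^ σ)).and (eventually_ge_atTop 1))
  have hbound : ∀ n ≥ m₀, (edgeLaw N).real (escapeEvent N p (scale K n) (scale K n))
      ≤ 2 * A * N * ((n : ℝ) + 1) ^ (σ - K * Real.log N) := by
    intro n hn
    have hesc := edgeLaw_escapeEvent_le (N := N) (p := p) (scale_mono hK.le) (tendsto_scale hK)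
      (q := q) (m₀ := m₀) (fun m _ => by positivity) (fun m hm => ?_) (fun m hm => ?_)
      (n := n) le_rfl hn
    · refine hesc.trans ?_
      have h1 := pow_scale_div_le hN hK.le n 1
      have h3 : ((n : ℝ) + 1) ^ (σ - K * Real.log N)
          = ((n : ℝ) + 1) ^ σ * ((n : ℝ) + 1) ^ (-(((1 : ℕ) : ℝ) * (K * Real.log N))) := by
        rw [← Real.rpow_add (by positivity), sub_eq_add_neg, Nat.cast_one, one_mul]
      rw [h3]
      simp only [hq]
      calc 2 * ((N : ℝ) ^ scale K n * (A * ((n : ℝ) + 1) ^ σ * ((N : ℝ) ^ scale K (n + 1))⁻¹))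
          = 2 * A * ((n : ℝ) + 1) ^ σ * ((N : ℝ) ^ scale K n *
              ((N : ℝ) ^ scale K (n + 1))⁻¹) := by ring
        _ ≤ 2 * A * ((n : ℝ) + 1) ^ σ *
              ((N : ℝ) ^ 1 * ((n : ℝ) + 1) ^ (-(((1 : ℕ) : ℝ) * (K * Real.log N)))) := by gcongr
        _ = _ := by rw [pow_one]; ring
    · simp only [hq]
      have h1 := (hm₀ (m + 1) (by omega)).1
      have h2 : ((m : ℝ) + 1 + 1) ^ σ ≤ 2 ^ σ * ((m : ℝ) + 1) ^ σ := by
        have := natCast_add_rpow_le m 1 hσ0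
        rw [Nat.cast_one, one_add_one_eq_two] at this
        exact this
      have hpos := branching_pos hN K (m + 1)
      rw [pow_scale_succ hK.le (m + 1), mul_inv]
      push_cast
      calc A * ((m : ℝ) + 1 + 1) ^ σ * (((N : ℝ) ^ scale K (m + 1))⁻¹ * (branching N K (m + 1))⁻¹)
          ≤ A * (2 ^ σ * ((m : ℝ) + 1) ^ σ) *
              (((N : ℝ) ^ scale K (m + 1))⁻¹ * (2 * 2 ^ σ)⁻¹) := by gcongr
        _ = _ := by
            have : (0 : ℝ) < 2 ^ σ := by positivity
            field_simp
    · refine ⟨fun _ => A * ((m : ℝ) + 1) ^ σ * ((N : ℝ) ^ (2 * scale K (m + 1)))⁻¹,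
        fun i hi hi' => ⟨by positivity, ?_⟩, ?_⟩
      · rw [hp m (hm₀ m hm).2 i hi hi']
        refine (min_le_left _ _).trans ?_
        rw [div_eq_mul_inv]
        refine mul_le_mul_of_nonneg_right ?_ (by positivity)
        refine (scaleRate_le_rpow hN hC ha hb hs0 (hm₀ m hm).2).trans ?_
        refine mul_le_mul_of_nonneg_left ?_ hA0
        exact Real.rpow_le_rpow (by positivity) (by linarith) hσ0
      · rw [Finset.sum_const, nsmul_eq_mul]
        simp only [hq]
        have h1 : ((shell N (scale K m) (scale K (m + 1))).card : ℝ) ≤ (N : ℝ) ^ scale K (m + 1) := by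
          rw [← Nat.cast_pow, ← card_block (N := N) _ 0]
          exact_mod_cast Finset.card_le_card Finset.sdiff_subset
        have h2 : (0 : ℝ) < (N : ℝ) ^ scale K (m + 1) := by positivity
        calc _ ≤ (N : ℝ) ^ scale K (m + 1) *
              (A * ((m : ℝ) + 1) ^ σ * ((N : ℝ) ^ (2 * scale K (m + 1)))⁻¹) := by gcongr
          _ = _ := by
            rw [two_mul, pow_add]
            field_simp
  unfold Percolates
  rw [not_lt, nonpos_iff_eq_zero, ← measureReal_eq_zero_iff]
  have hlim : Tendsto (fun n : ℕ => 2 * A * N * ((n : ℝ) + 1) ^ (σ - K * Real.log N)) atTop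
      (nhds (2 * A * N * 0)) :=
    (tendsto_nat_add_one_rpow (by rw [hσ, hs]; nlinarith)).const_mul _
  rw [mul_zero] at hlim
  refine le_antisymm (ge_of_tendsto hlim (eventually_atTop.2 ⟨m₀, fun n hn => ?_⟩))
    measureReal_nonneg
  refine le_trans (measureReal_mono (fun u hu => ?_) (measure_ne_top _ _)) (hbound n hn)
  by_contra hcon
  exact finite_supp_of_notMem_escapeEvent hcon hu

theorem prePercolates (hN : 2 ≤ N) {K C a : ℝ} (hK : 0 < K) (hC : 0 ≤ C) (ha : 1 < a) {c : ℕ → ℝ}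
    (hc : IsComparisonRate N K C (a * N) 0 c) : PrePercolates N K (connProb N c) := by
  have h0 : (0 : ℝ) < N := by positivity
  have ha0 : 0 < a := by linarith
  -- Any exponent strictly between `1` and `a` is summable and leaves room for the inner boundary
  -- corrections `1 - M⁻¹` and `1 - M'⁻¹`. The threshold `4 * a / (a - 1)` for the branching numbers
  -- makes their product at least `a' / a`.
  set a' := (1 + a) / 2 with ha'
  obtain ⟨m₀, hm₀⟩ := eventually_atTop.1 ((eventually_scale_lt hK).and
    ((tendsto_branching hN hK).eventually_ge_atTop (max 1 (4 * a / (a - 1)))))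
  have hbound : ∀ᶠ n in atTop, (edgeLaw N).real (noEdge (connProb N c)
      (shell N (scale K n) (scale K (n + 1))) (shell N (scale K (n + 1)) (scale K (n + 2))))
      ≤ ((n : ℝ) + 1) ^ (-a') := by
    refine eventually_atTop.2 ⟨m₀, fun n hn => ?_⟩
    have hdisj : Disjoint (shell N (scale K n) (scale K (n + 1)))
        (shell N (scale K (n + 1)) (scale K (n + 2))) := by
      rw [Finset.disjoint_left]
      intro y hy hy'
      rw [mem_shell] at hy hy'
      omega
    set G := scaleRate N C (a * N) 0 (n + 1) with hG
    have hGlog : a * N * Real.log (n + 1) ≤ G := by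
      rw [hG, scaleRate_eq hN _ _ _ (by omega)]
      push_cast
      rw [zero_mul, Real.rpow_zero, mul_one]
      linarith
    have hlog : 0 ≤ Real.log ((n : ℝ) + 1) := Real.log_nonneg (by linarith [n.cast_nonneg (α := ℝ)])
    have hG0 : 0 ≤ G := le_trans (by positivity) hGlog
    refine (edgeLaw_noEdge_le (connProb N c) hdisj
      (f := fun _ y => G * ((N : ℝ) ^ (2 * hdist 0 y))⁻¹) fun x hx y hy => ⟨by positivity, ?_⟩).trans ?_
    · rw [mem_shell] at hx hy
      rw [hdist_eq_of_lt (show hdist 0 x < hdist 0 y by omega), connProb, ← div_eq_mul_inv]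
      refine min_le_min_right 1 (div_le_div_of_nonneg_right ?_ (by positivity))
      exact (hc.mem_Icc hN (by positivity) le_rfl (by omega) (hm₀ (n + 1) (by omega)).1
        (hm₀ (n + 2) (by omega)).1 hy.1 hy.2).1
    · rw [Finset.sum_const, ← Finset.mul_sum, sum_shell_inv_pow (scale_mono hK.le (by omega)),
        nsmul_eq_mul, card_shell (scale_mono hK.le (by omega)), Real.rpow_def_of_pos (by positivity),
        Real.exp_le_exp, mul_neg, neg_le_neg_iff,
        Nat.cast_sub (Nat.pow_le_pow_right (by omega) (scale_mono hK.le (by omega)))]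
      push_cast
      have e1 := pow_scale_succ (N := N) hK.le n
      have e2 := pow_scale_succ (N := N) hK.le (n + 1)
      have hb1 := (hm₀ n hn).2
      have hb2 := (hm₀ (n + 1) (by omega)).2
      set M := branching N K n
      set M' := branching N K (n + 1)
      have hT : (0 : ℝ) < (N : ℝ) ^ scale K n := by positivity
      have hM1 : 1 ≤ M := (le_max_left _ _).trans hb1
      have hM1' : 1 ≤ M' := (le_max_left _ _).trans hb2
      have hinv : ∀ B : ℝ, max 1 (4 * a / (a - 1)) ≤ B → B⁻¹ ≤ (a - 1) / (4 * a) := fun B hB => by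
        rw [← inv_div]
        exact inv_anti₀ (div_pos (by linarith) (by linarith)) ((le_max_right _ _).trans hB)
      have hi := hinv M hb1
      have hi' := hinv M' hb2
      have hi0 : 0 < M⁻¹ := by positivity
      have hi0' : 0 < M'⁻¹ := by positivity
      have key : a' / a ≤ (1 - M⁻¹) * (1 - M'⁻¹) := by
        have h1 : a' / a = 1 - 2 * ((a - 1) / (4 * a)) := by
          rw [ha']; field_simp; ring
        rw [h1]
        nlinarith [mul_pos hi0 hi0']
      have e3 : ((N : ℝ) ^ scale K (n + 1) - (N : ℝ) ^ scale K n) *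
          (G * ((((N : ℝ) ^ scale K (n + 1))⁻¹ - ((N : ℝ) ^ scale K (n + 1 + 1))⁻¹) / N))
          = G / N * ((1 - M⁻¹) * (1 - M'⁻¹)) := by
        rw [e2, e1]
        field_simp
      rw [show n + 2 = n + 1 + 1 by omega, e3]
      have h5 : a * Real.log (n + 1) ≤ G / N := by
        rw [le_div_iff₀ h0]; linarith
      calc Real.log (n + 1) * a' = a * Real.log (n + 1) * (a' / a) := by field_simp
        _ ≤ G / N * ((1 - M⁻¹) * (1 - M'⁻¹)) := by
            have : 0 ≤ a' / a := by positivity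
            gcongr
  have hae := ae_eventually_notMem_of_measureReal_le (μ := edgeLaw N)
    (summable_nat_add_one_rpow (by rw [ha']; linarith : -a' < -1)) hbound
  filter_upwards [hae] with u hu
  obtain ⟨n₀, hn₀⟩ := eventually_atTop.1 hu
  refine ⟨n₀, fun n hn => ?_⟩
  by_contra hcon
  push Not at hcon
  exact hn₀ n hn fun x hx y hy => hcon x (mem_shell.1 hx) y (mem_shell.1 hy)

theorem isLocal_noEdge_shell (p : ℕ → ℝ) {k l : ℕ} (hkl : k ≤ l) :
    IsLocal p (block l 0) (noEdge p (block k 0) (shell N k l)) := fun _ _ huv hu x hx y hy hxy =>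
  hu x hx y hy (adj_of_inside_eq huv.symm (block_mono hkl 0 hx) (Finset.sdiff_subset hy) hxy)

-- Peel off the largest index `a`: the earlier events see only edges inside `B_{k a}`, while the
-- last one reads pairs with an end point outside that ball.
open ProbabilityTheory in
theorem iIndepSet_noEdge_shell (p : ℕ → ℝ) {k : ℕ → ℕ} (hk : Monotone k) :
    iIndepSet (fun n => noEdge p (block (k n) 0) (shell N (k n) (k (n + 1)))) (edgeLaw N) := by
  have hm : ∀ n, MeasurableSet (noEdge p (block (k n) 0) (shell N (k n) (k (n + 1)))) := fun n =>
    (isLocal_noEdge_shell p (hk (Nat.le_succ n))).measurableSet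
  rw [iIndepSet_iff_meas_biInter hm]
  intro t
  induction t using Finset.induction_on_max with
  | empty => simp
  | insert a t hat ih =>
    have hnot : a ∉ t := fun h => lt_irrefl a (hat a h)
    rw [Finset.prod_insert hnot, Finset.set_biInter_insert, ← ih]
    have hloc : IsLocal p (block (k a) 0)
        (⋂ i ∈ t, noEdge p (block (k i) 0) (shell N (k i) (k (i + 1)))) := fun u v huv hu => by
      simp only [Set.mem_iInter] at hu ⊢
      exact fun i hi => ((isLocal_noEdge_shell p (hk (Nat.le_succ i))).mono
        (block_mono (hk (Nat.succ_le_of_lt (hat i hi))) 0)) u v huv (hu i hi)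
    refine measure_inter_eq_mul_of_disjoint _ (hm a) (eventOn_noEdge p _ _) hloc.measurableSet
      hloc.eventOn ?_
    rw [Set.disjoint_left]
    rintro e ⟨x, hx, y, hy, rfl⟩ he
    exact (Finset.mem_sdiff.1 hy).2 (mem_innerEdges.1 he).2

/-- The bound on the expected number of edges is `C / N + a log (n + 1)`. With the loss factor `1 +
η = 1 / a` the exponential is exactly a constant times a harmonic term. -/
theorem eventually_le_edgeLaw_noEdge_shell (hN : 3 ≤ N) {C a η : ℝ} (hC : 0 ≤ C) (ha0 : 0 < a)
    (hη0 : 0 < η) (hηa : (1 + η) * a = 1) {c : ℕ → ℝ} (hc : IsComparisonRate N 1 C (a * N) 0 c) :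
    ∀ᶠ n : ℕ in atTop, Real.exp (-((1 + η) * (C / N))) * ((n : ℝ) + 1)⁻¹ ≤ (edgeLaw N).real
      (noEdge (connProb N c) (block (scale 1 n) 0) (shell N (scale 1 n) (scale 1 (n + 1)))) := by
  have h0 : (0 : ℝ) < N := by positivity
  have hN2 : 2 ≤ N := by omega
  have hmono := scale_mono (K := 1) zero_le_one
  filter_upwards [(tendsto_scaleRate_div_pow hN hC (mul_nonneg ha0.le h0.le)).eventually_le_const
    (show 0 < η / (1 + η) by positivity), eventually_scale_lt (K := 1) one_pos,
    (tendsto_add_atTop_nat 1).eventually (eventually_scale_lt (K := 1) one_pos),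
    eventually_ge_atTop 1] with n hsmall hlt hlt' hn
  set G := scaleRate N C (a * N) 0 (n + 1) with hG
  have hG0 : 0 ≤ G := hC.trans (le_scaleRate C (by positivity) 0 _)
  have hdisj : Disjoint (block (scale 1 n) 0) (shell N (scale 1 n) (scale 1 (n + 1))) :=
    Finset.disjoint_sdiff
  refine le_trans ?_ (le_edgeLaw_noEdge (connProb N c) hdisj (η := η)
    (f := fun _ y => G * ((N : ℝ) ^ (2 * hdist 0 y))⁻¹) hη0 fun x hx y hy =>
      ⟨by positivity, ?_, ?_⟩)
  · rw [Finset.sum_const, ← Finset.mul_sum, sum_shell_inv_pow (hmono (Nat.le_succ n)), card_block,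
      nsmul_eq_mul]
    have e1 : Real.log ((n : ℝ) + 1) = (1 + η) * (a * Real.log (n + 1)) := by
      rw [← mul_assoc, hηa, one_mul]
    have e2 : ((n : ℝ) + 1)⁻¹ = Real.exp (-Real.log (n + 1)) := by
      rw [Real.exp_neg, Real.exp_log (by positivity)]
    rw [e2, ← Real.exp_add, Real.exp_le_exp, e1, ← neg_add, neg_le_neg_iff, ← mul_add]
    refine mul_le_mul_of_nonneg_left ?_ (by positivity)
    have e3 : C / N + a * Real.log (n + 1) = G / N := by
      rw [hG, scaleRate_eq hN2 _ _ _ (by omega)]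
      push_cast
      rw [zero_mul, Real.rpow_zero, mul_one]
      field_simp
    rw [e3]
    have hT : (0 : ℝ) < (N : ℝ) ^ scale 1 n := by positivity
    have hT' : (0 : ℝ) < (N : ℝ) ^ scale 1 (n + 1) := by positivity
    push_cast
    calc (N : ℝ) ^ scale 1 n * (G * ((((N : ℝ) ^ scale 1 n)⁻¹ -
          ((N : ℝ) ^ scale 1 (n + 1))⁻¹) / N))
        ≤ (N : ℝ) ^ scale 1 n * (G * (((N : ℝ) ^ scale 1 n)⁻¹ / N)) := by
          gcongr
          exact sub_le_self _ (by positivity)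
      _ = G / N := by field_simp
  · have hy' := mem_shell.1 hy
    rw [hdist_eq_of_mem_block_of_notMem hx (Finset.mem_sdiff.1 hy).2, connProb]
    refine (min_le_left _ _).trans ?_
    rw [div_eq_mul_inv]
    refine mul_le_mul_of_nonneg_right ?_ (by positivity)
    exact (hc.mem_Icc hN2 (by positivity) le_rfl hn hlt hlt' hy'.1 hy'.2).2
  · refine le_trans (mul_le_mul_of_nonneg_left ?_ hG0) hsmall
    have hy' := mem_shell.1 hy
    refine inv_anti₀ (by positivity) (pow_le_pow_right₀ ?_ (by omega))
    exact_mod_cast (by omega : 1 ≤ N)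

/-- The second Borel–Cantelli lemma gives infinitely many `n` without edges from `B_{k_n}` to the
next shell; the first one excludes edges beyond that shell for large `n`. Some ball is then cut off
completely. -/
theorem not_percolates_of_lt_one (hN : 3 ≤ N) {C a : ℝ} (hC : 0 ≤ C) (ha0 : 0 < a) (ha : a < 1)
    {c : ℕ → ℝ} (hc : IsComparisonRate N 1 C (a * N) 0 c) : ¬ Percolates N (connProb N c) := by
  have h0 : (0 : ℝ) < N := by positivity
  have hN2 : 2 ≤ N := by omega
  have hL := one_lt_log_of_three_le hN
  have hmono := scale_mono (K := 1) zero_le_one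
  set F : ℕ → Set (Sym2 (HierGroup N) → unitInterval) := fun n =>
    noEdge (connProb N c) (block (scale 1 n) 0) (shell N (scale 1 n) (scale 1 (n + 1))) with hF
  set η := 1 / a - 1 with hη
  have hη0 : 0 < η := by
    rw [hη, sub_pos, lt_div_iff₀ ha0]; linarith
  have hηa : (1 + η) * a = 1 := by rw [hη]; field_simp; ring
  have hlow : ∀ᶠ n : ℕ in atTop,
      Real.exp (-((1 + η) * (C / N))) * ((n : ℝ) + 1)⁻¹ ≤ (edgeLaw N).real (F n) :=
    eventually_le_edgeLaw_noEdge_shell hN hC ha0 hη0 hηa hc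
  have hlimsup : edgeLaw N (limsup F atTop) = 1 := by
    refine ProbabilityTheory.measure_limsup_eq_one
      (fun n => (isLocal_noEdge_shell _ (hmono (Nat.le_succ n))).measurableSet)
      (iIndepSet_noEdge_shell _ hmono) ?_
    by_contra hne
    exact not_summable_of_eventually_le_inv (Real.exp_pos _) hlow (ENNReal.summable_toReal hne)
  have hio : ∀ᵐ u ∂(edgeLaw N), ∃ᶠ n in atTop, u ∈ F n := by
    have hmeas : MeasurableSet (limsup F atTop) := MeasurableSet.measurableSet_limsup fun n =>
      (isLocal_noEdge_shell _ (hmono (Nat.le_succ n))).measurableSet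
    have := (prob_compl_eq_zero_iff hmeas).2 hlimsup
    filter_upwards [measure_eq_zero_iff_ae_notMem.1 this] with u hu
    rw [Set.notMem_compl_iff, mem_limsup_iff_frequently_mem] at hu
    exact hu
  have hesc := ae_eventually_notMem_escapeEvent hN2 one_pos hC (mul_nonneg ha0.le h0.le) le_rfl hc 1
    (by push_cast; linarith)
  unfold Percolates
  rw [not_lt, nonpos_iff_eq_zero, measure_eq_zero_iff_ae_notMem]
  filter_upwards [hio, hesc] with u hu hu'
  obtain ⟨n, hn, hn'⟩ := (hu.and_eventually hu').exists
  refine finite_supp_of_notMem_escapeEvent (k := scale 1 n) ?_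
  rintro ⟨x, hx, y, hy, hxy⟩
  by_cases hy' : y ∈ block (scale 1 (n + 1)) (0 : HierGroup N)
  · exact hn x hx y (Finset.mem_sdiff.2 ⟨hy', hy⟩) hxy
  · exact hn' ⟨x, hx, y, hy', hxy⟩

end HierGroup

/-! ### Numerical conditions for the renormalization -/

namespace HierGroup
variable {N : ℕ}

/-- The branching number must exceed `2 / (ε n * ε (n + 1))`, which is of order `n ^ (2 * θ)`. -/
theorem eventually_count_bound (hN : 2 ≤ N) {K θ : ℝ} (hK : 0 < K) (hθ : 0 ≤ θ)
    (hθK : 2 * θ < K * Real.log N) :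
    ∀ᶠ n : ℕ in atTop, 1 / (((n : ℝ) + 1) ^ (-θ) * branching N K n)
      ≤ (((n + 1 : ℕ) : ℝ) + 1) ^ (-θ) / 2 := by
  have h0 : (0 : ℝ) < N := by positivity
  have hlim : Tendsto (fun n : ℕ => ((n : ℝ) + 1) ^ (K * Real.log N - 2 * θ)) atTop atTop :=
    (tendsto_rpow_atTop (by linarith)).comp
      (tendsto_atTop_add_const_right _ _ tendsto_natCast_atTop_atTop)
  filter_upwards [hlim.eventually_ge_atTop (2 * 2 ^ θ * N)] with n hn
  have hM := branching_lower hN hK.le n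
  have hMpos := branching_pos hN K n
  have hy := natCast_add_rpow_le n 1 hθ
  push_cast at hy ⊢
  rw [one_add_one_eq_two] at hy
  have hsplit : ((n : ℝ) + 1) ^ (K * Real.log N)
      = ((n : ℝ) + 1) ^ θ * ((n : ℝ) + 1) ^ θ * ((n : ℝ) + 1) ^ (K * Real.log N - 2 * θ) := by
    rw [← Real.rpow_add (by positivity), ← Real.rpow_add (by positivity)]
    ring_nf
  rw [hsplit, div_le_iff₀ h0] at hM
  rw [Real.rpow_neg (by positivity), Real.rpow_neg (by positivity)]
  set x := ((n : ℝ) + 1) ^ θ with hx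
  set y := ((n : ℝ) + 1 + 1) ^ θ
  set z := ((n : ℝ) + 1) ^ (K * Real.log N - 2 * θ)
  have hxpos : 0 < x := by positivity
  have hypos : 0 < y := by positivity
  have key : 2 * x * y ≤ branching N K n := by
    refine le_of_mul_le_mul_right ?_ h0
    calc 2 * x * y * N ≤ 2 * x * (2 ^ θ * x) * N := by gcongr
      _ = x * x * (2 * 2 ^ θ * N) := by ring
      _ ≤ x * x * z := by gcongr
      _ ≤ branching N K n * N := hM
  have e1 : 1 / (x⁻¹ * branching N K n) = x / branching N K n := by field_simp
  have e2 : y⁻¹ / 2 = 1 / (2 * y) := by field_simp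
  rw [e1, e2, div_le_div_iff₀ hMpos (by positivity)]
  linarith

/-- A lower bound for the connection probabilities between the scales `k_n` and `k_{n+1}`. -/
def lowerRate (N : ℕ) (K b : ℝ) (n : ℕ) : ℝ :=
  Real.log n * (n : ℝ) ^ (b * Real.log N) * ((N : ℝ) ^ (2 * scale K (n + 1)))⁻¹

/-- The exponent equals `log n * n ^ (b log N)` divided by `16` times the branching number. Since `K
< b` it exceeds every multiple of `log n`; the multiple `κ + θ + 1` pays for the branching factor,
for `ε (n + 1)`, and with one spare power for the constants. -/
theorem eventually_link_bound (hN : 2 ≤ N) {K b θ : ℝ} (hK : 0 < K) (hKb : K < b) (hθ : 0 ≤ θ) :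
    ∀ᶠ n : ℕ in atTop, 2 * (branching N K n * Real.exp (-(lowerRate N K b n *
      (N : ℝ) ^ (2 * scale K n) * branching N K n / 16)))
      ≤ (((n + 1 : ℕ) : ℝ) + 1) ^ (-θ) / 2 := by
  have h0 : (0 : ℝ) < N := by positivity
  have hL := log_pos_of_two_le hN
  set κ := K * Real.log N with hκ
  have hκ0 : 0 < κ := mul_pos hK hL
  set δ := b * Real.log N - κ with hδ
  have hδ0 : 0 < δ := by rw [hδ, hκ]; nlinarith
  set D := (N : ℝ) ^ (K + 1) * 2 ^ κ with hD
  have hD0 : 0 < D := by positivity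
  have hlim : Tendsto (fun n : ℕ => (n : ℝ) ^ δ) atTop atTop :=
    (tendsto_rpow_atTop hδ0).comp tendsto_natCast_atTop_atTop
  filter_upwards [hlim.eventually_ge_atTop ((κ + θ + 1) * (16 * D)), eventually_ge_atTop 1,
    tendsto_natCast_atTop_atTop.eventually_ge_atTop (4 * D * 3 ^ θ)] with n hn hn1 hn2
  have hn0 : (0 : ℝ) < n := by exact_mod_cast hn1
  have hn1' : (1 : ℝ) ≤ n := by exact_mod_cast hn1
  have hlog := Real.log_natCast_nonneg n
  have hMpos := branching_pos hN K n
  have hM : branching N K n ≤ D * (n : ℝ) ^ κ := by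
    refine (branching_upper hN hK.le n).trans ?_
    rw [hD, mul_assoc, ← Real.mul_rpow (by norm_num) hn0.le]
    refine mul_le_mul_of_nonneg_left ?_ (by positivity)
    exact Real.rpow_le_rpow (by positivity) (by linarith) hκ0.le
  have hexp : lowerRate N K b n * (N : ℝ) ^ (2 * scale K n) * branching N K n / 16
      = Real.log n * (n : ℝ) ^ (b * Real.log N) / (16 * branching N K n) := by
    have hT : (0 : ℝ) < (N : ℝ) ^ scale K n := by positivity
    rw [lowerRate, pow_mul', pow_mul', pow_scale_succ hK.le]
    field_simp
  have hE : (κ + θ + 1) * Real.log n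
      ≤ lowerRate N K b n * (N : ℝ) ^ (2 * scale K n) * branching N K n / 16 := by
    rw [hexp, le_div_iff₀ (by positivity)]
    have e1 : (n : ℝ) ^ (b * Real.log N) = (n : ℝ) ^ δ * (n : ℝ) ^ κ := by
      rw [← Real.rpow_add hn0, hδ, sub_add_cancel]
    have e2 : (0 : ℝ) ≤ κ + θ + 1 := by positivity
    rw [e1]
    calc (κ + θ + 1) * Real.log n * (16 * branching N K n)
        ≤ (κ + θ + 1) * Real.log n * (16 * (D * (n : ℝ) ^ κ)) := by gcongr
      _ = Real.log n * (((κ + θ + 1) * (16 * D)) * (n : ℝ) ^ κ) := by ring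
      _ ≤ Real.log n * ((n : ℝ) ^ δ * (n : ℝ) ^ κ) := by gcongr
  have hexp2 : Real.exp (-(lowerRate N K b n * (N : ℝ) ^ (2 * scale K n) *
      branching N K n / 16)) ≤ (n : ℝ) ^ (-(κ + θ + 1)) := by
    rw [Real.rpow_def_of_pos hn0, Real.exp_le_exp]
    linarith
  have e3 : (n : ℝ) ^ (-(κ + θ + 1)) = ((n : ℝ) ^ κ * (n : ℝ) ^ θ * n)⁻¹ := by
    rw [Real.rpow_neg hn0.le, Real.rpow_add hn0, Real.rpow_add hn0, Real.rpow_one]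
  have e4 : ((n : ℝ) + 1 + 1) ^ θ ≤ 3 ^ θ * (n : ℝ) ^ θ := by
    rw [← Real.mul_rpow (by norm_num) hn0.le]
    exact Real.rpow_le_rpow (by positivity) (by linarith) hθ
  push_cast
  have hnκ : 0 < (n : ℝ) ^ κ := by positivity
  have hnθ : 0 < (n : ℝ) ^ θ := by positivity
  calc 2 * (branching N K n * Real.exp (-(lowerRate N K b n *
      (N : ℝ) ^ (2 * scale K n) * branching N K n / 16)))
      ≤ 2 * (D * (n : ℝ) ^ κ * ((n : ℝ) ^ κ * (n : ℝ) ^ θ * n)⁻¹) := by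
        rw [← e3]
        gcongr
    _ = 2 * D / ((n : ℝ) ^ θ * n) := by field_simp
    _ ≤ 1 / (2 * ((n : ℝ) + 1 + 1) ^ θ) := by
        rw [div_le_div_iff₀ (by positivity) (by positivity)]
        calc 2 * D * (2 * ((n : ℝ) + 1 + 1) ^ θ) ≤ 2 * D * (2 * (3 ^ θ * (n : ℝ) ^ θ)) := by
              gcongr
          _ = (4 * D * 3 ^ θ) * (n : ℝ) ^ θ := by ring
          _ ≤ n * (n : ℝ) ^ θ := by gcongr
          _ = 1 * ((n : ℝ) ^ θ * n) := by ring
    _ = ((n : ℝ) + 1 + 1) ^ (-θ) / 2 := by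
        rw [Real.rpow_neg (by positivity)]
        field_simp

theorem exists_renormalizable [NeZero N] (hN : 2 ≤ N) {K b : ℝ} (hK : 2 / Real.log N < K)
    (hKb : K < b) :
    ∃ (n₀ : ℕ) (β ε lam : ℕ → ℝ), ∀ C a : ℝ, (N : ℝ) ^ (2 * scale K n₀) ≤ C → 1 ≤ a →
      ∀ c : ℕ → ℝ, IsComparisonRate N K C a b c →
        Renormalizable N (connProb N c) (scale K) n₀ β ε lam := by
  have h0 : (0 : ℝ) < N := by positivity
  have h1N : (1 : ℝ) ≤ N := by exact_mod_cast (by omega : 1 ≤ N)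
  have hL := log_pos_of_two_le hN
  have hKL : 2 < K * Real.log N := (div_lt_iff₀ hL).1 hK
  have hK0 : 0 < K := (div_pos two_pos hL).trans hK
  have hb0 : 0 < b := hK0.trans hKb
  -- The midpoint of `1` and `K log N / 2`: above `1` for summability, and `2 * θ < K log N` for the
  -- count.
  set θ := 1 / 2 + K * Real.log N / 4 with hθ
  have hθ1 : 1 < θ := by rw [hθ]; linarith
  set ε : ℕ → ℝ := fun n => ((n : ℝ) + 1) ^ (-θ) with hε
  have hεs : Summable ε := summable_nat_add_one_rpow (by linarith)
  have hεpos : ∀ n, 0 < ε n := fun n => by simp only [hε]; positivity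
  set tail : ℕ → ℝ := fun n => ∑' i, ε (i + n) with htail
  have htail0 : ∀ n, 0 ≤ tail n := fun n => tsum_nonneg fun i => (hεpos _).le
  have htails : ∀ n, tail n = ε n + tail (n + 1) := fun n => by
    have := ((summable_nat_add_iff n).2 hεs).tsum_eq_zero_add
    simp only [htail]
    rw [this, zero_add]
    congr 2
    ext i
    congr 1
    omega
  have htaillim : Tendsto tail atTop (nhds 0) := tendsto_sum_nat_add ε
  obtain ⟨n₀, hn₀⟩ := eventually_atTop.1 ((((eventually_count_bound hN hK0 (by linarith : 0 ≤ θ)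
    (by rw [hθ]; linarith)).and (eventually_link_bound hN hK0 hKb (by linarith : 0 ≤ θ))).and
    ((eventually_scale_lt hK0).and (htaillim.eventually_le_const (by norm_num : (0 : ℝ) < 1 / 8)))).and
    (eventually_ge_atTop 1))
  -- Tails make the recursion for the densities exact; as they are at most `1/8` from `n₀` on, the
  -- densities stay in `[3/4, 1]`. The scale `n₀` is fixed before `C` and `a`, so the lower bound on
  -- `C` depends on `N`, `K`, `b` only.
  refine ⟨n₀, fun n => 3 / 4 + 2 * tail n, ε, lowerRate N K b, fun C a hC ha c hc => ?_⟩
  have hC0 : 0 ≤ C := le_trans (by positivity) hC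
  have ha0 : 0 ≤ a := by linarith
  refine
  { mono := scale_mono hK0.le
    lt_succ := fun n hn => (hn₀ n hn).1.2.1
    density_ge := fun n _ => by linarith [htail0 n]
    density_le := fun n hn => by linarith [(hn₀ n hn).1.2.2]
    density_succ := fun n _ => by linarith [htails n]
    eps_pos := hεpos
    eps_summable := hεs
    eps_tsum := by
      have := (hn₀ (n₀ + 1) (by omega)).1.2.2
      simp only [htail] at this
      linarith
    lam_nonneg := fun n hn => ?_
    lam_le := fun n hn j hj hj' => ?_
    count_bound := fun n hn => (hn₀ n hn).1.1.1
    link_bound := fun n hn => (hn₀ n hn).1.1.2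
    eps_le := fun n => ?_
    base := fun j hj hj' => ?_ }
  · have := Real.log_natCast_nonneg n
    unfold lowerRate
    positivity
  · have h1 := (hc.mem_Icc hN ha0 hb0.le (hn₀ n hn).2 (hn₀ n hn).1.2.1
      (hn₀ (n + 1) (by omega)).1.2.1 hj hj').1
    refine min_le_min_right 1 ?_
    rw [lowerRate, div_eq_mul_inv]
    have h2 : Real.log n * (n : ℝ) ^ (b * Real.log N) ≤ c j := by
      refine le_trans ?_ h1
      rw [scaleRate_eq hN C a b (hn₀ n hn).2]
      have h3 : 0 ≤ Real.log n * (n : ℝ) ^ (b * Real.log N) := by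
        have := Real.log_natCast_nonneg n
        positivity
      nlinarith
    refine mul_le_mul h2 ?_ (by positivity) (hC0.trans (hc.le_rate hK0 ha0 j))
    exact inv_anti₀ (by positivity) (pow_le_pow_right₀ h1N (by omega))
  · simp only [hε]
    exact Real.rpow_le_one_of_one_le_of_nonpos (by linarith [n.cast_nonneg (α := ℝ)]) (by linarith)
  · refine le_min ?_ le_rfl
    rw [le_div_iff₀ (by positivity), one_mul]
    exact (pow_le_pow_right₀ h1N (by omega)).trans (hC.trans (hc.le_rate hK0 ha0 j))

end HierGroup

end

theorem theorem3p5 (N : ℕ) (hN : 2 ≤ N) :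
    -- part (a)
    (3 ≤ N → ∀ C a : ℝ, 0 ≤ C → 0 < a → ∀ c : ℕ → ℝ,
      HierGroup.IsComparisonRate N 1 C (a * N) 0 c →
        (a < 1 → ¬ HierGroup.Percolates N (HierGroup.connProb N c)) ∧
        (1 < a → HierGroup.PrePercolates N 1 (HierGroup.connProb N c))) ∧
    -- part (b)
    (∀ K b : ℝ, 2 / Real.log N < K → K < b →
      ∃ C₀ > 0, ∃ a₀ > 0, ∀ C ≥ C₀, ∀ a > a₀, ∀ c : ℕ → ℝ,
        HierGroup.IsComparisonRate N K C a b c →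
          ((∃ β : ℕ → ℝ, (∀ n, 0 < β n ∧ β n < 1) ∧ 0 < Filter.liminf β Filter.atTop ∧
              HierGroup.EventuallyDense N K (HierGroup.connProb N c) β) ∧
            HierGroup.Percolates N (HierGroup.connProb N c) ∧
            HierGroup.UniqueInfiniteCluster N (HierGroup.connProb N c)) ∧
          (b < 2 * K - 1 / Real.log N →
            HierGroup.IsCascade N K (HierGroup.connProb N c))) ∧
    -- part (c): the model with the lower bounds as connection probabilities
    (∀ K C a b : ℝ, 0 ≤ C → 0 < a → 0 < b → b ≤ 2 / Real.log N → 2 / Real.log N < K →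
      ∀ p : ℕ → ℝ,
        (∀ n ≥ 1, ∀ j, HierGroup.scale K n < j → j ≤ HierGroup.scale K (n + 1) →
          p j = min (HierGroup.scaleRate N C a b n /
            (N : ℝ) ^ (2 * HierGroup.scale K (n + 1))) 1) →
        ¬ HierGroup.Percolates N p) := by
  have : NeZero N := ⟨by omega⟩
  have hL := HierGroup.log_pos_of_two_le hN
  refine ⟨fun hN3 C a hC ha c hc => ⟨fun ha1 => ?_, fun ha1 => ?_⟩, fun K b hK hKb => ?_,
    fun K C a b hC ha hb hb2 hK p hp => ?_⟩
  · exact HierGroup.not_percolates_of_lt_one hN3 hC ha ha1 hc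
  · exact HierGroup.prePercolates hN one_pos hC ha1 hc
  · obtain ⟨n₀, β, ε, lam, h⟩ := HierGroup.exists_renormalizable hN hK hKb
    have hK0 : 0 < K := (div_pos two_pos hL).trans hK
    have hC₀ : (0 : ℝ) < (N : ℝ) ^ (2 * HierGroup.scale K n₀) := by positivity
    refine ⟨_, hC₀, 1, one_pos, fun C hC a ha c hc => ?_⟩
    have hr := h C a hC (le_of_lt ha) c hc
    refine ⟨⟨⟨fun _ => 1 / 2, fun _ => by norm_num, ?_, hr.eventuallyDense⟩, hr.percolates hN,
      hr.uniqueInfiniteCluster hN⟩, fun hb => hr.isCascade ?_⟩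
    · rw [liminf_const]
      norm_num
    -- The cascade condition times `log N` is the summability condition for edges that jump two
    -- scales.
    · have hb' : b * Real.log N + 1 < ((2 : ℕ) : ℝ) * (K * Real.log N) := by
        have h1 := mul_lt_mul_of_pos_right hb hL
        rw [sub_mul, one_div_mul_cancel hL.ne'] at h1
        push_cast
        linarith
      have hesc := HierGroup.ae_eventually_notMem_escapeEvent hN hK0 (hC₀.le.trans hC)
        (zero_le_one.trans (le_of_lt ha)) (hK0.trans hKb).le hc 2 hb'
      filter_upwards [hesc] with u hu
      filter_upwards [hu] with n hn x hx y hy hxy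
      exact hn ⟨x, hx, y, hy, hxy⟩
  · exact HierGroup.not_percolates_of_lower_rates hN hC ha.le hb.le (hb2.trans_lt hK) hp
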